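/- Let $\mathbb S=[0,1]/{\sim}$ be the circle. For $\gamma\in W^{1,1}(\mathbb S,\mathbb R^2)$ put $\mathcal L(\gamma)=\int_0^1|\gamma'|\,du$, and when $\mathcal L(\gamma)\neq0$ put $\xi_\gamma(u)=\mathcal L(\gamma)^{-1}\int_0^u|\gamma'|$. For $\lambda>0$ let $$\mathcal G^\lambda(x)=-\frac{\cosh\big((|x|-\tfrac12)/\lambda\big)}{2\lambda\sinh(1/(2\lambda))}\qquad(|x|\le 1),$$ and, for $a\in\mathbb R$, define $F_{\lambda,a}(\gamma)=0$ if $\mathcal L(\gamma)=0$ and otherwise $$F_{\lambda,a}(\gamma)(u)=-\frac{\mathcal L(\gamma)^{a-2}}{\lambda^2}\Big(\gamma(u)+\int_0^1\gamma(v)\,\mathcal G^\lambda\big(\xi_\gamma(v)-\xi_\gamma(u)\big)\frac{|\gamma'(v)|}{\mathcal L(\gamma)}\,dv\Big).$$ This is minus the gradient of $\mathcal L$ for the metric $\mathcal L(\gamma)^{-a}\langle v,w\rangle_{L^2(\gamma)}+\lambda^2\mathcal L(\gamma)^{2-a}\big\langle \tfrac{v'}{|\gamma'|},\tfrac{w'}{|\gamma'|}\big\rangle_{L^2(\gamma)}$,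 where $\langle v,w\rangle_{L^2(\gamma)}=\int_0^1\langle v,w\rangle|\gamma'|\,du$. Call $\partial_tX=F_{\lambda,a}(X)$ the flow (GFa), and (GF2) its case $a=2$. **Theorem.** Let $\lambda>0$. (v) Let $X_0\in C^1(\mathbb S,\mathbb R^2)$ be an immersion. Then (GF2) has a solution $X\in C^1([0,\infty),C^1(\mathbb S,\mathbb R^2))$ with $X(0)=X_0$. It is unique, also among $W^{1,1}$ solutions: every solution $Y\in C^1([0,T'),W^{1,1}(\mathbb S,\mathbb R^2))$ of (GF2) with $Y(0)=X_0$ equals $X$ on $[0,T')$. For every $t\ge0$ the curve $X(\cdot,t)$ is an immersion, and $$|X_u(u,t)|^2\ \ge\ |X_u(u,0)|^2\,e^{-4t/\lambda^2}\qquad(u\in\mathbb S).$$ (vi) Let $X_0\in C^2(\mathbb S,\mathbb R^2)$ be an immersion such that $X_0(\mathbb S)$ is the boundary of a strictly convex domain. Then (GF2) has a solution $X\in C^1([0,\infty),C^2(\mathbb S,\mathbb R^2))$ with $X(0)=X_0$, unique in the same sense. For every $t\ge0$ the curve $X(\cdot,t)$ is an immersion and $X(\mathbb S,t)$ is the boundary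 of a convex set. If $k$ denotes the curvature of $X(\cdot,t)$ with the sign (one for all $u$ and $t$) for which $k(\cdot,0)\ge0$, then $$k(u,t)\ \ge\ k(u,0)\,e^{-t/\lambda^2}\qquad(u\in\mathbb S,\ t\ge0).$$ Moreover, in (v) and in (vi), for every $a\in\mathbb R$ there are $T\in(0,\infty]$, with $T=\infty$ if $a\ge2$, and an increasing bijection $\varphi:[0,T)\to[0,\infty)$ with $\varphi(0)=0$ and $\varphi'(t)=\mathcal L(X(\cdot,\varphi(t)))^{a-2}$, such that $Z(u,t)=X(u,\varphi(t))$ is a solution of (GFa) in $C^1([0,T),C^1(\mathbb S,\mathbb R^2))$, respectively $C^1([0,T),C^2(\mathbb S,\mathbb R^2))$, of positive length. Every $W^{1,1}$ solution of (GFa) on an interval $[0,T')$ with initial value $X_0$ agrees with $Z$ on $[0,\min(T,T'))$, and if it has positive length on $[0,T')$ then $T'\le T$. For every $t\in[0,T)$ the curve $Z(\cdot,t)$ is an immersion. In case (v), $|Z_u(u,t)|^2\ge|Z_u(u,0)|^2e^{-4\varphi(t)/\lambda^2}$ for all $u\in\mathbb S$ and $t\in[0,T)$. In case (vi), $Z(\mathbb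 S,t)$ is the boundary of a convex set and, with $k$ now the curvature of $Z(\cdot,t)$ with the same sign, $k(u,t)\ge k(u,0)e^{-\varphi(t)/\lambda^2}$ for all $u\in\mathbb S$ and $t\in[0,T)$. -/

import Mathlib

open MeasureTheory Set

noncomputable section

namespace SobolevLengthFlow

/-- The Euclidean plane. -/
abbrev Plane : Type := EuclideanSpace ℝ (Fin 2)

/-! ### Spaces of closed curves on the circle `[0,1]/∼` -/

/-- The space `C^k(𝕊, ℝ²)` inside a product of spaces of continuous functions: an element is the family `(γ, γ', …, γ^(k))` of continuous
functions on the circle, each one being the derivative of the preceding one. The norm, inherited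
from the product, is the maximum of the sup norms of `γ, γ', …, γ^(k)`. -/
def ckSubmodule (k : ℕ) : Submodule ℝ (Fin (k + 1) → C(UnitAddCircle, Plane)) where
  carrier := {γ | ∀ (j : Fin k) (x : ℝ),
    HasDerivAt (fun y : ℝ => γ j.castSucc (y : UnitAddCircle))
      (γ j.succ (x : UnitAddCircle)) x}
  add_mem' := fun hγ hβ j x => (hγ j x).add (hβ j x)
  zero_mem' := fun _ x => hasDerivAt_const x 0
  smul_mem' := fun c _ hγ j x => (hγ j x).const_smul c

/-- The Banach space `C^k(𝕊, ℝ²)`. -/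
abbrev CkLoop (k : ℕ) : Type := ckSubmodule k

/-- The `j`-th derivative `γ^(j)` of a `C^k` curve, `j ≤ k` (`j = 0` is the curve itself). -/
def CkLoop.jet {k : ℕ} (γ : CkLoop k) (j : Fin (k + 1)) : C(UnitAddCircle, Plane) :=
  (γ : Fin (k + 1) → C(UnitAddCircle, Plane)) j

theorem integrable_restrict_of_Lp
    (g : Lp Plane 1 (volume.restrict (Ioc (0 : ℝ) 1))) {x : ℝ} (hx : x ∈ Icc (0 : ℝ) 1) :
    Integrable (fun s => g s) (volume.restrict (Ioc (0 : ℝ) x)) :=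
  (L1.integrable_coeFn g).mono_measure
    (Measure.restrict_mono (Ioc_subset_Ioc_right hx.2) le_rfl)

theorem ae_restrict_of_ae_restrict_unit {p : ℝ → Prop}
    (h : ∀ᵐ s ∂(volume.restrict (Ioc (0 : ℝ) 1)), p s) {x : ℝ} (hx : x ∈ Icc (0 : ℝ) 1) :
    ∀ᵐ s ∂(volume.restrict (Ioc (0 : ℝ) x)), p s :=
  ae_mono (Measure.restrict_mono (Ioc_subset_Ioc_right hx.2) le_rfl) h

/-- The space `W^{1,1}(𝕊, ℝ²)` inside a product of Banach spaces: an element is a pair `(γ, γ')` of the (absolutely)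
continuous representative and its weak derivative in `L¹(0,1)`, linked by
`γ(x) = γ(0) + ∫₀ˣ γ'`. The inherited norm `max (sup |γ|) (‖γ'‖_{L¹})` is equivalent to
`‖γ‖_{L¹} + ‖γ'‖_{L¹}`. -/
def w11Submodule : Submodule ℝ
    (C(UnitAddCircle, Plane) × Lp Plane 1 (volume.restrict (Ioc (0 : ℝ) 1))) where
  carrier := {γ | ∀ x ∈ Icc (0 : ℝ) 1,
    γ.1 (x : UnitAddCircle) - γ.1 ((0 : ℝ) : UnitAddCircle) = ∫ s in (0 : ℝ)..x, γ.2 s}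
  add_mem' := by
    intro γ β hγ hβ x hx
    have h := ae_restrict_of_ae_restrict_unit (Lp.coeFn_add γ.2 β.2) hx
    have h1 := hγ x hx
    have h2 := hβ x hx
    rw [intervalIntegral.integral_of_le hx.1] at h1 h2 ⊢
    rw [Prod.snd_add, integral_congr_ae h]
    simp only [Pi.add_apply]
    rw [integral_add (integrable_restrict_of_Lp γ.2 hx) (integrable_restrict_of_Lp β.2 hx),
      ← h1, ← h2]
    simp only [Prod.fst_add, ContinuousMap.add_apply]
    abel
  zero_mem' := by
    intro x hx
    have h := ae_restrict_of_ae_restrict_unit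
      (Lp.coeFn_zero Plane 1 (volume.restrict (Ioc (0 : ℝ) 1))) hx
    rw [intervalIntegral.integral_of_le hx.1, Prod.snd_zero, integral_congr_ae h]
    simp
  smul_mem' := by
    intro c γ hγ x hx
    have h := ae_restrict_of_ae_restrict_unit (Lp.coeFn_smul c γ.2) hx
    have h1 := hγ x hx
    rw [intervalIntegral.integral_of_le hx.1] at h1 ⊢
    rw [Prod.smul_snd, integral_congr_ae h]
    simp only [Pi.smul_apply]
    rw [integral_smul, ← h1]
    simp only [Prod.smul_fst, ContinuousMap.smul_apply, smul_sub]

/-- The Banach space `W^{1,1}(𝕊, ℝ²)`. -/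
abbrev W11Loop : Type := w11Submodule

/-- The continuous representative of a `W^{1,1}` curve. -/
def W11Loop.curve (γ : W11Loop) : C(UnitAddCircle, Plane) :=
  (γ : C(UnitAddCircle, Plane) × Lp Plane 1 (volume.restrict (Ioc (0 : ℝ) 1))).1

/-- The weak derivative of a `W^{1,1}` curve, as a function on `(0,1]` (defined a.e.). -/
def W11Loop.weakDeriv (γ : W11Loop) : Lp Plane 1 (volume.restrict (Ioc (0 : ℝ) 1)) :=
  (γ : C(UnitAddCircle, Plane) × Lp Plane 1 (volume.restrict (Ioc (0 : ℝ) 1))).2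

/-! ### Length and the gradient vector field

A curve enters below through the functions `γ` and `dγ = γ'` on `[0,1]`. -/

/-- The length `𝓛(γ) = ∫₀¹ |γ'(u)| du`. -/
def length (dγ : ℝ → Plane) : ℝ := ∫ u in (0 : ℝ)..1, ‖dγ u‖

/-- Normalised arc length `ξ_γ(u) = 𝓛(γ)⁻¹ ∫₀ᵘ |γ'|`. -/
def arc (dγ : ℝ → Plane) (u : ℝ) : ℝ := (∫ s in (0 : ℝ)..u, ‖dγ s‖) / length dγ

/-- The periodic Green's function `𝒢^lam` of `lam² ∂² - 1`, as an explicit function on `[-1,1]`. -/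
def green (lam x : ℝ) : ℝ :=
  -(Real.cosh ((|x| - 1 / 2) / lam) / (2 * lam * Real.sinh (1 / (2 * lam))))

/-- The convolution
`(γ ∗_γ 𝒢^lam)(u) = ∫₀¹ γ(v) 𝒢^lam(ξ_γ(v) - ξ_γ(u)) |γ'(v)| / 𝓛(γ) dv`. -/
def greenConv (lam : ℝ) (γ dγ : ℝ → Plane) (u : ℝ) : Plane :=
  ∫ v in (0 : ℝ)..1, (green lam (arc dγ v - arc dγ u) * (‖dγ v‖ / length dγ)) • γ v

/-- The gradient `∇𝓛_{lam,a}(γ) = (𝓛(γ)^(a-2) / lam²) (γ + γ ∗_γ 𝒢^lam)`. -/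
def gradLength (lam a : ℝ) (γ dγ : ℝ → Plane) (u : ℝ) : Plane :=
  (length dγ ^ (a - 2) / lam ^ 2) • (γ u + greenConv lam γ dγ u)

open Classical in
/-- The vector field `F_{lam,a}`: minus the gradient, and zero on curves of length zero. -/
def flowField (lam a : ℝ) (γ dγ : ℝ → Plane) (u : ℝ) : Plane :=
  if length dγ = 0 then 0 else -gradLength lam a γ dγ u

/-- The length of a curve of class `C^(n+1)`. -/
def CkLoop.len {n : ℕ} (γ : CkLoop (n + 1)) : ℝ :=
  length (fun x : ℝ => γ.jet 1 (x : UnitAddCircle))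

/-- The length of a curve of class `W^{1,1}`. -/
def W11Loop.len (γ : W11Loop) : ℝ := length (fun x : ℝ => γ.weakDeriv x)

/-! ### Solutions -/

/-- The time interval `[0,T)`, with `T = ⊤` for `[0,∞)`. -/
def timeInterval (T : EReal) : Set ℝ := {t | 0 ≤ t ∧ (t : EReal) < T}

/-- `X ∈ C¹([0,T), C^(n+1)(𝕊, ℝ²))` solves `∂ₜX = F_{lam,a}(X)`. -/
def IsCkFlow {n : ℕ} (lam a : ℝ) (T : EReal) (X : ℝ → CkLoop (n + 1)) : Prop :=
  ContDiffOn ℝ 1 X (timeInterval T) ∧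
  ∀ t ∈ timeInterval T, ∀ u ∈ Icc (0 : ℝ) 1,
    HasDerivWithinAt (fun s : ℝ => (X s).jet 0 (u : UnitAddCircle))
      (flowField lam a (fun x : ℝ => (X t).jet 0 (x : UnitAddCircle))
        (fun x : ℝ => (X t).jet 1 (x : UnitAddCircle)) u)
      (timeInterval T) t

/-- `X ∈ C¹([0,T), W^{1,1}(𝕊, ℝ²))` solves `∂ₜX = F_{lam,a}(X)`. -/
def IsW11Flow (lam a : ℝ) (T : EReal) (X : ℝ → W11Loop) : Prop :=
  ContDiffOn ℝ 1 X (timeInterval T) ∧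
  ∀ t ∈ timeInterval T, ∀ u ∈ Icc (0 : ℝ) 1,
    HasDerivWithinAt (fun s : ℝ => (X s).curve (u : UnitAddCircle))
      (flowField lam a (fun x : ℝ => (X t).curve (x : UnitAddCircle))
        (fun x : ℝ => (X t).weakDeriv x) u)
      (timeInterval T) t

/-- `X` is the global solution of the flow with `a = 2` in `C¹([0,∞), C^(n+1))` starting at `X₀`;
it coincides with every `W^{1,1}` solution with the same initial curve, as long as that exists. -/
def IsTheGlobalFlow {n : ℕ} (lam : ℝ) (X₀ : CkLoop (n + 1)) (X : ℝ → CkLoop (n + 1)) : Prop :=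
  X 0 = X₀ ∧ IsCkFlow lam 2 ⊤ X ∧
  ∀ (T : EReal) (Y : ℝ → W11Loop), IsW11Flow lam 2 T Y → (Y 0).curve = X₀.jet 0 →
    ∀ t ∈ timeInterval T, (Y t).curve = (X t).jet 0

/-- `φ` is an increasing bijection of `[0,T)` onto `[0,∞)` with `φ(0) = 0`,
`φ'(t) = 𝓛(X(φ(t)))^(a-2)`. -/
def IsTimeChange {n : ℕ} (a : ℝ) (X : ℝ → CkLoop (n + 1)) (T : EReal) (φ : ℝ → ℝ) : Prop :=
  φ 0 = 0 ∧ StrictMonoOn φ (timeInterval T) ∧ BijOn φ (timeInterval T) (Ici 0) ∧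
  ∀ t ∈ timeInterval T, HasDerivWithinAt φ ((X (φ t)).len ^ (a - 2)) (timeInterval T) t

/-- `Z` is the solution of the flow with parameter `a` in `C¹([0,T), C^(n+1))` starting at `X₀`:
every `W^{1,1}` solution with the same initial curve coincides with it on the common interval of
existence, and `[0,T)` is the longest interval carrying a solution of positive length. -/
def IsTheMaximalFlow {n : ℕ} (lam a : ℝ) (X₀ : CkLoop (n + 1)) (T : EReal)
    (Z : ℝ → CkLoop (n + 1)) : Prop :=
  0 < T ∧ Z 0 = X₀ ∧ IsCkFlow lam a T Z ∧ (∀ t ∈ timeInterval T, 0 < (Z t).len) ∧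
  ∀ (T' : EReal) (Y : ℝ → W11Loop), IsW11Flow lam a T' Y → (Y 0).curve = X₀.jet 0 →
    (∀ t ∈ timeInterval T ∩ timeInterval T', (Y t).curve = (Z t).jet 0) ∧
    ((∀ t ∈ timeInterval T', 0 < (Y t).len) → T' ≤ T)

/-! ### Geometry of curves -/

/-- The curve is an immersion. -/
def IsImmersed {n : ℕ} (γ : CkLoop (n + 1)) : Prop := ∀ u, γ.jet 1 u ≠ 0

/-- `|γ'(u)|² ≥ |β'(u)|² c` for all `u`. -/
def SpeedSqBound {n : ℕ} (γ β : CkLoop (n + 1)) (c : ℝ) : Prop :=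
  ∀ u, ‖β.jet 1 u‖ ^ 2 * c ≤ ‖γ.jet 1 u‖ ^ 2

/-- The signed curvature `det(γ', γ'') / |γ'|³` of a `C²` curve. -/
def signedCurvature (γ : CkLoop 2) (u : UnitAddCircle) : ℝ :=
  (γ.jet 1 u 0 * γ.jet 2 u 1 - γ.jet 1 u 1 * γ.jet 2 u 0) / ‖γ.jet 1 u‖ ^ 3

/-- The image of the curve is the boundary of a strictly convex domain. Strict convexity is asked
of the closure: every open segment between two distinct points of the closed domain lies in the
interior. -/
def BoundsStrictlyConvexDomain {k : ℕ} (γ : CkLoop k) : Prop :=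
  ∃ Ω : Set Plane, IsOpen Ω ∧ Ω.Nonempty ∧ Convex ℝ Ω ∧ StrictConvex ℝ (closure Ω) ∧
    frontier Ω = range (γ.jet 0)

/-- The image of the curve is the boundary of a convex set. -/
def BoundsConvexSet {k : ℕ} (γ : CkLoop k) : Prop :=
  ∃ K : Set Plane, Convex ℝ K ∧ frontier K = range (γ.jet 0)

end SobolevLengthFlow

end

/-!
For `a = 2` the vector field is `lam⁻² (P - X)`, where `P` is the position averaged over the curve
with the positive kernel `-𝒢` in arc length, a kernel of total mass one. Its derivative is
`P_u = |X_u| N`, where `N` is the unit tangent averaged with the same kernel, so that `|N| ≤ 1`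
(`conv_position_sub`, `CkLoop.hasDerivAt_smoothed`). As the kernel is the periodic Green's function
of `1 - lam² ∂²`, the derivative of `N` is again a multiple of `P - X`
(`hasDerivAt_shiftConv_tangent`). Hence the flow loses no derivatives and is an ordinary
differential equation: its field is locally Lipschitz on `W^{1,1}` loops of positive length
(`W11Loop.field_locally_lipschitz`), which gives uniqueness (`IsW11Flow.unique`), and Lipschitz on
bounded sets of `C¹` or `C²` loops with speed bounded from below (`exists_bounds_fieldOne`,
`exists_bounds_fieldTwo`). From `|N| ≤ 1` the quantity `|X_u|²` decreases, at a rate of at most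
`4 / lam²` (`IsFlowField.inner_bounds`). This is the claim on the speed, it keeps the curve
immersed, and together with linear growth in the second derivative it supplies the a priori bounds
that make solutions global (`exists_global_one`, `exists_global_two`).

The curvature `k` satisfies `lam² k_t = (1 - 2⟨N, T⟩) k + G` with `T` the unit tangent
(`hasDerivWithinAt_curvature`), where `G` is a positive multiple of the component of `P - X` on the
inner side of the tangent line. If the curve lies on the inner side of all its tangents
(`ChordCondition`), then so does every average of its points, strictly
(`ChordCondition.smoothed_pos`); therefore `G > 0`, and `exp (t / lam²) k` is nondecreasing as long
as `k ≥ 0`. Conversely, a closed arc with `k ≥ 0` that turns exactly once lies on the inner side of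
the tangent at its endpoint (`wedge_nonneg_of_turning`). Both implications combine to a continuous
induction in time (`chordCondition_of_flow`), and the chord condition makes the curve the boundary
of a convex set (`ChordCondition.boundsConvexSet`).

The hypothesis concerns the image of the initial curve only, which may be traversed several times.
A strictly convex curve is then invariant under changes of parameter that move each point by full
turns of the tangent (`exists_deck`). Uniqueness makes this invariance persist along the flow
(`IsCircleDiffeo.invariant`), so the turning angle between a point and its next copy is always an
integer multiple of `2π`; it depends continuously on time and stays `2π`.

The fields for other values of `a` differ by the factor `𝓛^(a-2)`, so their solutions arise by a
change of time, the inverse of the clock `∫ 𝓛^(2-a)` (`exists_timeChange`).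
-/

open MeasureTheory Set

noncomputable section

namespace SobolevLengthFlow

open Filter Topology
open scoped NNReal

/-! ### The convolution kernel -/

/-- The positive kernel `-𝒢^lam`, the periodic Green's function of `1 - lam² ∂²` on `[-1,1]`. -/
def kernel (lam x : ℝ) : ℝ := -green lam x

theorem kernel_eq (lam x : ℝ) : kernel lam x =
    Real.cosh ((|x| - 1 / 2) / lam) / (2 * lam * Real.sinh (1 / (2 * lam))) := by
  simp [kernel, green]

theorem kernel_den_pos {lam : ℝ} (hlam : 0 < lam) : 0 < 2 * lam * Real.sinh (1 / (2 * lam)) := by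
  have : 0 < Real.sinh (1 / (2 * lam)) := Real.sinh_pos_iff.2 (by positivity)
  positivity

theorem kernel_pos {lam : ℝ} (hlam : 0 < lam) (x : ℝ) : 0 < kernel lam x := by
  rw [kernel_eq]
  exact div_pos (Real.cosh_pos _) (kernel_den_pos hlam)

@[fun_prop]
theorem kernel_continuous (lam : ℝ) : Continuous (kernel lam) := by
  have : kernel lam = fun x => Real.cosh ((|x| - 1 / 2) / lam) /
      (2 * lam * Real.sinh (1 / (2 * lam))) := funext (kernel_eq lam)
  rw [this]
  fun_prop

theorem kernel_neg (lam x : ℝ) : kernel lam (-x) = kernel lam x := by simp [kernel_eq]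

theorem kernel_sub_comm (lam x y : ℝ) : kernel lam (x - y) = kernel lam (y - x) := by
  rw [← kernel_neg, neg_sub]

theorem kernel_one_sub (lam : ℝ) {x : ℝ} (hx : x ∈ Icc (0 : ℝ) 1) :
    kernel lam (1 - x) = kernel lam x := by
  rw [kernel_eq, kernel_eq, abs_of_nonneg hx.1, abs_of_nonneg (by linarith [hx.2]),
    ← Real.cosh_neg]
  congr 2
  ring

theorem integral_kernel {lam : ℝ} (hlam : 0 < lam) : ∫ x in (0 : ℝ)..1, kernel lam x = 1 := by
  have hD := kernel_den_pos hlam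
  have h1 : ∀ x ∈ uIcc (0 : ℝ) 1, HasDerivAt
      (fun y => lam * Real.sinh ((y - 1 / 2) / lam) / (2 * lam * Real.sinh (1 / (2 * lam))))
      (Real.cosh ((x - 1 / 2) / lam) / (2 * lam * Real.sinh (1 / (2 * lam)))) x := by
    intro x _
    have h2 : HasDerivAt (fun y : ℝ => (y - 1 / 2) / lam) (1 / lam) x :=
      ((hasDerivAt_id x).sub_const _).div_const _
    have h3 := ((h2.sinh).const_mul lam).div_const (2 * lam * Real.sinh (1 / (2 * lam)))
    rwa [mul_one_div, mul_div_cancel₀ _ hlam.ne'] at h3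
  have h4 : ∫ x in (0 : ℝ)..1, kernel lam x = ∫ x in (0 : ℝ)..1,
      Real.cosh ((x - 1 / 2) / lam) / (2 * lam * Real.sinh (1 / (2 * lam))) := by
    apply intervalIntegral.integral_congr
    intro x hx
    rw [uIcc_of_le zero_le_one] at hx
    simp only [kernel_eq, abs_of_nonneg hx.1]
  rw [h4, intervalIntegral.integral_eq_sub_of_hasDerivAt h1
    (Continuous.intervalIntegrable (by fun_prop) _ _)]
  have h5 : Real.sinh ((0 - 1 / 2) / lam) = -Real.sinh (1 / (2 * lam)) := by
    rw [← Real.sinh_neg]; congr 1; field_simp; ring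
  have h6 : ((1 : ℝ) - 1 / 2) / lam = 1 / (2 * lam) := by field_simp; ring
  rw [h5, h6]
  have : Real.sinh (1 / (2 * lam)) ≠ 0 := (Real.sinh_pos_iff.2 (by positivity)).ne'
  field_simp
  ring

theorem exists_kernel_bound (lam : ℝ) : ∃ C : ℝ, 0 < C ∧
    (∀ x, |x| ≤ 1 → |kernel lam x| ≤ C) ∧
    ∀ x y, |x| ≤ 1 → |y| ≤ 1 → |kernel lam x - kernel lam y| ≤ C * |x - y| := by
  obtain ⟨B, hB⟩ := (isCompact_Icc (a := (-1 : ℝ)) (b := 1)).exists_bound_of_continuousOn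
    (kernel_continuous lam).continuousOn
  have hc : ContDiffOn ℝ 1 (fun y : ℝ => Real.cosh ((y - 1 / 2) / lam) /
      (2 * lam * Real.sinh (1 / (2 * lam)))) (Icc 0 1) := by
    apply ContDiff.contDiffOn
    have : ContDiff ℝ 1 (fun y : ℝ => Real.cosh ((y - 1 / 2) / lam)) :=
      Real.contDiff_cosh.comp ((contDiff_id.sub contDiff_const).div_const _)
    exact this.div_const _
  obtain ⟨K, hK⟩ := hc.exists_lipschitzOnWith (by decide) (convex_Icc _ _) isCompact_Icc
  refine ⟨max B K + 1, ?_, ?_, ?_⟩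
  · have := le_max_right B (K : ℝ)
    have := K.coe_nonneg
    linarith
  · intro x hx
    exact ((hB x (abs_le.1 hx)).trans (le_max_left _ _)).trans (by linarith)
  · intro x y hx hy
    have h1 := hK.dist_le_mul (|x|) ⟨abs_nonneg x, hx⟩ (|y|) ⟨abs_nonneg y, hy⟩
    rw [Real.dist_eq, Real.dist_eq] at h1
    rw [kernel_eq, kernel_eq]
    calc _ ≤ _ := h1
      _ ≤ K * |x - y| := mul_le_mul_of_nonneg_left (abs_abs_sub_abs_le x y) K.coe_nonneg
      _ ≤ _ := by gcongr; linarith [le_max_right B (K : ℝ)]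

/-- The primitive of the kernel that vanishes at `0`. -/
def kernelPrim (lam x : ℝ) : ℝ := ∫ y in (0 : ℝ)..x, kernel lam y

theorem hasDerivAt_kernelPrim (lam x : ℝ) : HasDerivAt (kernelPrim lam) (kernel lam x) x :=
  intervalIntegral.integral_hasDerivAt_right ((kernel_continuous lam).intervalIntegrable _ _)
    (kernel_continuous lam).stronglyMeasurable.stronglyMeasurableAtFilter
    (kernel_continuous lam).continuousAt

theorem kernelPrim_continuous (lam : ℝ) : Continuous (kernelPrim lam) :=
  continuous_iff_continuousAt.2 fun x => (hasDerivAt_kernelPrim lam x).continuousAt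

theorem kernelPrim_neg (lam x : ℝ) : kernelPrim lam (-x) = -kernelPrim lam x := by
  have h : ∫ y in (0 : ℝ)..(-x), kernel lam y = ∫ y in (0 : ℝ)..(-x), kernel lam (-y) := by
    simp only [kernel_neg]
  rw [kernelPrim, h, intervalIntegral.integral_comp_neg, neg_neg, neg_zero,
    intervalIntegral.integral_symm, kernelPrim]

theorem kernelPrim_one_sub {lam : ℝ} (hlam : 0 < lam) {x : ℝ} (hx : x ∈ Icc (0 : ℝ) 1) :
    kernelPrim lam (1 - x) - kernelPrim lam (-x) = 1 := by
  have h : ∫ y in (0 : ℝ)..(1 - x), kernel lam y = ∫ y in x..1, kernel lam y := by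
    have h1 : ∫ y in x..1, kernel lam (1 - y) = ∫ y in (0 : ℝ)..(1 - x), kernel lam y := by
      rw [intervalIntegral.integral_comp_sub_left (fun y => kernel lam y) 1, sub_self]
    rw [← h1]
    apply intervalIntegral.integral_congr
    intro y hy
    rw [uIcc_of_le hx.2] at hy
    exact kernel_one_sub lam ⟨hx.1.trans hy.1, hy.2⟩
  rw [kernelPrim_neg, kernelPrim, kernelPrim, h, sub_neg_eq_add, add_comm,
    intervalIntegral.integral_add_adjacent_intervals
      ((kernel_continuous lam).intervalIntegrable _ _)
      ((kernel_continuous lam).intervalIntegrable _ _), integral_kernel hlam]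

/-! ### Arc length of an integrable velocity -/

theorem uIcc_zero_one : uIcc (0 : ℝ) 1 = Icc 0 1 := uIcc_of_le zero_le_one

theorem IntervalIntegrable.mono_unit {E : Type*} [NormedAddCommGroup E] {f : ℝ → E}
    (hf : IntervalIntegrable f volume 0 1) {a b : ℝ} (ha : a ∈ Icc (0 : ℝ) 1)
    (hb : b ∈ Icc (0 : ℝ) 1) : IntervalIntegrable f volume a b := by
  refine hf.mono_set ?_
  rw [uIcc_zero_one]
  exact uIcc_subset_Icc ha hb

section Arc

variable {V V₁ V₂ w w₁ w₂ γ : ℝ → Plane} {lam : ℝ}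

theorem length_nonneg (V : ℝ → Plane) : 0 ≤ length V :=
  intervalIntegral.integral_nonneg zero_le_one fun _ _ => norm_nonneg _

theorem arc_zero (V : ℝ → Plane) : arc V 0 = 0 := by simp [arc]

theorem arc_one (hL : 0 < length V) : arc V 1 = 1 := div_self hL.ne'

theorem arc_sub_eq (hV : IntervalIntegrable V volume 0 1) {a b : ℝ} (ha : a ∈ Icc (0 : ℝ) 1)
    (hb : b ∈ Icc (0 : ℝ) 1) : arc V b - arc V a = (∫ s in a..b, ‖V s‖) / length V := by
  have h0 : (0 : ℝ) ∈ Icc (0 : ℝ) 1 := ⟨le_rfl, zero_le_one⟩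
  rw [arc, arc, ← sub_div, intervalIntegral.integral_interval_sub_left
    (IntervalIntegrable.mono_unit hV.norm h0 hb) (IntervalIntegrable.mono_unit hV.norm h0 ha)]

theorem arc_monotoneOn (hV : IntervalIntegrable V volume 0 1) : MonotoneOn (arc V) (Icc 0 1) := by
  intro a ha b hb hab
  rw [← sub_nonneg, arc_sub_eq hV ha hb]
  exact div_nonneg (intervalIntegral.integral_nonneg hab fun _ _ => norm_nonneg _)
    (length_nonneg V)

theorem arc_mem (hV : IntervalIntegrable V volume 0 1) (hL : 0 < length V) {u : ℝ}
    (hu : u ∈ Icc (0 : ℝ) 1) : arc V u ∈ Icc (0 : ℝ) 1 := by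
  constructor
  · rw [← arc_zero V]; exact arc_monotoneOn hV ⟨le_rfl, zero_le_one⟩ hu hu.1
  · rw [← arc_one hL]; exact arc_monotoneOn hV hu ⟨zero_le_one, le_rfl⟩ hu.2

theorem abs_arc_sub_le_one (hV : IntervalIntegrable V volume 0 1) (hL : 0 < length V) {u v : ℝ}
    (hu : u ∈ Icc (0 : ℝ) 1) (hv : v ∈ Icc (0 : ℝ) 1) : |arc V v - arc V u| ≤ 1 := by
  have h1 := arc_mem hV hL hu
  have h2 := arc_mem hV hL hv
  rw [abs_le]
  constructor <;> linarith [h1.1, h1.2, h2.1, h2.2]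

theorem arc_continuousOn (hV : IntervalIntegrable V volume 0 1) :
    ContinuousOn (arc V) (Icc 0 1) := by
  have := intervalIntegral.continuousOn_primitive_interval'
    (μ := volume) hV.norm (a := 0) (by simp)
  rw [uIcc_zero_one] at this
  exact this.div_const _

theorem integral_speed_div (hL : 0 < length V) : ∫ v in (0 : ℝ)..1, ‖V v‖ / length V = 1 := by
  rw [intervalIntegral.integral_div]
  exact div_self hL.ne'

theorem kernel_arc_continuousOn (hV : IntervalIntegrable V volume 0 1) (u : ℝ) :
    ContinuousOn (fun v => kernel lam (arc V v - arc V u)) (uIcc 0 1) := by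
  rw [uIcc_zero_one]
  exact (kernel_continuous lam).comp_continuousOn ((arc_continuousOn hV).sub continuousOn_const)

/-- The chain rule for the composition of a `C¹` function with the (merely absolutely
continuous) arc length. -/
theorem integral_comp_arc (hV : IntervalIntegrable V volume 0 1) {F f : ℝ → ℝ}
    (hF : ∀ x, HasDerivAt F (f x) x) (hf : Continuous f) {a b : ℝ} (ha : a ∈ Icc (0 : ℝ) 1)
    (hb : b ∈ Icc (0 : ℝ) 1) :
    ∫ v in a..b, f (arc V v) * (‖V v‖ / length V) = F (arc V b) - F (arc V a) := by
  have hr : IntervalIntegrable (fun v => ‖V v‖ / length V) volume 0 1 := hV.norm.div_const _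
  have hfr : IntervalIntegrable (fun v => f (arc V v) * (‖V v‖ / length V)) volume 0 1 :=
    hr.continuousOn_mul (by
      rw [uIcc_zero_one]; exact hf.comp_continuousOn (arc_continuousOn hV))
  have h0 : (0 : ℝ) ∈ uIcc (0 : ℝ) 1 := by simp
  have hAarc : AbsolutelyContinuousOnInterval (arc V) 0 1 := by
    have h := hV.norm.absolutelyContinuousOnInterval_intervalIntegral h0
    have h2 : arc V = fun u => (length V)⁻¹ * ∫ v in (0 : ℝ)..u, ‖V v‖ := by
      funext u
      rw [arc, div_eq_inv_mul]
    rw [h2]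
    exact h.const_mul _
  have hFc : ContDiff ℝ 1 F := by
    rw [contDiff_one_iff_deriv]
    refine ⟨fun x => (hF x).differentiableAt, ?_⟩
    rwa [funext fun x => (hF x).deriv]
  obtain ⟨B, hB⟩ := hAarc.exists_bound
  have hAF : AbsolutelyContinuousOnInterval (fun v => F (arc V v)) 0 1 := by
    obtain ⟨K, hK⟩ := hFc.contDiffOn.exists_lipschitzOnWith (by decide)
      (convex_Icc (-B) B) isCompact_Icc
    rw [absolutelyContinuousOnInterval_iff] at hAarc ⊢
    intro ε hε
    obtain ⟨δ, hδ, h⟩ := hAarc (ε / (K + 1)) (by positivity)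
    refine ⟨δ, hδ, fun E hE hEδ => ?_⟩
    have h1 := h E hE hEδ
    have h2 : ∑ i ∈ Finset.range E.1, dist (F (arc V (E.2 i).1)) (F (arc V (E.2 i).2)) ≤
        K * ∑ i ∈ Finset.range E.1, dist (arc V (E.2 i).1) (arc V (E.2 i).2) := by
      rw [Finset.mul_sum]
      apply Finset.sum_le_sum
      intro i hi
      have hE1 := hE.1 i hi
      exact hK.dist_le_mul _ (abs_le.1 (hB _ hE1.1)) _ (abs_le.1 (hB _ hE1.2))
    calc _ ≤ _ := h2
      _ ≤ K * (ε / (K + 1)) := by gcongr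
      _ < (K + 1) * (ε / (K + 1)) := by
        apply mul_lt_mul_of_pos_right _ (by positivity); linarith
      _ = ε := by field_simp
  have hAI := hfr.absolutelyContinuousOnInterval_intervalIntegral h0
  obtain ⟨C, hC⟩ := (hAF.fun_sub hAI).const_of_ae_hasDerivAt_zero (by
    filter_upwards [hfr.ae_hasDerivAt_integral, hr.ae_hasDerivAt_integral] with x hx1 hx2 hx
    have e1 := hx1 hx 0 h0
    have e2 := hx2 hx 0 h0
    have e3 : HasDerivAt (arc V) (‖V x‖ / length V) x := by
      have h3 : arc V = fun u => ∫ v in (0 : ℝ)..u, ‖V v‖ / length V :=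
        funext fun u => (intervalIntegral.integral_div _ _).symm
      rwa [h3]
    have e4 := ((hF (arc V x)).comp x e3).sub e1
    rwa [sub_self] at e4)
  rw [← uIcc_zero_one] at ha hb
  have h1 := hC a ha
  have h2 := hC b hb
  rw [uIcc_zero_one] at ha hb
  have h3 := intervalIntegral.integral_interval_sub_left
    (IntervalIntegrable.mono_unit hfr ⟨le_rfl, zero_le_one⟩ hb)
    (IntervalIntegrable.mono_unit hfr ⟨le_rfl, zero_le_one⟩ ha)
  rw [← h3]
  linarith

theorem integral_kernel_arc_sub (hV : IntervalIntegrable V volume 0 1) (c : ℝ) {a b : ℝ}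
    (ha : a ∈ Icc (0 : ℝ) 1) (hb : b ∈ Icc (0 : ℝ) 1) :
    ∫ v in a..b, kernel lam (arc V v - c) * (‖V v‖ / length V) =
      kernelPrim lam (arc V b - c) - kernelPrim lam (arc V a - c) :=
  integral_comp_arc (F := fun x => kernelPrim lam (x - c)) (f := fun x => kernel lam (x - c)) hV
    (fun x => (hasDerivAt_kernelPrim lam (x - c)).comp_sub_const x c) (by fun_prop) ha hb

theorem integral_kernel_arc (hlam : 0 < lam) (hV : IntervalIntegrable V volume 0 1)
    (hL : 0 < length V) {u : ℝ} (hu : u ∈ Icc (0 : ℝ) 1) :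
    ∫ v in (0 : ℝ)..1, kernel lam (arc V v - arc V u) * (‖V v‖ / length V) = 1 := by
  rw [integral_kernel_arc_sub hV _ ⟨le_rfl, zero_le_one⟩ ⟨zero_le_one, le_rfl⟩, arc_zero,
    arc_one hL, zero_sub]
  exact kernelPrim_one_sub hlam (arc_mem hV hL hu)

end Arc

/-! ### Convolution along a curve -/

/-- Convolution of `w` with the kernel along the normalised arc length of a curve with velocity
`V`. With `w = |V| γ / 𝓛` this is `-γ ∗_γ 𝒢^lam`; with `w = V / 𝓛` it is the averaged unit
tangent. -/
def conv (lam : ℝ) (V w : ℝ → Plane) (u : ℝ) : Plane :=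
  ∫ v in (0 : ℝ)..1, kernel lam (arc V v - arc V u) • w v

section Conv

variable {V V₁ V₂ w w₁ w₂ γ : ℝ → Plane} {lam C : ℝ}

theorem unit_left_mem : (0 : ℝ) ∈ Icc (0 : ℝ) 1 := ⟨le_rfl, zero_le_one⟩

theorem unit_right_mem : (1 : ℝ) ∈ Icc (0 : ℝ) 1 := ⟨zero_le_one, le_rfl⟩

theorem abs_length_sub_le (h₁ : IntervalIntegrable V₁ volume 0 1)
    (h₂ : IntervalIntegrable V₂ volume 0 1) {u : ℝ} (hu : u ∈ Icc (0 : ℝ) 1) :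
    |(∫ s in (0 : ℝ)..u, ‖V₁ s‖) - ∫ s in (0 : ℝ)..u, ‖V₂ s‖| ≤
      ∫ s in (0 : ℝ)..1, ‖V₁ s - V₂ s‖ := by
  have g₁ := IntervalIntegrable.mono_unit h₁ unit_left_mem hu
  have g₂ := IntervalIntegrable.mono_unit h₂ unit_left_mem hu
  rw [← intervalIntegral.integral_sub g₁.norm g₂.norm]
  calc _ ≤ ∫ s in (0 : ℝ)..u, |‖V₁ s‖ - ‖V₂ s‖| :=
        intervalIntegral.abs_integral_le_integral_abs hu.1
    _ ≤ ∫ s in (0 : ℝ)..u, ‖V₁ s - V₂ s‖ :=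
        intervalIntegral.integral_mono_on hu.1 (g₁.norm.sub g₂.norm).abs (g₁.sub g₂).norm
          fun s _ => abs_norm_sub_norm_le _ _
    _ ≤ _ := by
        apply intervalIntegral.integral_mono_interval le_rfl hu.1 hu.2 _ (h₁.sub h₂).norm
        exact ae_of_all _ fun _ => norm_nonneg _

theorem abs_arc_sub_arc_le (h₁ : IntervalIntegrable V₁ volume 0 1)
    (h₂ : IntervalIntegrable V₂ volume 0 1) (hL₁ : 0 < length V₁) (hL₂ : 0 < length V₂) {u : ℝ}
    (hu : u ∈ Icc (0 : ℝ) 1) :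
    |arc V₁ u - arc V₂ u| ≤ 2 / length V₁ * ∫ s in (0 : ℝ)..1, ‖V₁ s - V₂ s‖ := by
  have e1 := abs_length_sub_le h₁ h₂ hu
  have e2 : |length V₂ - length V₁| ≤ ∫ s in (0 : ℝ)..1, ‖V₁ s - V₂ s‖ := by
    rw [abs_sub_comm]; exact abs_length_sub_le h₁ h₂ unit_right_mem
  have e3 := arc_mem h₂ hL₂ hu
  have e4 : arc V₁ u - arc V₂ u =
      (1 / length V₁) * (((∫ s in (0 : ℝ)..u, ‖V₁ s‖) - ∫ s in (0 : ℝ)..u, ‖V₂ s‖) +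
        arc V₂ u * (length V₂ - length V₁)) := by
    rw [arc, arc]
    field_simp
    ring
  rw [e4, abs_mul, abs_of_pos (by positivity : 0 < 1 / length V₁)]
  calc _ ≤ (1 / length V₁) * ((∫ s in (0 : ℝ)..1, ‖V₁ s - V₂ s‖) +
        1 * ∫ s in (0 : ℝ)..1, ‖V₁ s - V₂ s‖) := by
        gcongr
        refine (abs_add_le _ _).trans (add_le_add e1 ?_)
        rw [abs_mul, abs_of_nonneg e3.1]
        exact mul_le_mul e3.2 e2 (abs_nonneg _) zero_le_one
    _ = _ := by ring

theorem integral_norm_inv_smul (hL : 0 < length V) :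
    ∫ v in (0 : ℝ)..1, ‖(length V)⁻¹ • V v‖ = 1 := by
  refine Eq.trans ?_ (integral_speed_div hL)
  congr 1
  ext v
  rw [norm_smul, norm_inv, Real.norm_of_nonneg hL.le, div_eq_inv_mul]

theorem integral_norm_inv_smul_sub_le (h₁ : IntervalIntegrable V₁ volume 0 1)
    (h₂ : IntervalIntegrable V₂ volume 0 1) (hL₁ : 0 < length V₁) (hL₂ : 0 < length V₂) :
    ∫ v in (0 : ℝ)..1, ‖(length V₁)⁻¹ • V₁ v - (length V₂)⁻¹ • V₂ v‖ ≤
      2 / length V₁ * ∫ s in (0 : ℝ)..1, ‖V₁ s - V₂ s‖ := by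
  have e2 : |length V₂ - length V₁| ≤ ∫ s in (0 : ℝ)..1, ‖V₁ s - V₂ s‖ := by
    rw [abs_sub_comm]; exact abs_length_sub_le h₁ h₂ unit_right_mem
  have g₁ : IntervalIntegrable (fun v => (length V₁)⁻¹ • V₁ v) volume 0 1 := h₁.smul (length V₁)⁻¹
  have g₂ : IntervalIntegrable (fun v => (length V₂)⁻¹ • V₂ v) volume 0 1 := h₂.smul (length V₂)⁻¹
  have g₃ : IntervalIntegrable (fun v => (length V₁)⁻¹ * ‖V₁ v - V₂ v‖) volume 0 1 :=
    (h₁.sub h₂).norm.const_mul _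
  have g₄ : IntervalIntegrable (fun v => (|length V₂ - length V₁| / length V₁) *
    ‖(length V₂)⁻¹ • V₂ v‖) volume 0 1 := g₂.norm.const_mul _
  calc _ ≤ ∫ v in (0 : ℝ)..1, ((length V₁)⁻¹ * ‖V₁ v - V₂ v‖ +
        (|length V₂ - length V₁| / length V₁) * ‖(length V₂)⁻¹ • V₂ v‖) := by
        apply intervalIntegral.integral_mono_on zero_le_one (g₁.sub g₂).norm (g₃.add g₄)
        intro v _
        have : (length V₁)⁻¹ • V₁ v - (length V₂)⁻¹ • V₂ v = (length V₁)⁻¹ • (V₁ v - V₂ v) +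
            ((length V₂ - length V₁) / length V₁) • ((length V₂)⁻¹ • V₂ v) := by
          rw [smul_smul, smul_sub]
          have : (length V₂ - length V₁) / length V₁ * (length V₂)⁻¹ =
            (length V₁)⁻¹ - (length V₂)⁻¹ := by field_simp
          rw [this, sub_smul]
          abel
        rw [this]
        refine (norm_add_le _ _).trans (le_of_eq ?_)
        rw [norm_smul, norm_smul, norm_inv, Real.norm_of_nonneg hL₁.le, norm_div,
          Real.norm_of_nonneg hL₁.le, Real.norm_eq_abs]
    _ = (length V₁)⁻¹ * (∫ v in (0 : ℝ)..1, ‖V₁ v - V₂ v‖) +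
        (|length V₂ - length V₁| / length V₁) * 1 := by
        rw [intervalIntegral.integral_add g₃ g₄, intervalIntegral.integral_const_mul,
          intervalIntegral.integral_const_mul, integral_norm_inv_smul hL₂]
    _ ≤ (length V₁)⁻¹ * (∫ v in (0 : ℝ)..1, ‖V₁ v - V₂ v‖) +
        ((∫ v in (0 : ℝ)..1, ‖V₁ v - V₂ v‖) / length V₁) * 1 := by gcongr
    _ = _ := by ring

theorem conv_integrand_intervalIntegrable (hV : IntervalIntegrable V volume 0 1)
    (hw : IntervalIntegrable w volume 0 1) (u : ℝ) :
    IntervalIntegrable (fun v => kernel lam (arc V v - arc V u) • w v) volume 0 1 :=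
  hw.continuousOn_smul (kernel_arc_continuousOn hV u)

/-- Comparison of two convolutions, possibly at different points, in terms of the distance `η` of
the arc length differences and the `L¹` distance of the weights. -/
theorem norm_conv_sub_le_of_arc (hC : (∀ x, |x| ≤ 1 → |kernel lam x| ≤ C) ∧
      ∀ x y, |x| ≤ 1 → |y| ≤ 1 → |kernel lam x - kernel lam y| ≤ C * |x - y|)
    (h₁ : IntervalIntegrable V₁ volume 0 1) (h₂ : IntervalIntegrable V₂ volume 0 1)
    (hL₁ : 0 < length V₁) (hL₂ : 0 < length V₂)
    (hw₁ : IntervalIntegrable w₁ volume 0 1) (hw₂ : IntervalIntegrable w₂ volume 0 1)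
    {u u' η : ℝ} (hu : u ∈ Icc (0 : ℝ) 1) (hu' : u' ∈ Icc (0 : ℝ) 1)
    (hη : ∀ v ∈ Icc (0 : ℝ) 1, |(arc V₁ v - arc V₁ u) - (arc V₂ v - arc V₂ u')| ≤ η) :
    ‖conv lam V₁ w₁ u - conv lam V₂ w₂ u'‖ ≤
      C * η * (∫ v in (0 : ℝ)..1, ‖w₁ v‖) + C * ∫ v in (0 : ℝ)..1, ‖w₁ v - w₂ v‖ := by
  have hC0 : 0 ≤ C := (abs_nonneg _).trans (hC.1 0 (by simp))
  have g₁ := conv_integrand_intervalIntegrable (lam := lam) h₁ hw₁ u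
  have g₂ := conv_integrand_intervalIntegrable (lam := lam) h₂ hw₂ u'
  have g₃ : IntervalIntegrable (fun v => C * η * ‖w₁ v‖) volume 0 1 := hw₁.norm.const_mul _
  have g₄ : IntervalIntegrable (fun v => C * ‖w₁ v - w₂ v‖) volume 0 1 :=
    (hw₁.sub hw₂).norm.const_mul _
  rw [conv, conv, ← intervalIntegral.integral_sub g₁ g₂]
  calc _ ≤ ∫ v in (0 : ℝ)..1, ‖kernel lam (arc V₁ v - arc V₁ u) • w₁ v -
        kernel lam (arc V₂ v - arc V₂ u') • w₂ v‖ :=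
        intervalIntegral.norm_integral_le_integral_norm zero_le_one
    _ ≤ ∫ v in (0 : ℝ)..1, (C * η * ‖w₁ v‖ + C * ‖w₁ v - w₂ v‖) := by
        apply intervalIntegral.integral_mono_on zero_le_one (g₁.sub g₂).norm (g₃.add g₄)
        intro v hv
        have a₁ := abs_arc_sub_le_one h₁ hL₁ hu hv
        have a₂ := abs_arc_sub_le_one h₂ hL₂ hu' hv
        have : kernel lam (arc V₁ v - arc V₁ u) • w₁ v -
            kernel lam (arc V₂ v - arc V₂ u') • w₂ v =
            (kernel lam (arc V₁ v - arc V₁ u) - kernel lam (arc V₂ v - arc V₂ u')) • w₁ v +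
            kernel lam (arc V₂ v - arc V₂ u') • (w₁ v - w₂ v) := by
          rw [sub_smul, smul_sub]; abel
        rw [this]
        refine (norm_add_le _ _).trans (add_le_add ?_ ?_)
        · rw [norm_smul]
          gcongr
          exact (hC.2 _ _ a₁ a₂).trans (by gcongr; exact hη v hv)
        · rw [norm_smul]
          gcongr
          exact hC.1 _ a₂
    _ = _ := by
        rw [intervalIntegral.integral_add g₃ g₄, intervalIntegral.integral_const_mul,
          intervalIntegral.integral_const_mul]

theorem norm_conv_sub_le (hC : (∀ x, |x| ≤ 1 → |kernel lam x| ≤ C) ∧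
      ∀ x y, |x| ≤ 1 → |y| ≤ 1 → |kernel lam x - kernel lam y| ≤ C * |x - y|)
    (h₁ : IntervalIntegrable V₁ volume 0 1) (h₂ : IntervalIntegrable V₂ volume 0 1)
    (hL₁ : 0 < length V₁) (hL₂ : 0 < length V₂)
    (hw₁ : IntervalIntegrable w₁ volume 0 1) (hw₂ : IntervalIntegrable w₂ volume 0 1)
    {u : ℝ} (hu : u ∈ Icc (0 : ℝ) 1) :
    ‖conv lam V₁ w₁ u - conv lam V₂ w₂ u‖ ≤
      C * (4 / length V₁ * ∫ s in (0 : ℝ)..1, ‖V₁ s - V₂ s‖) * (∫ v in (0 : ℝ)..1, ‖w₁ v‖) +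
        C * ∫ v in (0 : ℝ)..1, ‖w₁ v - w₂ v‖ := by
  apply norm_conv_sub_le_of_arc hC h₁ h₂ hL₁ hL₂ hw₁ hw₂ hu hu
  intro v hv
  have a₁ := abs_arc_sub_arc_le h₁ h₂ hL₁ hL₂ hv
  have a₂ := abs_arc_sub_arc_le h₁ h₂ hL₁ hL₂ hu
  calc _ = |(arc V₁ v - arc V₂ v) - (arc V₁ u - arc V₂ u)| := by congr 1; ring
    _ ≤ _ := (abs_sub _ _).trans (add_le_add a₁ a₂)
    _ = _ := by ring

theorem conv_continuousOn (hV : IntervalIntegrable V volume 0 1) (hL : 0 < length V)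
    (hw : IntervalIntegrable w volume 0 1) : ContinuousOn (conv lam V w) (Icc 0 1) := by
  obtain ⟨C, -, hC⟩ := exists_kernel_bound lam
  intro u hu
  rw [ContinuousWithinAt, tendsto_iff_norm_sub_tendsto_zero]
  have h1 : Tendsto (fun u' => C * |arc V u' - arc V u| * ∫ v in (0 : ℝ)..1, ‖w v‖)
      (𝓝[Icc 0 1] u) (𝓝 0) := by
    have h2 := (arc_continuousOn hV u hu).sub (continuousWithinAt_const (b := arc V u))
    have h3 := (h2.abs.const_mul C).mul_const (∫ v in (0 : ℝ)..1, ‖w v‖)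
    simpa using h3.tendsto
  refine squeeze_zero' (.of_forall fun _ => norm_nonneg _) ?_ h1
  filter_upwards [self_mem_nhdsWithin] with u' hu'
  have := norm_conv_sub_le_of_arc hC hV hV hL hL hw hw hu' hu (η := |arc V u' - arc V u|)
    fun v _ => by
      rw [abs_sub_comm (arc V u')]
      exact le_of_eq (by congr 1; ring)
  simpa using this

theorem conv_zero_eq_one (hV : IntervalIntegrable V volume 0 1) (hL : 0 < length V) :
    conv lam V w 0 = conv lam V w 1 := by
  apply intervalIntegral.integral_congr
  intro v hv
  rw [uIcc_zero_one] at hv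
  simp only [arc_zero, arc_one hL, sub_zero]
  rw [kernel_sub_comm, kernel_one_sub lam (arc_mem hV hL hv)]

theorem norm_conv_tangent_le (hlam : 0 < lam) (hV : IntervalIntegrable V volume 0 1)
    (hL : 0 < length V) {u : ℝ} (hu : u ∈ Icc (0 : ℝ) 1) :
    ‖conv lam V (fun v => (length V)⁻¹ • V v) u‖ ≤ 1 := by
  rw [← integral_kernel_arc hlam hV hL hu]
  refine (intervalIntegral.norm_integral_le_integral_norm zero_le_one).trans (le_of_eq ?_)
  congr 1
  ext v
  rw [norm_smul, norm_smul, norm_inv, Real.norm_of_nonneg hL.le,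
    Real.norm_of_nonneg (kernel_pos hlam _).le, div_eq_inv_mul]

end Conv

/-! ### The derivative of the smoothed curve -/

section Fubini

variable {V γ : ℝ → Plane} {lam : ℝ}

theorem integral_integral_swap_unit {f : ℝ → ℝ} {g : ℝ → Plane} {k : ℝ → ℝ → ℝ} {B a : ℝ}
    (ha : 0 ≤ a)
    (hf : IntegrableOn f (Ioc 0 a)) (hg : IntegrableOn g (Ioc 0 1))
    (hk : AEStronglyMeasurable (fun p : ℝ × ℝ => k p.1 p.2)
      ((volume.restrict (Ioc 0 a)).prod (volume.restrict (Ioc 0 1))))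
    (hkB : ∀ x ∈ Ioc (0 : ℝ) a, ∀ y ∈ Ioc (0 : ℝ) 1, |k x y| ≤ B) :
    ∫ x in (0 : ℝ)..a, f x • ∫ y in (0 : ℝ)..1, k x y • g y =
      ∫ y in (0 : ℝ)..1, (∫ x in (0 : ℝ)..a, k x y * f x) • g y := by
  have h1 : Integrable (fun p : ℝ × ℝ => k p.1 p.2 • (f p.1 • g p.2))
      ((volume.restrict (Ioc 0 a)).prod (volume.restrict (Ioc 0 1))) := by
    refine (Integrable.smul_prod hf hg).bdd_smul B hk ?_
    rw [Measure.prod_restrict]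
    filter_upwards [ae_restrict_mem (measurableSet_Ioc.prod measurableSet_Ioc)] with p hp
    exact hkB _ hp.1 _ hp.2
  have h2 := integral_integral_swap (f := fun x y => k x y • (f x • g y)) h1
  simp only [intervalIntegral.integral_of_le ha, intervalIntegral.integral_of_le zero_le_one]
  calc _ = ∫ x in Ioc 0 a, ∫ y in Ioc 0 1, k x y • (f x • g y) := by
        congr 1; ext1 x
        rw [← integral_smul]
        congr 1; ext1 y
        rw [smul_comm]
    _ = _ := h2
    _ = _ := by
        congr 1; ext1 y
        rw [← integral_smul_const]
        congr 1; ext1 x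
        rw [smul_smul]

/-- Integration by parts in the definition of the smoothed curve. -/
theorem conv_position_eq (hlam : 0 < lam) (hV : IntervalIntegrable V volume 0 1)
    (hL : 0 < length V) (hγ : ∀ x ∈ Icc (0 : ℝ) 1, γ x - γ 0 = ∫ s in (0 : ℝ)..x, V s)
    (hcl : ∫ s in (0 : ℝ)..1, V s = 0) {u : ℝ} (hu : u ∈ Icc (0 : ℝ) 1) :
    conv lam V (fun v => (‖V v‖ / length V) • γ v) u =
      γ 0 - ∫ v in (0 : ℝ)..1, kernelPrim lam (arc V v - arc V u) • V v := by
  set g : ℝ → ℝ := fun v => kernel lam (arc V v - arc V u) * (‖V v‖ / length V) with hg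
  have hgI : IntervalIntegrable g volume 0 1 :=
    (hV.norm.div_const _).continuousOn_mul (kernel_arc_continuousOn hV u)
  have hgO : IntegrableOn g (Ioc 0 1) := (intervalIntegrable_iff_integrableOn_Ioc_of_le
    zero_le_one).1 hgI
  have hVO : IntegrableOn V (Ioc 0 1) := (intervalIntegrable_iff_integrableOn_Ioc_of_le
    zero_le_one).1 hV
  have hQ : IntervalIntegrable (fun v => kernelPrim lam (arc V v - arc V u) • V v)
      volume 0 1 := by
    refine hV.continuousOn_smul ?_
    rw [uIcc_zero_one]
    exact (kernelPrim_continuous lam).comp_continuousOn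
      ((arc_continuousOn hV).sub continuousOn_const)
  have hind : ∀ v ∈ Icc (0 : ℝ) 1, ∫ w in (0 : ℝ)..1, (if w ≤ v then (1 : ℝ) else 0) • V w =
      ∫ w in (0 : ℝ)..v, V w := by
    intro v hv
    rw [intervalIntegral.integral_of_le zero_le_one, intervalIntegral.integral_of_le hv.1]
    have : (fun w => (if w ≤ v then (1 : ℝ) else 0) • V w) = (Iic v).indicator V := by
      ext1 w
      by_cases h : w ≤ v <;> simp [h]
    rw [this, setIntegral_indicator measurableSet_Iic]
    congr 2
    ext w
    simp only [mem_inter_iff, mem_Ioc, mem_Iic]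
    grind
  have hind' : ∀ w ∈ Icc (0 : ℝ) 1, ∫ v in (0 : ℝ)..1, (if w ≤ v then (1 : ℝ) else 0) * g v =
      kernelPrim lam (1 - arc V u) - kernelPrim lam (arc V w - arc V u) := by
    intro w hw
    have h := integral_kernel_arc_sub (lam := lam) hV (arc V u) hw unit_right_mem
    rw [arc_one hL] at h
    rw [← h, intervalIntegral.integral_of_le zero_le_one, intervalIntegral.integral_of_le hw.2]
    have : (fun v => (if w ≤ v then (1 : ℝ) else 0) * g v) = (Ici w).indicator g := by
      ext1 v
      by_cases h : w ≤ v <;> simp [h]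
    rw [this, setIntegral_indicator measurableSet_Ici]
    apply setIntegral_congr_set
    have h1 : (Ioc 0 1 ∩ Ici w : Set ℝ) =ᵐ[volume] (Ioc 0 1 ∩ Ioi w : Set ℝ) :=
      (ae_eq_refl _).inter Ioi_ae_eq_Ici.symm
    have h2 : (Ioc 0 1 ∩ Ioi w : Set ℝ) = Ioc w 1 := by
      ext v
      simp only [mem_inter_iff, mem_Ioc, mem_Ioi]
      have := hw.1
      grind
    rwa [h2] at h1
  have hswap := integral_integral_swap_unit (f := g) (g := V) (B := 1) (a := 1)
    (k := fun v w => if w ≤ v then (1 : ℝ) else 0) zero_le_one hgO hVO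
    (by
      apply Measurable.aestronglyMeasurable
      exact Measurable.ite (measurableSet_le measurable_snd measurable_fst)
        measurable_const measurable_const)
    (fun x _ y _ => by split_ifs <;> simp)
  have h1 : conv lam V (fun v => (‖V v‖ / length V) • γ v) u =
      ∫ v in (0 : ℝ)..1, (g v • γ 0 +
        g v • ∫ w in (0 : ℝ)..1, (if w ≤ v then (1 : ℝ) else 0) • V w) := by
    apply intervalIntegral.integral_congr
    intro v hv
    rw [uIcc_zero_one] at hv
    have : γ v = γ 0 + ∫ w in (0 : ℝ)..1, (if w ≤ v then (1 : ℝ) else 0) • V w := by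
      rw [hind v hv, ← hγ v hv]; abel
    beta_reduce
    rw [← smul_add, ← this, smul_smul]
  have hprim : ContinuousOn (fun v => ∫ w in (0 : ℝ)..v, V w) (uIcc 0 1) :=
    intervalIntegral.continuousOn_primitive_interval' hV (by simp)
  have h2 : IntervalIntegrable (fun v => g v •
      ∫ w in (0 : ℝ)..1, (if w ≤ v then (1 : ℝ) else 0) • V w) volume 0 1 := by
    refine (hgI.smul_continuousOn hprim).congr_ae ?_
    rw [uIoc_of_le zero_le_one]
    filter_upwards [ae_restrict_mem measurableSet_Ioc] with v hv
    rw [hind v ⟨hv.1.le, hv.2⟩]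
  have h3 : IntervalIntegrable (fun v => g v • γ 0) volume 0 1 :=
    hgI.smul_continuousOn continuousOn_const
  rw [h1, intervalIntegral.integral_add h3 h2, intervalIntegral.integral_smul_const, hg,
    integral_kernel_arc hlam hV hL hu, one_smul, ← hg, hswap]
  have h4 : ∫ y in (0 : ℝ)..1, (∫ x in (0 : ℝ)..1, (if y ≤ x then (1 : ℝ) else 0) * g x) • V y =
      ∫ y in (0 : ℝ)..1, (kernelPrim lam (1 - arc V u) • V y -
        kernelPrim lam (arc V y - arc V u) • V y) := by
    apply intervalIntegral.integral_congr
    intro w hw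
    rw [uIcc_zero_one] at hw
    beta_reduce
    rw [hind' w hw, sub_smul]
  have h5 : IntervalIntegrable (fun v => kernelPrim lam (1 - arc V u) • V v) volume 0 1 :=
    hV.smul (kernelPrim lam (1 - arc V u))
  rw [h4, intervalIntegral.integral_sub h5 hQ, intervalIntegral.integral_smul, hcl,
    smul_zero, zero_sub, sub_eq_add_neg]

/-- The derivative of the smoothed curve is the speed times the averaged unit tangent. -/
theorem conv_position_sub (hlam : 0 < lam) (hV : IntervalIntegrable V volume 0 1)
    (hL : 0 < length V) (hγ : ∀ x ∈ Icc (0 : ℝ) 1, γ x - γ 0 = ∫ s in (0 : ℝ)..x, V s)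
    (hcl : ∫ s in (0 : ℝ)..1, V s = 0) {u : ℝ} (hu : u ∈ Icc (0 : ℝ) 1) :
    conv lam V (fun v => (‖V v‖ / length V) • γ v) u -
      conv lam V (fun v => (‖V v‖ / length V) • γ v) 0 =
      ∫ w in (0 : ℝ)..u, ‖V w‖ • conv lam V (fun v => (length V)⁻¹ • V v) w := by
  have hVO : IntegrableOn V (Ioc 0 1) := (intervalIntegrable_iff_integrableOn_Ioc_of_le
    zero_le_one).1 hV
  have hQ : ∀ x, IntervalIntegrable (fun v => kernelPrim lam (arc V v - arc V x) • V v)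
      volume 0 1 := by
    intro x
    refine hV.continuousOn_smul ?_
    rw [uIcc_zero_one]
    exact (kernelPrim_continuous lam).comp_continuousOn
      ((arc_continuousOn hV).sub continuousOn_const)
  rw [conv_position_eq hlam hV hL hγ hcl hu, conv_position_eq hlam hV hL hγ hcl unit_left_mem]
  obtain ⟨B, -, hB, -⟩ := exists_kernel_bound lam
  have hrO : IntegrableOn (fun w => ‖V w‖ / length V) (Ioc 0 u) :=
    IntegrableOn.mono_set (hVO.norm.div_const _) (Ioc_subset_Ioc_right hu.2)
  have harc : AEStronglyMeasurable (arc V) (volume.restrict (Ioc 0 1)) :=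
    ((arc_continuousOn hV).mono Ioc_subset_Icc_self).aestronglyMeasurable measurableSet_Ioc
  have harc' : AEStronglyMeasurable (arc V) (volume.restrict (Ioc 0 u)) :=
    harc.mono_measure (Measure.restrict_mono (Ioc_subset_Ioc_right hu.2) le_rfl)
  have hswap := integral_integral_swap_unit (f := fun w => ‖V w‖ / length V) (g := V) (B := B)
    (a := u) (k := fun w v => kernel lam (arc V v - arc V w)) hu.1 hrO hVO
    ((kernel_continuous lam).comp_aestronglyMeasurable (harc.comp_snd.sub harc'.comp_fst))
    (fun x hx y hy => hB _ (abs_arc_sub_le_one hV hL ⟨hx.1.le, hx.2.trans hu.2⟩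
      ⟨hy.1.le, hy.2⟩))
  have h1 : ∫ w in (0 : ℝ)..u, ‖V w‖ • conv lam V (fun v => (length V)⁻¹ • V v) w =
      ∫ w in (0 : ℝ)..u, (‖V w‖ / length V) •
        ∫ v in (0 : ℝ)..1, kernel lam (arc V v - arc V w) • V v := by
    congr 1; ext1 w
    have h2 : conv lam V (fun v => (length V)⁻¹ • V v) w =
        (length V)⁻¹ • ∫ v in (0 : ℝ)..1, kernel lam (arc V v - arc V w) • V v := by
      rw [conv, ← intervalIntegral.integral_smul]
      congr 1; ext1 v
      rw [smul_comm]
    rw [h2, smul_smul, div_eq_mul_inv]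
  rw [h1, hswap, sub_sub_sub_cancel_left, ← intervalIntegral.integral_sub (hQ 0) (hQ u)]
  apply intervalIntegral.integral_congr
  intro v hv
  rw [uIcc_zero_one] at hv
  simp only
  rw [← sub_smul]
  congr 1
  have h2 := integral_kernel_arc_sub (lam := lam) hV (arc V v) unit_left_mem hu
  simp only [kernel_sub_comm lam (arc V v)]
  rw [h2, ← neg_sub (arc V v) (arc V u), ← neg_sub (arc V v) (arc V 0), kernelPrim_neg,
    kernelPrim_neg]
  ring

end Fubini

/-! ### Loops of class `W^{1,1}` -/

theorem coe_one_eq_zero : ((1 : ℝ) : UnitAddCircle) = ((0 : ℝ) : UnitAddCircle) := by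
  have := AddCircle.coe_period (p := (1 : ℝ))
  rw [this]; rfl

theorem exists_coe_eq (q : UnitAddCircle) : ∃ x ∈ Icc (0 : ℝ) 1, (x : UnitAddCircle) = q := by
  have h : q ∈ ((↑) : ℝ → UnitAddCircle) '' Ico 0 (0 + 1) := by
    rw [AddCircle.coe_image_Ico_eq]; exact mem_univ _
  obtain ⟨x, hx, rfl⟩ := h
  exact ⟨x, ⟨hx.1, by linarith [hx.2]⟩, rfl⟩

theorem loop_ext {f g : C(UnitAddCircle, Plane)}
    (h : ∀ u ∈ Icc (0 : ℝ) 1, f (u : UnitAddCircle) = g (u : UnitAddCircle)) : f = g := by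
  ext1 q
  obtain ⟨x, hx, rfl⟩ := exists_coe_eq q
  exact h x hx

theorem norm_loop_le {f : C(UnitAddCircle, Plane)} {B : ℝ} (hB : 0 ≤ B)
    (h : ∀ u ∈ Icc (0 : ℝ) 1, ‖f (u : UnitAddCircle)‖ ≤ B) : ‖f‖ ≤ B := by
  rw [ContinuousMap.norm_le _ hB]
  intro q
  obtain ⟨x, hx, rfl⟩ := exists_coe_eq q
  exact h x hx

open Classical in
/-- The loop given by a function on `[0,1]` that is continuous with equal values at the end
points (and the zero loop for other functions). -/
def toLoop (f : ℝ → Plane) : C(UnitAddCircle, Plane) :=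
  if h : f 0 = f 1 ∧ ContinuousOn f (Icc 0 1) then
    ⟨AddCircle.liftIco 1 0 f, AddCircle.liftIco_zero_continuous h.1 h.2⟩ else 0

theorem toLoop_coe {f : ℝ → Plane} (h0 : f 0 = f 1) (hc : ContinuousOn f (Icc 0 1)) {u : ℝ}
    (hu : u ∈ Icc (0 : ℝ) 1) : toLoop f (u : UnitAddCircle) = f u := by
  rw [toLoop, dif_pos ⟨h0, hc⟩]
  change AddCircle.liftIco 1 0 f (u : UnitAddCircle) = f u
  rcases hu.2.lt_or_eq with h | rfl
  · exact AddCircle.liftIco_zero_coe_apply ⟨hu.1, h⟩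
  · rw [coe_one_eq_zero, AddCircle.liftIco_zero_coe_apply ⟨le_rfl, zero_lt_one⟩, h0]

instance : NormedAddCommGroup W11Loop := Submodule.normedAddCommGroup _

instance : SeminormedAddCommGroup W11Loop := NormedAddCommGroup.toSeminormedAddCommGroup

instance : NormedSpace ℝ W11Loop := Submodule.normedSpace _

namespace W11Loop

/-- The curve as a continuous linear function of the `W^{1,1}` loop. -/
def curveL : W11Loop →L[ℝ] C(UnitAddCircle, Plane) :=
  (ContinuousLinearMap.fst ℝ _ _).comp w11Submodule.subtypeL

/-- The weak derivative as a continuous linear function of the `W^{1,1}` loop. -/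
def weakDerivL : W11Loop →L[ℝ] Lp Plane 1 (volume.restrict (Ioc (0 : ℝ) 1)) :=
  (ContinuousLinearMap.snd ℝ _ _).comp w11Submodule.subtypeL

theorem norm_eq (γ : W11Loop) : ‖γ‖ = max ‖γ.curve‖ ‖γ.weakDeriv‖ := rfl

theorem norm_curve_le (γ : W11Loop) : ‖γ.curve‖ ≤ ‖γ‖ := le_max_left _ _

theorem norm_weakDeriv_le (γ : W11Loop) : ‖γ.weakDeriv‖ ≤ ‖γ‖ := le_max_right _ _

theorem integrableOn_weakDeriv (γ : W11Loop) :
    IntegrableOn (fun x => γ.weakDeriv x) (Ioc (0 : ℝ) 1) := L1.integrable_coeFn γ.weakDeriv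

theorem intervalIntegrable_weakDeriv (γ : W11Loop) :
    IntervalIntegrable (fun x => γ.weakDeriv x) volume 0 1 :=
  (intervalIntegrable_iff_integrableOn_Ioc_of_le zero_le_one).2 γ.integrableOn_weakDeriv

theorem curve_sub (γ : W11Loop) : ∀ x ∈ Icc (0 : ℝ) 1,
    γ.curve (x : UnitAddCircle) - γ.curve ((0 : ℝ) : UnitAddCircle) =
      ∫ s in (0 : ℝ)..x, γ.weakDeriv s := γ.2

theorem integral_weakDeriv (γ : W11Loop) : ∫ s in (0 : ℝ)..1, γ.weakDeriv s = 0 := by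
  rw [← γ.curve_sub 1 unit_right_mem, coe_one_eq_zero, sub_self]

theorem len_eq_norm (γ : W11Loop) : γ.len = ‖γ.weakDeriv‖ := by
  rw [L1.norm_eq_integral_norm, len, length, intervalIntegral.integral_of_le zero_le_one]

theorem continuous_len : Continuous W11Loop.len := by
  have : W11Loop.len = fun γ => ‖weakDerivL γ‖ := funext len_eq_norm
  rw [this]
  fun_prop

theorem abs_len_sub_le (γ₁ γ₂ : W11Loop) : |γ₁.len - γ₂.len| ≤ ‖γ₁ - γ₂‖ := by
  rw [len_eq_norm, len_eq_norm]
  exact (abs_norm_sub_norm_le _ _).trans (norm_weakDeriv_le (γ₁ - γ₂))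

theorem integral_norm_weakDeriv_sub (γ₁ γ₂ : W11Loop) :
    ∫ s in (0 : ℝ)..1, ‖γ₁.weakDeriv s - γ₂.weakDeriv s‖ = ‖γ₁.weakDeriv - γ₂.weakDeriv‖ := by
  rw [L1.norm_eq_integral_norm, intervalIntegral.integral_of_le zero_le_one]
  apply integral_congr_ae
  filter_upwards [Lp.coeFn_sub γ₁.weakDeriv γ₂.weakDeriv] with s hs
  rw [hs, Pi.sub_apply]

theorem integral_norm_weakDeriv_sub_le (γ₁ γ₂ : W11Loop) :
    ∫ s in (0 : ℝ)..1, ‖γ₁.weakDeriv s - γ₂.weakDeriv s‖ ≤ ‖γ₁ - γ₂‖ := by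
  rw [integral_norm_weakDeriv_sub]
  exact norm_weakDeriv_le (γ₁ - γ₂)

/-- An absolutely continuous function determines its derivative almost everywhere. -/
theorem ae_eq_of_integral_eq {f g : ℝ → Plane} (hf : IntervalIntegrable f volume 0 1)
    (hg : IntervalIntegrable g volume 0 1)
    (h : ∀ x ∈ Icc (0 : ℝ) 1, ∫ s in (0 : ℝ)..x, f s = ∫ s in (0 : ℝ)..x, g s) :
    f =ᵐ[volume.restrict (Ioc 0 1)] g := by
  rw [← restrict_Ioo_eq_restrict_Ioc, EventuallyEq, ae_restrict_iff' measurableSet_Ioo]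
  filter_upwards [hf.ae_hasDerivAt_integral, hg.ae_hasDerivAt_integral] with x h1 h2 hx
  have hx' : x ∈ uIcc (0 : ℝ) 1 := by rw [uIcc_zero_one]; exact Ioo_subset_Icc_self hx
  have e1 := h1 hx' 0 (by simp)
  have e2 := h2 hx' 0 (by simp)
  refine e1.unique (e2.congr_of_eventuallyEq ?_)
  filter_upwards [Ioo_mem_nhds hx.1 hx.2] with y hy
  exact h y (Ioo_subset_Icc_self hy)

theorem ext_curve {γ₁ γ₂ : W11Loop} (h : γ₁.curve = γ₂.curve) : γ₁ = γ₂ := by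
  apply Subtype.ext
  refine Prod.ext h ?_
  apply Lp.ext
  apply ae_eq_of_integral_eq γ₁.intervalIntegrable_weakDeriv γ₂.intervalIntegrable_weakDeriv
  intro x hx
  rw [← γ₁.curve_sub x hx, ← γ₂.curve_sub x hx, h]

/-- The curve smoothed by convolution with the kernel along arc length, `-γ ∗_γ 𝒢^lam`. -/
def smoothed (lam : ℝ) (γ : W11Loop) : C(UnitAddCircle, Plane) :=
  toLoop (conv lam (fun x => γ.weakDeriv x) fun v => (‖γ.weakDeriv v‖ / γ.len) • γ.curve v)

/-- The unit tangent averaged with the kernel along arc length. -/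
def tangent (lam : ℝ) (γ : W11Loop) : C(UnitAddCircle, Plane) :=
  toLoop (conv lam (fun x => γ.weakDeriv x) fun v => γ.len⁻¹ • γ.weakDeriv v)

theorem curve_continuous (γ : W11Loop) : Continuous fun x : ℝ => γ.curve (x : UnitAddCircle) :=
  γ.curve.continuous.comp (AddCircle.continuous_mk' 1)

theorem position_weight_intervalIntegrable (γ : W11Loop) : IntervalIntegrable
    (fun v : ℝ => (‖γ.weakDeriv v‖ / γ.len) • γ.curve v) volume 0 1 :=
  (γ.intervalIntegrable_weakDeriv.norm.div_const _).smul_continuousOn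
    γ.curve_continuous.continuousOn

theorem tangent_weight_intervalIntegrable (γ : W11Loop) : IntervalIntegrable
    (fun v : ℝ => γ.len⁻¹ • γ.weakDeriv v) volume 0 1 :=
  γ.intervalIntegrable_weakDeriv.smul γ.len⁻¹

variable {lam : ℝ}

theorem smoothed_coe {γ : W11Loop} (hL : 0 < γ.len) {u : ℝ} (hu : u ∈ Icc (0 : ℝ) 1) :
    smoothed lam γ (u : UnitAddCircle) = conv lam (fun x => γ.weakDeriv x)
      (fun v => (‖γ.weakDeriv v‖ / γ.len) • γ.curve v) u :=
  toLoop_coe (conv_zero_eq_one γ.intervalIntegrable_weakDeriv hL)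
    (conv_continuousOn γ.intervalIntegrable_weakDeriv hL γ.position_weight_intervalIntegrable) hu

theorem tangent_coe {γ : W11Loop} (hL : 0 < γ.len) {u : ℝ} (hu : u ∈ Icc (0 : ℝ) 1) :
    tangent lam γ (u : UnitAddCircle) = conv lam (fun x => γ.weakDeriv x)
      (fun v => γ.len⁻¹ • γ.weakDeriv v) u :=
  toLoop_coe (conv_zero_eq_one γ.intervalIntegrable_weakDeriv hL)
    (conv_continuousOn γ.intervalIntegrable_weakDeriv hL γ.tangent_weight_intervalIntegrable) hu

theorem norm_tangent_le (hlam : 0 < lam) {γ : W11Loop} (hL : 0 < γ.len) (q : UnitAddCircle) :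
    ‖tangent lam γ q‖ ≤ 1 := by
  obtain ⟨u, hu, rfl⟩ := exists_coe_eq q
  rw [tangent_coe hL hu]
  exact norm_conv_tangent_le hlam γ.intervalIntegrable_weakDeriv hL hu

theorem smoothed_sub (hlam : 0 < lam) {γ : W11Loop} (hL : 0 < γ.len) {u : ℝ}
    (hu : u ∈ Icc (0 : ℝ) 1) :
    smoothed lam γ (u : UnitAddCircle) - smoothed lam γ ((0 : ℝ) : UnitAddCircle) =
      ∫ w in (0 : ℝ)..u, ‖γ.weakDeriv w‖ • tangent lam γ (w : UnitAddCircle) := by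
  rw [smoothed_coe hL hu, smoothed_coe hL unit_left_mem]
  refine (conv_position_sub (γ := fun x : ℝ => γ.curve (x : UnitAddCircle)) hlam
    γ.intervalIntegrable_weakDeriv hL γ.curve_sub γ.integral_weakDeriv hu).trans ?_
  apply intervalIntegral.integral_congr
  intro w hw
  rw [uIcc_of_le hu.1] at hw
  beta_reduce
  rw [tangent_coe hL ⟨hw.1, hw.2.trans hu.2⟩]
  rfl

/-- The tangent average depends on the loop in a locally Lipschitz way. -/
theorem exists_norm_tangent_sub_le (lam : ℝ) : ∃ C : ℝ, 0 < C ∧ ∀ γ₁ γ₂ : W11Loop, 0 < γ₁.len →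
    0 < γ₂.len → ‖tangent lam γ₁ - tangent lam γ₂‖ ≤ C / γ₁.len * ‖γ₁ - γ₂‖ := by
  obtain ⟨C, hC0, hC⟩ := exists_kernel_bound lam
  refine ⟨6 * C, by positivity, fun γ₁ γ₂ h₁ h₂ => norm_loop_le (by positivity) fun u hu => ?_⟩
  have i₁ := γ₁.intervalIntegrable_weakDeriv
  have i₂ := γ₂.intervalIntegrable_weakDeriv
  rw [ContinuousMap.sub_apply, tangent_coe h₁ hu, tangent_coe h₂ hu]
  have e1 := norm_conv_sub_le hC i₁ i₂ h₁ h₂ γ₁.tangent_weight_intervalIntegrable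
    γ₂.tangent_weight_intervalIntegrable hu
  have e2 := integral_norm_inv_smul_sub_le i₁ i₂ h₁ h₂
  have e3 := integral_norm_inv_smul (V := fun x => γ₁.weakDeriv x) h₁
  have e4 := integral_norm_weakDeriv_sub_le γ₁ γ₂
  change _ ≤ C * (4 / γ₁.len * _) * _ + _ at e1
  change ∫ v in (0 : ℝ)..1, ‖γ₁.len⁻¹ • γ₁.weakDeriv v‖ = 1 at e3
  change ∫ v in (0 : ℝ)..1, ‖γ₁.len⁻¹ • γ₁.weakDeriv v - γ₂.len⁻¹ • γ₂.weakDeriv v‖ ≤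
    2 / γ₁.len * _ at e2
  rw [e3] at e1
  calc _ ≤ _ := e1
    _ ≤ C * (4 / γ₁.len * ‖γ₁ - γ₂‖) * 1 + C * (2 / γ₁.len * ‖γ₁ - γ₂‖) := by
      gcongr
      exact e2.trans (by gcongr)
    _ = _ := by ring

/-- The smoothed curve depends on the loop in a locally Lipschitz way. -/
theorem exists_norm_smoothed_sub_le (lam : ℝ) : ∃ C : ℝ, 0 < C ∧ ∀ γ₁ γ₂ : W11Loop, 0 < γ₁.len →
    0 < γ₂.len → ‖smoothed lam γ₁ - smoothed lam γ₂‖ ≤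
      C * (1 + (‖γ₁‖ + ‖γ₂‖) / γ₁.len) * ‖γ₁ - γ₂‖ := by
  obtain ⟨C, hC0, hC⟩ := exists_kernel_bound lam
  refine ⟨4 * C, by positivity, fun γ₁ γ₂ h₁ h₂ => norm_loop_le (by positivity) fun u hu => ?_⟩
  have i₁ := γ₁.intervalIntegrable_weakDeriv
  have i₂ := γ₂.intervalIntegrable_weakDeriv
  have p₁ := γ₁.position_weight_intervalIntegrable
  have p₂ := γ₂.position_weight_intervalIntegrable
  have t₁ := γ₁.tangent_weight_intervalIntegrable
  have t₂ := γ₂.tangent_weight_intervalIntegrable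
  rw [ContinuousMap.sub_apply, smoothed_coe h₁ hu, smoothed_coe h₂ hu]
  have e1 := norm_conv_sub_le hC i₁ i₂ h₁ h₂ p₁ p₂ hu
  have e2 := integral_norm_inv_smul_sub_le i₁ i₂ h₁ h₂
  have e4 := integral_norm_weakDeriv_sub_le γ₁ γ₂
  have e5 := integral_speed_div (V := fun x => γ₁.weakDeriv x) h₁
  change _ ≤ C * (4 / γ₁.len * _) * _ + _ at e1
  change ∫ v in (0 : ℝ)..1, ‖γ₁.len⁻¹ • γ₁.weakDeriv v - γ₂.len⁻¹ • γ₂.weakDeriv v‖ ≤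
    2 / γ₁.len * _ at e2
  change ∫ v in (0 : ℝ)..1, ‖γ₁.weakDeriv v‖ / γ₁.len = 1 at e5
  have hr : IntervalIntegrable (fun v => ‖γ₁.weakDeriv v‖ / γ₁.len) volume 0 1 :=
    i₁.norm.div_const _
  have e6 : ∫ v in (0 : ℝ)..1, ‖(‖γ₁.weakDeriv v‖ / γ₁.len) • γ₁.curve (v : UnitAddCircle)‖ ≤
      ‖γ₁‖ := by
    calc _ ≤ ∫ v in (0 : ℝ)..1, (‖γ₁.weakDeriv v‖ / γ₁.len) * ‖γ₁‖ := by
          apply intervalIntegral.integral_mono_on zero_le_one p₁.norm (hr.mul_const _)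
          intro v _
          rw [norm_smul, Real.norm_of_nonneg (by positivity)]
          gcongr
          exact (ContinuousMap.norm_coe_le_norm _ _).trans γ₁.norm_curve_le
      _ = ‖γ₁‖ := by rw [intervalIntegral.integral_mul_const, e5, one_mul]
  have e7 : ∫ v in (0 : ℝ)..1, ‖(‖γ₁.weakDeriv v‖ / γ₁.len) • γ₁.curve (v : UnitAddCircle) -
      (‖γ₂.weakDeriv v‖ / γ₂.len) • γ₂.curve (v : UnitAddCircle)‖ ≤
      ‖γ₁ - γ₂‖ + 2 / γ₁.len * ‖γ₁ - γ₂‖ * ‖γ₂‖ := by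
    calc _ ≤ ∫ v in (0 : ℝ)..1, ((‖γ₁.weakDeriv v‖ / γ₁.len) * ‖γ₁ - γ₂‖ +
          ‖γ₁.len⁻¹ • γ₁.weakDeriv v - γ₂.len⁻¹ • γ₂.weakDeriv v‖ * ‖γ₂‖) := by
          apply intervalIntegral.integral_mono_on zero_le_one (p₁.sub p₂).norm
            ((hr.mul_const _).add ((t₁.sub t₂).norm.mul_const _))
          intro v _
          have : (‖γ₁.weakDeriv v‖ / γ₁.len) • γ₁.curve (v : UnitAddCircle) -
              (‖γ₂.weakDeriv v‖ / γ₂.len) • γ₂.curve (v : UnitAddCircle) =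
              (‖γ₁.weakDeriv v‖ / γ₁.len) • (γ₁ - γ₂).curve (v : UnitAddCircle) +
              (‖γ₁.weakDeriv v‖ / γ₁.len - ‖γ₂.weakDeriv v‖ / γ₂.len) •
                γ₂.curve (v : UnitAddCircle) := by
            change _ = _ • (γ₁.curve (v : UnitAddCircle) - γ₂.curve (v : UnitAddCircle)) + _
            rw [smul_sub, sub_smul]; abel
          rw [this]
          refine (norm_add_le _ _).trans (add_le_add ?_ ?_)
          · rw [norm_smul, Real.norm_of_nonneg (by positivity)]
            gcongr
            exact (ContinuousMap.norm_coe_le_norm _ _).trans (γ₁ - γ₂).norm_curve_le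
          · rw [norm_smul]
            gcongr
            · have q₁ : ‖γ₁.weakDeriv v‖ / γ₁.len = ‖γ₁.len⁻¹ • γ₁.weakDeriv v‖ := by
                rw [norm_smul, norm_inv, Real.norm_of_nonneg h₁.le, div_eq_inv_mul]
              have q₂ : ‖γ₂.weakDeriv v‖ / γ₂.len = ‖γ₂.len⁻¹ • γ₂.weakDeriv v‖ := by
                rw [norm_smul, norm_inv, Real.norm_of_nonneg h₂.le, div_eq_inv_mul]
              rw [q₁, q₂]
              exact abs_norm_sub_norm_le _ _
            · exact (ContinuousMap.norm_coe_le_norm _ _).trans γ₂.norm_curve_le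
      _ = ‖γ₁ - γ₂‖ + (∫ v in (0 : ℝ)..1,
          ‖γ₁.len⁻¹ • γ₁.weakDeriv v - γ₂.len⁻¹ • γ₂.weakDeriv v‖) * ‖γ₂‖ := by
          rw [intervalIntegral.integral_add (hr.mul_const _) ((t₁.sub t₂).norm.mul_const _),
            intervalIntegral.integral_mul_const, intervalIntegral.integral_mul_const, e5, one_mul]
      _ ≤ _ := by
          gcongr
          exact e2.trans (by gcongr)
  calc _ ≤ _ := e1
    _ ≤ C * (4 / γ₁.len * ‖γ₁ - γ₂‖) * ‖γ₁‖ +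
        C * (‖γ₁ - γ₂‖ + 2 / γ₁.len * ‖γ₁ - γ₂‖ * ‖γ₂‖) := by
        gcongr
        exact intervalIntegral.integral_nonneg zero_le_one fun _ _ => norm_nonneg _
    _ = C * (1 + (4 * ‖γ₁‖ + 2 * ‖γ₂‖) / γ₁.len) * ‖γ₁ - γ₂‖ := by ring
    _ ≤ C * (4 + (4 * ‖γ₁‖ + 4 * ‖γ₂‖) / γ₁.len) * ‖γ₁ - γ₂‖ := by
        gcongr <;> norm_num
    _ = _ := by ring

end W11Loop

/-! ### The vector field on `W^{1,1}` and uniqueness -/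

theorem norm_smul_sub_smul_le {E : Type*} [SeminormedAddCommGroup E] [NormedSpace ℝ E] (r s : ℝ)
    (x y : E) : ‖r • x - s • y‖ ≤ |r| * ‖x - y‖ + |r - s| * ‖y‖ := by
  have : r • x - s • y = r • (x - y) + (r - s) • y := by rw [smul_sub, sub_smul]; abel
  rw [this, ← Real.norm_eq_abs, ← Real.norm_eq_abs, ← norm_smul, ← norm_smul]
  exact norm_add_le _ _

namespace W11Loop

variable {lam : ℝ}

/-- Evaluation of a `W^{1,1}` loop at a point of the circle. -/
def evalL (q : UnitAddCircle) : W11Loop →L[ℝ] Plane :=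
  (ContinuousMap.evalCLM ℝ q).comp curveL

theorem fieldDeriv_integrable (lam : ℝ) (γ : W11Loop) :
    Integrable (fun x : ℝ => ‖γ.weakDeriv x‖ • tangent lam γ (x : UnitAddCircle) -
      γ.weakDeriv x) (volume.restrict (Ioc (0 : ℝ) 1)) := by
  refine (intervalIntegrable_iff_integrableOn_Ioc_of_le zero_le_one).1 ?_
  exact (γ.intervalIntegrable_weakDeriv.norm.smul_continuousOn
    ((tangent lam γ).continuous.comp (AddCircle.continuous_mk' 1)).continuousOn).sub
    γ.intervalIntegrable_weakDeriv

open Classical in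
/-- The vector field `-γ ∗_γ 𝒢^lam - γ`, with its weak derivative, on loops of positive length. -/
def baseField (lam : ℝ) (γ : W11Loop) : W11Loop :=
  if h : 0 < lam ∧ 0 < γ.len then
    ⟨(smoothed lam γ - γ.curve, (fieldDeriv_integrable lam γ).toL1 _), by
      intro x hx
      have hae := ae_restrict_of_ae_restrict_unit (fieldDeriv_integrable lam γ).coeFn_toL1 hx
      have h1 : ∫ s in (0 : ℝ)..x, (fieldDeriv_integrable lam γ).toL1 _ s =
          ∫ s in (0 : ℝ)..x, (‖γ.weakDeriv s‖ • tangent lam γ (s : UnitAddCircle) -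
            γ.weakDeriv s) := by
        rw [intervalIntegral.integral_of_le hx.1, intervalIntegral.integral_of_le hx.1]
        exact integral_congr_ae hae
      have h2 : IntervalIntegrable (fun s : ℝ => ‖γ.weakDeriv s‖ •
          tangent lam γ (s : UnitAddCircle)) volume 0 1 :=
        γ.intervalIntegrable_weakDeriv.norm.smul_continuousOn
          ((tangent lam γ).continuous.comp (AddCircle.continuous_mk' 1)).continuousOn
      simp only
      rw [h1, intervalIntegral.integral_sub
        (IntervalIntegrable.mono_unit h2 unit_left_mem hx)
        (IntervalIntegrable.mono_unit γ.intervalIntegrable_weakDeriv unit_left_mem hx),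
        ← smoothed_sub h.1 h.2 hx, ← γ.curve_sub x hx]
      simp only [ContinuousMap.sub_apply]
      abel⟩ else 0

theorem baseField_curve (hlam : 0 < lam) {γ : W11Loop} (hL : 0 < γ.len) :
    (baseField lam γ).curve = smoothed lam γ - γ.curve := by
  rw [baseField, dif_pos ⟨hlam, hL⟩]; rfl

theorem baseField_weakDeriv (hlam : 0 < lam) {γ : W11Loop} (hL : 0 < γ.len) :
    (baseField lam γ).weakDeriv = (fieldDeriv_integrable lam γ).toL1 _ := by
  rw [baseField, dif_pos ⟨hlam, hL⟩]; rfl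

/-- The vector field of the flow with parameter `a` on loops of positive length. -/
def field (lam a : ℝ) (γ : W11Loop) : W11Loop := (γ.len ^ (a - 2) / lam ^ 2) • baseField lam γ

end W11Loop

theorem greenConv_eq_neg_conv (lam : ℝ) (γ V : ℝ → Plane) (u : ℝ) :
    greenConv lam γ V u = -conv lam V (fun v => (‖V v‖ / length V) • γ v) u := by
  rw [greenConv, conv, ← intervalIntegral.integral_neg]
  congr 1; ext1 v
  rw [kernel, neg_smul, neg_neg, smul_smul]

namespace W11Loop

variable {lam : ℝ}

theorem flowField_eq (hlam : 0 < lam) (a : ℝ) {γ : W11Loop} (hL : 0 < γ.len) {u : ℝ}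
    (hu : u ∈ Icc (0 : ℝ) 1) :
    flowField lam a (fun x : ℝ => γ.curve (x : UnitAddCircle)) (fun x : ℝ => γ.weakDeriv x) u =
      (field lam a γ).curve (u : UnitAddCircle) := by
  have hL' : length (fun x => γ.weakDeriv x) ≠ 0 := ne_of_gt hL
  change _ = (γ.len ^ (a - 2) / lam ^ 2) • (baseField lam γ).curve (u : UnitAddCircle)
  rw [baseField_curve hlam hL, flowField, if_neg hL', gradLength,
    greenConv_eq_neg_conv, ContinuousMap.sub_apply, smoothed_coe hL hu, ← smul_neg]
  change (γ.len ^ (a - 2) / lam ^ 2) • _ = _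
  congr 1
  rw [neg_add, neg_neg]
  change -_ + conv lam (fun x => γ.weakDeriv x)
      (fun v => (‖γ.weakDeriv v‖ / γ.len) • γ.curve v) u = _
  abel

/-- The kernel is Lipschitz on `[-1,1]`, and the arc length functions are Lipschitz in the `W^{1,1}`
norm as long as the lengths stay away from zero; the constant depends only on `m` and `M`. -/
theorem exists_norm_baseField_sub_le (hlam : 0 < lam) {m : ℝ} (M : ℝ) (hm : 0 < m) :
    ∃ K : ℝ, 0 ≤ K ∧ ∀ γ₁ γ₂ : W11Loop, m ≤ γ₁.len → m ≤ γ₂.len → ‖γ₁‖ ≤ M → ‖γ₂‖ ≤ M →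
      ‖baseField lam γ₁ - baseField lam γ₂‖ ≤ K * ‖γ₁ - γ₂‖ := by
  obtain ⟨C₁, hC₁, h₁⟩ := exists_norm_smoothed_sub_le lam
  obtain ⟨C₂, hC₂, h₂⟩ := exists_norm_tangent_sub_le lam
  refine ⟨max (C₁ * (1 + (M + M) / m) + 1) (2 + |M| * (C₂ / m)),
    le_max_of_le_right (by positivity), ?_⟩
  intro γ₁ γ₂ hm₁ hm₂ hM₁ hM₂
  have hL₁ := hm.trans_le hm₁
  have hL₂ := hm.trans_le hm₂
  have hM : 0 ≤ M := (norm_nonneg γ₁).trans hM₁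
  rw [norm_eq, max_mul_of_nonneg _ _ (norm_nonneg (γ₁ - γ₂))]
  apply max_le_max
  · have e : (baseField lam γ₁ - baseField lam γ₂).curve =
        (smoothed lam γ₁ - smoothed lam γ₂) - (γ₁ - γ₂).curve := by
      change (baseField lam γ₁).curve - (baseField lam γ₂).curve = _ - (γ₁.curve - γ₂.curve)
      rw [baseField_curve hlam hL₁, baseField_curve hlam hL₂]
      abel
    rw [e, add_mul, one_mul]
    refine (norm_sub_le _ _).trans (add_le_add ?_ (norm_curve_le _))
    refine (h₁ γ₁ γ₂ hL₁ hL₂).trans ?_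
    gcongr
  · have e : (baseField lam γ₁ - baseField lam γ₂).weakDeriv =
        ((fieldDeriv_integrable lam γ₁).sub (fieldDeriv_integrable lam γ₂)).toL1 _ := by
      change (baseField lam γ₁).weakDeriv - (baseField lam γ₂).weakDeriv = _
      rw [baseField_weakDeriv hlam hL₁, baseField_weakDeriv hlam hL₂, Integrable.toL1_sub]
    have i₁ := γ₁.intervalIntegrable_weakDeriv
    have i₂ := γ₂.intervalIntegrable_weakDeriv
    rw [e, L1.norm_of_fun_eq_integral_norm, ← intervalIntegral.integral_of_le zero_le_one]
    have hd := h₂ γ₁ γ₂ hL₁ hL₂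
    have hd' : ‖tangent lam γ₁ - tangent lam γ₂‖ ≤ C₂ / m * ‖γ₁ - γ₂‖ :=
      hd.trans (by gcongr)
    have hint : IntervalIntegrable (fun x => 2 * ‖γ₁.weakDeriv x - γ₂.weakDeriv x‖ +
        ‖γ₂.weakDeriv x‖ * (C₂ / m * ‖γ₁ - γ₂‖)) volume 0 1 :=
      ((i₁.sub i₂).norm.const_mul _).add (i₂.norm.mul_const _)
    have hint' := ((fieldDeriv_integrable lam γ₁).sub (fieldDeriv_integrable lam γ₂))
    calc _ ≤ ∫ x in (0 : ℝ)..1, (2 * ‖γ₁.weakDeriv x - γ₂.weakDeriv x‖ +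
          ‖γ₂.weakDeriv x‖ * (C₂ / m * ‖γ₁ - γ₂‖)) := by
          apply intervalIntegral.integral_mono_on zero_le_one _ hint
          · intro x _
            rw [Pi.sub_apply]
            have : (‖γ₁.weakDeriv x‖ • tangent lam γ₁ (x : UnitAddCircle) - γ₁.weakDeriv x) -
                (‖γ₂.weakDeriv x‖ • tangent lam γ₂ (x : UnitAddCircle) - γ₂.weakDeriv x) =
                (‖γ₁.weakDeriv x‖ - ‖γ₂.weakDeriv x‖) • tangent lam γ₁ (x : UnitAddCircle) -
                (γ₁.weakDeriv x - γ₂.weakDeriv x) + ‖γ₂.weakDeriv x‖ •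
                  (tangent lam γ₁ - tangent lam γ₂) (x : UnitAddCircle) := by
              rw [ContinuousMap.sub_apply, sub_smul, smul_sub]; abel
            rw [this]
            refine (norm_add_le _ _).trans (add_le_add ?_ ?_)
            · refine (norm_sub_le _ _).trans ?_
              rw [norm_smul, two_mul]
              gcongr
              calc _ ≤ ‖γ₁.weakDeriv x - γ₂.weakDeriv x‖ * 1 := by
                    gcongr
                    · exact abs_norm_sub_norm_le _ _
                    · exact norm_tangent_le hlam hL₁ _
                _ = _ := mul_one _
            · rw [norm_smul, norm_norm]
              gcongr
              exact (ContinuousMap.norm_coe_le_norm _ _).trans hd'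
          · exact (intervalIntegrable_iff_integrableOn_Ioc_of_le zero_le_one).2 hint'.norm
      _ = 2 * (∫ x in (0 : ℝ)..1, ‖γ₁.weakDeriv x - γ₂.weakDeriv x‖) +
          γ₂.len * (C₂ / m * ‖γ₁ - γ₂‖) := by
          rw [intervalIntegral.integral_add ((i₁.sub i₂).norm.const_mul _) (i₂.norm.mul_const _),
            intervalIntegral.integral_const_mul, intervalIntegral.integral_mul_const]
          rfl
      _ ≤ 2 * ‖γ₁ - γ₂‖ + M * (C₂ / m * ‖γ₁ - γ₂‖) := by
          gcongr
          · exact integral_norm_weakDeriv_sub_le γ₁ γ₂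
          · rw [len_eq_norm]; exact γ₂.norm_weakDeriv_le.trans hM₂
      _ = _ := by rw [abs_of_nonneg hM]; ring

theorem dist_eq (γ₁ γ₂ : W11Loop) : dist γ₁ γ₂ = ‖γ₁ - γ₂‖ := dist_eq_norm γ₁ γ₂

/-- The field is a smooth function of the length times `baseField`. Positive length is needed for
both factors. -/
theorem field_locally_lipschitz (hlam : 0 < lam) (a : ℝ) {γ₀ : W11Loop} (hL : 0 < γ₀.len) :
    ∃ K : ℝ≥0, ∃ s ∈ 𝓝 γ₀, LipschitzOnWith K (field lam a) s := by
  set m := γ₀.len / 2 with hm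
  have hm0 : 0 < m := by positivity
  set M := ‖γ₀‖ + m with hM
  obtain ⟨K, hK0, hK⟩ := exists_norm_baseField_sub_le hlam M hm0
  have hc : ContDiffOn ℝ 1 (fun x : ℝ => x ^ (a - 2) / lam ^ 2) (Icc m M) := by
    intro x hx
    have : x ≠ 0 := (hm0.trans_le hx.1).ne'
    exact ((Real.contDiffAt_rpow_const_of_ne this).div_const _).contDiffWithinAt
  obtain ⟨B, hB⟩ := isCompact_Icc.exists_bound_of_continuousOn hc.continuousOn
  obtain ⟨K', hK'⟩ := hc.exists_lipschitzOnWith (by decide) (convex_Icc _ _) isCompact_Icc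
  set D := ‖baseField lam γ₀‖ + K * m with hD
  have hD0 : 0 ≤ D := by positivity
  have hball : ∀ γ ∈ Metric.ball γ₀ m, m ≤ γ.len ∧ ‖γ‖ ≤ M ∧ ‖baseField lam γ‖ ≤ D := by
    intro γ hγ
    rw [Metric.mem_ball, dist_eq] at hγ
    have h1 : m ≤ γ.len := by
      have := (abs_le.1 ((abs_len_sub_le γ γ₀).trans hγ.le)).1
      linarith
    have h2 : ‖γ‖ ≤ M := by
      have : ‖γ‖ ≤ ‖γ₀‖ + ‖γ - γ₀‖ := norm_le_insert' γ γ₀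
      linarith
    refine ⟨h1, h2, ?_⟩
    have h3 := hK γ γ₀ h1 (by linarith) h2 (by linarith)
    have h4 : ‖baseField lam γ‖ ≤ ‖baseField lam γ₀‖ + ‖baseField lam γ - baseField lam γ₀‖ :=
      norm_le_insert' (baseField lam γ) (baseField lam γ₀)
    have h5 : K * ‖γ - γ₀‖ ≤ K * m := by gcongr
    linarith
  have hmM : ∀ γ ∈ Metric.ball γ₀ m, γ.len ∈ Icc m M := fun γ hγ =>
    ⟨(hball γ hγ).1, by rw [len_eq_norm]; exact γ.norm_weakDeriv_le.trans (hball γ hγ).2.1⟩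
  refine ⟨(|B| * K + K' * D).toNNReal, Metric.ball γ₀ m, Metric.ball_mem_nhds _ hm0, ?_⟩
  apply LipschitzOnWith.of_dist_le_mul
  intro γ₁ h₁ γ₂ h₂
  rw [Real.coe_toNNReal _ (by positivity), dist_eq, dist_eq]
  have e1 := hK'.dist_le_mul _ (hmM _ h₁) _ (hmM _ h₂)
  rw [Real.dist_eq, Real.dist_eq] at e1
  rw [add_mul]
  refine (norm_smul_sub_smul_le _ _ (baseField lam γ₁) (baseField lam γ₂)).trans
    (add_le_add ?_ ?_)
  · rw [mul_assoc]
    exact mul_le_mul ((hB _ (hmM _ h₁)).trans (le_abs_self B))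
      (hK _ _ (hball _ h₁).1 (hball _ h₂).1 (hball _ h₁).2.1 (hball _ h₂).2.1)
      (norm_nonneg (baseField lam γ₁ - baseField lam γ₂)) (abs_nonneg B)
  · calc _ ≤ (K' * |γ₁.len - γ₂.len|) * D := by gcongr; exact (hball _ h₂).2.2
      _ ≤ (K' * ‖γ₁ - γ₂‖) * D := by gcongr; exact abs_len_sub_le γ₁ γ₂
      _ = _ := by ring

end W11Loop

/-! ### Time intervals -/

theorem mem_timeInterval_of_le {T : EReal} {s t : ℝ} (ht : t ∈ timeInterval T) (hs : 0 ≤ s)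
    (hst : s ≤ t) : s ∈ timeInterval T :=
  ⟨hs, (EReal.coe_le_coe_iff.2 hst).trans_lt ht.2⟩

theorem exists_gt_mem_timeInterval {T : EReal} {t : ℝ} (ht : t ∈ timeInterval T) :
    ∃ t' > t, t' ∈ timeInterval T := by
  obtain ⟨x, h1, h2⟩ := EReal.lt_iff_exists_real_btwn.1 ht.2
  have h1 : t < x := EReal.coe_lt_coe_iff.1 h1
  exact ⟨x, h1, ht.1.trans h1.le, h2⟩

theorem timeInterval_top : timeInterval ⊤ = Ici 0 := by
  ext t
  simp [timeInterval]

theorem uniqueDiffOn_timeInterval (T : EReal) : UniqueDiffOn ℝ (timeInterval T) := by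
  rcases (timeInterval T).eq_empty_or_nonempty with h | ⟨t, ht⟩
  · rw [h]; exact uniqueDiffOn_empty
  · obtain ⟨t', h1, h2⟩ := exists_gt_mem_timeInterval ht
    apply uniqueDiffOn_convex
    · apply OrdConnected.convex
      refine ⟨fun x hx y hy z hz => ?_⟩
      exact mem_timeInterval_of_le hy (hx.1.trans hz.1) hz.2
    · refine ⟨t' / 2, mem_interior.2 ⟨Ioo 0 t', ?_, isOpen_Ioo, ?_⟩⟩
      · exact fun x hx => mem_timeInterval_of_le h2 hx.1.le hx.2.le
      · have := ht.1
        constructor <;> linarith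

theorem timeInterval_mem_nhdsWithin_Ici {T : EReal} {t : ℝ} (ht : t ∈ timeInterval T) :
    timeInterval T ∈ 𝓝[Ici t] t := by
  obtain ⟨t', h1, h2⟩ := exists_gt_mem_timeInterval ht
  filter_upwards [Ico_mem_nhdsGE h1] with x hx
  exact mem_timeInterval_of_le h2 (ht.1.trans hx.1) hx.2.le

/-- Two trajectories of a vector field that is locally Lipschitz on `U` agree if they start at
the same point and one of them stays in `U`. -/
theorem eqOn_Icc_of_locally_lipschitz {E : Type*} [NormedAddCommGroup E] [NormedSpace ℝ E]
    {F : E → E} {U : Set E} {f g : ℝ → E} {b : ℝ} (hU : IsOpen U)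
    (hF : ∀ x ∈ U, ∃ K : ℝ≥0, ∃ s ∈ 𝓝 x, LipschitzOnWith K F s)
    (hfc : ContinuousOn f (Icc 0 b)) (hgc : ContinuousOn g (Icc 0 b))
    (hfU : ∀ t ∈ Icc 0 b, f t ∈ U)
    (hf : ∀ t ∈ Ico 0 b, HasDerivWithinAt f (F (f t)) (Ici t) t)
    (hg : ∀ t ∈ Ico 0 b, g t ∈ U → HasDerivWithinAt g (F (g t)) (Ici t) t)
    (h0 : f 0 = g 0) : ∀ t ∈ Icc 0 b, f t = g t := by
  rcases lt_or_ge b 0 with hb | hb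
  · intro t ht
    exact absurd (ht.1.trans ht.2) (not_le.2 hb)
  have hclosed : IsClosed ({t | f t = g t} ∩ Icc 0 b) := by
    rw [inter_comm]
    exact ContinuousOn.preimage_isClosed_of_isClosed (f := fun t => (f t, g t))
      (hfc.prodMk hgc) isClosed_Icc isClosed_diagonal
  refine hclosed.Icc_subset_of_forall_exists_gt h0 fun t ht y hy => ?_
  have htI : t ∈ Icc 0 b := Ico_subset_Icc_self ht.2
  obtain ⟨K, s, hs, hK⟩ := hF (f t) (hfU t htI)
  have hsU : s ∩ U ∈ 𝓝 (f t) := inter_mem hs (hU.mem_nhds (hfU t htI))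
  have hIcc : Icc t b ⊆ Icc 0 b := Icc_subset_Icc_left ht.2.1
  have e1 : ∀ᶠ r in 𝓝[Icc t b] t, f r ∈ s ∩ U :=
    ((hfc t htI).mono hIcc) hsU
  have e2 : ∀ᶠ r in 𝓝[Icc t b] t, g r ∈ s ∩ U := by
    have := ht.1
    rw [mem_ofPred_eq] at this
    rw [this] at hsU
    exact ((hgc t htI).mono hIcc) hsU
  obtain ⟨ε, hε, hball⟩ := Metric.mem_nhdsWithin_iff.1 (e1.and e2)
  set c := min (min (t + ε / 2) y) b with hc
  have htc : t < c := by
    refine lt_min (lt_min ?_ hy) ht.2.2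
    linarith
  have hcb : c ≤ b := min_le_right _ _
  have hcε : c ≤ t + ε / 2 := (min_le_left _ _).trans (min_le_left _ _)
  have hin : ∀ r ∈ Icc t c, f r ∈ s ∩ U ∧ g r ∈ s ∩ U := by
    intro r hr
    refine hball ⟨?_, hr.1, hr.2.trans hcb⟩
    rw [Metric.mem_ball, Real.dist_eq, abs_of_nonneg (by linarith [hr.1])]
    linarith [hr.2]
  have hsub : Icc t c ⊆ Icc 0 b := fun r hr => ⟨ht.2.1.trans hr.1, hr.2.trans hcb⟩
  have hEq := ODE_solution_unique_of_mem_Icc_right (v := fun _ => F) (s := fun _ => s ∩ U)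
    (K := K) (f := f) (g := g) (a := t) (b := c)
    (fun _ _ => hK.mono inter_subset_left) (hfc.mono hsub)
    (fun r hr => hf r ⟨ht.2.1.trans hr.1, hr.2.trans_le hcb⟩)
    (fun r hr => (hin r (Ico_subset_Icc_self hr)).1) (hgc.mono hsub)
    (fun r hr => hg r ⟨ht.2.1.trans hr.1, hr.2.trans_le hcb⟩
      (hin r (Ico_subset_Icc_self hr)).2.2)
    (fun r hr => (hin r (Ico_subset_Icc_self hr)).2) ht.1
  exact ⟨c, hEq (right_mem_Icc.2 htc.le), htc, (min_le_left _ _).trans (min_le_right _ _)⟩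

theorem IsW11Flow.hasDerivWithinAt {lam a : ℝ} {T : EReal} {Y : ℝ → W11Loop} (hlam : 0 < lam)
    (hY : IsW11Flow lam a T Y) {t : ℝ} (ht : t ∈ timeInterval T) (hL : 0 < (Y t).len) :
    HasDerivWithinAt Y (W11Loop.field lam a (Y t)) (timeInterval T) t := by
  have hd := (hY.1.differentiableOn_one t ht).hasDerivWithinAt
  have : derivWithin Y (timeInterval T) t = W11Loop.field lam a (Y t) := by
    apply W11Loop.ext_curve
    apply loop_ext
    intro u hu
    have h1 := (W11Loop.evalL (u : UnitAddCircle)).hasFDerivAt.comp_hasDerivWithinAt t hd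
    have h2 := hY.2 t ht u hu
    rw [W11Loop.flowField_eq hlam a hL hu] at h2
    exact (uniqueDiffOn_timeInterval T t ht).eq_deriv _ h1 h2
  rwa [this] at hd

/-- A `W^{1,1}` solution of positive length is the only `W^{1,1}` solution with its initial
value. -/
theorem IsW11Flow.unique {lam a : ℝ} {T : EReal} {Y₁ Y₂ : ℝ → W11Loop} (hlam : 0 < lam)
    (h₁ : IsW11Flow lam a T Y₁) (h₂ : IsW11Flow lam a T Y₂)
    (hpos : ∀ t ∈ timeInterval T, 0 < (Y₁ t).len) (h0 : (Y₁ 0).curve = (Y₂ 0).curve) :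
    ∀ t ∈ timeInterval T, Y₁ t = Y₂ t := by
  intro t ht
  have hsub : Icc 0 t ⊆ timeInterval T := fun s hs => mem_timeInterval_of_le ht hs.1 hs.2
  refine eqOn_Icc_of_locally_lipschitz (F := W11Loop.field lam a) (U := {γ | 0 < γ.len})
    (isOpen_lt continuous_const W11Loop.continuous_len)
    (fun γ hγ => W11Loop.field_locally_lipschitz hlam a hγ)
    (h₁.1.continuousOn.mono hsub) (h₂.1.continuousOn.mono hsub) (fun s hs => hpos s (hsub hs))
    (fun s hs => ?_) (fun s hs hL => ?_) (W11Loop.ext_curve h0) t ⟨ht.1, le_rfl⟩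
  · have hsT := hsub (Ico_subset_Icc_self hs)
    exact (h₁.hasDerivWithinAt hlam hsT (hpos s hsT)).mono_of_mem_nhdsWithin
      (timeInterval_mem_nhdsWithin_Ici hsT)
  · have hsT := hsub (Ico_subset_Icc_self hs)
    exact (h₂.hasDerivWithinAt hlam hsT hL).mono_of_mem_nhdsWithin
      (timeInterval_mem_nhdsWithin_Ici hsT)

/-! ### Loops of class `C^k` -/

theorem loop_periodic {E : Type*} (f : UnitAddCircle → E) :
    Function.Periodic (fun x : ℝ => f (x : UnitAddCircle)) 1 := by
  intro x
  simp only
  rw [AddCircle.coe_add, AddCircle.coe_period, add_zero]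

theorem loop_comp_continuous {E : Type*} [TopologicalSpace E] (f : C(UnitAddCircle, E)) :
    Continuous fun x : ℝ => f (x : UnitAddCircle) :=
  f.continuous.comp (AddCircle.continuous_mk' 1)

theorem hasDerivAt_loop_of_integral {f g : C(UnitAddCircle, Plane)}
    (h : ∀ x ∈ Icc (0 : ℝ) 1, f (x : UnitAddCircle) - f ((0 : ℝ) : UnitAddCircle) =
      ∫ s in (0 : ℝ)..x, g (s : UnitAddCircle)) (x : ℝ) :
    HasDerivAt (fun y : ℝ => f (y : UnitAddCircle)) (g (x : UnitAddCircle)) x := by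
  have hg := loop_comp_continuous g
  have hint : ∀ a b : ℝ, IntervalIntegrable (fun s : ℝ => g (s : UnitAddCircle)) volume a b :=
    fun a b => hg.intervalIntegrable a b
  have h1 : ∫ s in (0 : ℝ)..1, g (s : UnitAddCircle) = 0 := by
    rw [← h 1 unit_right_mem, coe_one_eq_zero, sub_self]
  have h2 : ∀ y : ℝ, f (y : UnitAddCircle) =
      f ((0 : ℝ) : UnitAddCircle) + ∫ s in (0 : ℝ)..y, g (s : UnitAddCircle) := by
    intro y
    have hp := loop_periodic g
    have e1 : f (y : UnitAddCircle) = f ((Int.fract y : ℝ) : UnitAddCircle) := by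
      have := (loop_periodic f).sub_zsmul_eq (x := y) ⌊y⌋
      have e0 : y - ⌊y⌋ • (1 : ℝ) = Int.fract y := by rw [zsmul_one]; rfl
      rw [← this, e0]
    have e2 : ∫ s in (Int.fract y)..(Int.fract y + ⌊y⌋ • (1 : ℝ)), g (s : UnitAddCircle) = 0 := by
      rw [hp.intervalIntegral_add_zsmul_eq ⌊y⌋ _ hint, hp.intervalIntegral_add_eq _ 0, zero_add,
        h1, smul_zero]
    have e3 : Int.fract y + ⌊y⌋ • (1 : ℝ) = y := by simp
    rw [e3] at e2
    rw [e1, ← intervalIntegral.integral_add_adjacent_intervals (hint 0 (Int.fract y)) (hint _ _),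
      e2, add_zero, ← h _ ⟨Int.fract_nonneg y, (Int.fract_lt_one y).le⟩]
    abel
  rw [funext h2]
  exact (intervalIntegral.integral_hasDerivAt_right (hint _ _)
    hg.stronglyMeasurable.stronglyMeasurableAtFilter hg.continuousAt).const_add _

theorem integral_loop_of_hasDerivAt {f g : C(UnitAddCircle, Plane)}
    (h : ∀ x : ℝ, HasDerivAt (fun y : ℝ => f (y : UnitAddCircle)) (g (x : UnitAddCircle)) x)
    (a b : ℝ) : f (b : UnitAddCircle) - f (a : UnitAddCircle) =
      ∫ s in a..b, g (s : UnitAddCircle) :=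
  (intervalIntegral.integral_eq_sub_of_hasDerivAt (fun x _ => h x)
    ((loop_comp_continuous g).intervalIntegrable a b)).symm

theorem isClosed_ckSubmodule (k : ℕ) :
    IsClosed (ckSubmodule k : Set (Fin (k + 1) → C(UnitAddCircle, Plane))) := by
  have : (ckSubmodule k : Set (Fin (k + 1) → C(UnitAddCircle, Plane))) =
      ⋂ (j : Fin k) (x : ℝ), {γ | γ j.castSucc (x : UnitAddCircle) -
        γ j.castSucc ((0 : ℝ) : UnitAddCircle) =
        ∫ s in (0 : ℝ)..x, γ j.succ (s : UnitAddCircle)} := by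
    ext γ
    simp only [mem_iInter]
    constructor
    · intro h j x
      exact integral_loop_of_hasDerivAt (h j) 0 x
    · intro h j x
      exact hasDerivAt_loop_of_integral (fun y _ => h j y) x
  rw [this]
  refine isClosed_iInter fun j => isClosed_iInter fun x => isClosed_eq ?_ ?_
  · exact ((continuous_eval_const _).comp (continuous_apply _)).sub
      ((continuous_eval_const _).comp (continuous_apply _))
  · apply intervalIntegral.continuous_parametric_intervalIntegral_of_continuous'
    have h1 : Continuous fun p : (Fin (k + 1) → C(UnitAddCircle, Plane)) × ℝ =>
        ((p.1 j.succ, (p.2 : UnitAddCircle)) : C(UnitAddCircle, Plane) × UnitAddCircle) :=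
      ((continuous_apply _).comp continuous_fst).prodMk
        ((AddCircle.continuous_mk' 1).comp continuous_snd)
    exact ContinuousEval.continuous_eval.comp h1

instance (k : ℕ) : CompleteSpace (CkLoop k) :=
  (isClosed_ckSubmodule k).completeSpace_coe

instance (k : ℕ) : NormedAddCommGroup (CkLoop k) := Submodule.normedAddCommGroup _

instance (k : ℕ) : SeminormedAddCommGroup (CkLoop k) :=
  NormedAddCommGroup.toSeminormedAddCommGroup

instance (k : ℕ) : NormedSpace ℝ (CkLoop k) := Submodule.normedSpace _

theorem integral_congr_unit {E : Type*} [NormedAddCommGroup E] [NormedSpace ℝ E] {f g : ℝ → E}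
    (h : f =ᵐ[volume.restrict (Ioc (0 : ℝ) 1)] g) {u : ℝ} (hu : u ∈ Icc (0 : ℝ) 1) :
    ∫ s in (0 : ℝ)..u, f s = ∫ s in (0 : ℝ)..u, g s := by
  rw [intervalIntegral.integral_of_le hu.1, intervalIntegral.integral_of_le hu.1]
  exact integral_congr_ae (ae_restrict_of_ae_restrict_unit h hu)

section Congr

variable {V V' w w' : ℝ → Plane} {lam : ℝ}

theorem length_congr (h : V =ᵐ[volume.restrict (Ioc (0 : ℝ) 1)] V') : length V = length V' :=
  integral_congr_unit (h.mono fun _ hx => by simp only [hx]) unit_right_mem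

theorem arc_congr (h : V =ᵐ[volume.restrict (Ioc (0 : ℝ) 1)] V') {u : ℝ}
    (hu : u ∈ Icc (0 : ℝ) 1) : arc V u = arc V' u := by
  have h' : (fun s => ‖V s‖) =ᵐ[volume.restrict (Ioc (0 : ℝ) 1)] fun s => ‖V' s‖ :=
    h.mono fun _ hx => by simp only [hx]
  rw [arc, arc, length_congr h, integral_congr_unit h' hu]

theorem conv_congr (h : V =ᵐ[volume.restrict (Ioc (0 : ℝ) 1)] V')
    (hw : w =ᵐ[volume.restrict (Ioc (0 : ℝ) 1)] w') {u : ℝ} (hu : u ∈ Icc (0 : ℝ) 1) :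
    conv lam V w u = conv lam V' w' u := by
  apply integral_congr_unit _ unit_right_mem
  filter_upwards [hw, ae_restrict_mem measurableSet_Ioc] with v hv hv'
  rw [hv, arc_congr h hu, arc_congr h ⟨hv'.1.le, hv'.2⟩]

theorem flowField_congr (h : V =ᵐ[volume.restrict (Ioc (0 : ℝ) 1)] V') (a : ℝ) (γ : ℝ → Plane)
    {u : ℝ} (hu : u ∈ Icc (0 : ℝ) 1) : flowField lam a γ V u = flowField lam a γ V' u := by
  have hw : (fun v => (‖V v‖ / length V) • γ v) =ᵐ[volume.restrict (Ioc (0 : ℝ) 1)]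
      fun v => (‖V' v‖ / length V') • γ v :=
    h.mono fun _ hx => by simp only [hx, length_congr h]
  rw [flowField, flowField, gradLength, gradLength, greenConv_eq_neg_conv, greenConv_eq_neg_conv,
    conv_congr h hw hu, length_congr h]

end Congr

namespace CkLoop

/-- The `j`-th derivative as a continuous linear function of the `C^k` loop. -/
def jetL (k : ℕ) (j : Fin (k + 1)) : CkLoop k →L[ℝ] C(UnitAddCircle, Plane) :=
  (ContinuousLinearMap.proj (R := ℝ) j).comp (ckSubmodule k).subtypeL

theorem norm_jet_le {k : ℕ} (γ : CkLoop k) (j : Fin (k + 1)) : ‖γ.jet j‖ ≤ ‖γ‖ :=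
  norm_le_pi_norm (γ : Fin (k + 1) → C(UnitAddCircle, Plane)) j

theorem norm_le_of_jet {k : ℕ} {γ : CkLoop k} {B : ℝ} (hB : 0 ≤ B) (h : ∀ j, ‖γ.jet j‖ ≤ B) :
    ‖γ‖ ≤ B := (pi_norm_le_iff_of_nonneg hB).2 h

variable {n : ℕ}

theorem hasDerivAt_jet_zero (γ : CkLoop (n + 1)) (x : ℝ) :
    HasDerivAt (fun y : ℝ => γ.jet 0 (y : UnitAddCircle)) (γ.jet 1 (x : UnitAddCircle)) x :=
  γ.2 0 x

theorem hasDerivAt_jet_one (γ : CkLoop 2) (x : ℝ) :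
    HasDerivAt (fun y : ℝ => γ.jet 1 (y : UnitAddCircle)) (γ.jet 2 (x : UnitAddCircle)) x :=
  γ.2 1 x

theorem jet_integrable (γ : CkLoop (n + 1)) (j : Fin (n + 2)) :
    Integrable (fun x : ℝ => γ.jet j (x : UnitAddCircle)) (volume.restrict (Ioc (0 : ℝ) 1)) :=
  (intervalIntegrable_iff_integrableOn_Ioc_of_le zero_le_one).1
    ((loop_comp_continuous (γ.jet j)).intervalIntegrable 0 1)

/-- A `C^(n+1)` loop as a `W^{1,1}` loop. -/
def toW11Fun (γ : CkLoop (n + 1)) : W11Loop :=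
  ⟨(γ.jet 0, (γ.jet_integrable 1).toL1 _), by
    intro x hx
    have hae := ae_restrict_of_ae_restrict_unit (γ.jet_integrable 1).coeFn_toL1 hx
    simp only
    rw [integral_loop_of_hasDerivAt γ.hasDerivAt_jet_zero, intervalIntegral.integral_of_le hx.1,
      intervalIntegral.integral_of_le hx.1]
    exact (integral_congr_ae hae).symm⟩

theorem toW11Fun_weakDeriv (γ : CkLoop (n + 1)) :
    (fun x => γ.toW11Fun.weakDeriv x) =ᵐ[volume.restrict (Ioc (0 : ℝ) 1)]
      fun x : ℝ => γ.jet 1 (x : UnitAddCircle) := (γ.jet_integrable 1).coeFn_toL1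

theorem norm_toW11Fun_le (γ : CkLoop (n + 1)) : ‖γ.toW11Fun‖ ≤ 1 * ‖γ‖ := by
  rw [one_mul, W11Loop.norm_eq]
  apply max_le (γ.norm_jet_le 0)
  rw [← W11Loop.len_eq_norm, W11Loop.len, length_congr γ.toW11Fun_weakDeriv]
  have h := intervalIntegral.integral_mono_on zero_le_one
    ((loop_comp_continuous (γ.jet 1)).norm.intervalIntegrable 0 1)
    (intervalIntegrable_const (μ := volume) (c := ‖γ‖))
    fun x _ => (ContinuousMap.norm_coe_le_norm (γ.jet 1) (x : UnitAddCircle)).trans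
      (γ.norm_jet_le 1)
  rw [intervalIntegral.integral_const, sub_zero, one_smul] at h
  exact h

/-- The inclusion of `C^(n+1)` in `W^{1,1}` as a linear map. -/
def toW11Lin (n : ℕ) : CkLoop (n + 1) →ₗ[ℝ] W11Loop where
  toFun := toW11Fun
  map_add' _ _ := W11Loop.ext_curve rfl
  map_smul' _ _ := W11Loop.ext_curve rfl

/-- The inclusion of `C^(n+1)` in `W^{1,1}`. -/
def toW11 : CkLoop (n + 1) →L[ℝ] W11Loop :=
  (toW11Lin n).mkContinuous 1 norm_toW11Fun_le

theorem norm_toW11_le (γ : CkLoop (n + 1)) : ‖toW11 γ‖ ≤ ‖γ‖ := by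
  have h : ‖(toW11 : CkLoop (n + 1) →L[ℝ] W11Loop)‖ ≤ 1 :=
    LinearMap.mkContinuous_norm_le _ zero_le_one _
  calc _ ≤ ‖(toW11 : CkLoop (n + 1) →L[ℝ] W11Loop)‖ * ‖γ‖ := ContinuousLinearMap.le_opNorm _ γ
    _ ≤ 1 * ‖γ‖ := mul_le_mul_of_nonneg_right h (norm_nonneg γ)
    _ = _ := one_mul _

theorem toW11_curve (γ : CkLoop (n + 1)) : (toW11 γ).curve = γ.jet 0 := rfl

theorem toW11_weakDeriv (γ : CkLoop (n + 1)) :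
    (fun x => (toW11 γ).weakDeriv x) =ᵐ[volume.restrict (Ioc (0 : ℝ) 1)]
      fun x : ℝ => γ.jet 1 (x : UnitAddCircle) := γ.toW11Fun_weakDeriv

end CkLoop

namespace CkLoop

variable {n : ℕ} {lam : ℝ}

theorem len_eq (γ : CkLoop (n + 1)) : (toW11 γ).len = γ.len := length_congr γ.toW11_weakDeriv

theorem flowField_toW11 (γ : CkLoop (n + 1)) (a : ℝ) {u : ℝ} (hu : u ∈ Icc (0 : ℝ) 1) :
    flowField lam a (fun x : ℝ => (toW11 γ).curve (x : UnitAddCircle))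
      (fun x => (toW11 γ).weakDeriv x) u =
    flowField lam a (fun x : ℝ => γ.jet 0 (x : UnitAddCircle))
      (fun x : ℝ => γ.jet 1 (x : UnitAddCircle)) u :=
  flowField_congr γ.toW11_weakDeriv a _ hu

theorem len_pos_of_isImmersed {γ : CkLoop (n + 1)} (h : IsImmersed γ) : 0 < γ.len := by
  refine intervalIntegral.intervalIntegral_pos_of_pos
    ((loop_comp_continuous (γ.jet 1)).norm.intervalIntegrable 0 1) (fun x => ?_) zero_lt_one
  exact norm_pos_iff.2 (h _)

end CkLoop

theorem IsCkFlow.isW11Flow {n : ℕ} {lam a : ℝ} {T : EReal} {X : ℝ → CkLoop (n + 1)}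
    (hX : IsCkFlow lam a T X) : IsW11Flow lam a T (fun t => CkLoop.toW11 (X t)) := by
  refine ⟨CkLoop.toW11.contDiff.comp_contDiffOn hX.1, fun t ht u hu => ?_⟩
  rw [CkLoop.flowField_toW11 _ a hu]
  exact hX.2 t ht u hu

/-- A regular solution with positive length agrees with every `W^{1,1}` solution. -/
theorem IsCkFlow.unique {n : ℕ} {lam a : ℝ} {T : EReal} {X : ℝ → CkLoop (n + 1)}
    {Y : ℝ → W11Loop} (hlam : 0 < lam) (hX : IsCkFlow lam a T X) (hY : IsW11Flow lam a T Y)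
    (hpos : ∀ t ∈ timeInterval T, 0 < (X t).len) (h0 : (Y 0).curve = (X 0).jet 0) :
    ∀ t ∈ timeInterval T, Y t = CkLoop.toW11 (X t) := fun t ht =>
  (hX.isW11Flow.unique hlam hY (fun s hs => by rw [CkLoop.len_eq]; exact hpos s hs) h0.symm
    t ht).symm

/-! ### Convolution over a full period -/

section Shift

variable {V w : ℝ → Plane} {lam : ℝ}

/-- The convolution along a periodic curve, with the integration over the period that starts at the
point `u`; there the kernel is a smooth function of the arc length. -/
def shiftConv (lam : ℝ) (V w : ℝ → Plane) (u : ℝ) : Plane :=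
  ∫ v in u..(u + 1), (Real.cosh ((arc V v - arc V u - 1 / 2) / lam) /
    (2 * lam * Real.sinh (1 / (2 * lam)))) • w v

theorem arc_continuous (hV : Continuous V) : Continuous (arc V) :=
  (intervalIntegral.continuous_primitive (fun a b => hV.norm.intervalIntegrable a b) 0).div_const _

theorem hasDerivAt_arc (hV : Continuous V) (u : ℝ) :
    HasDerivAt (arc V) (‖V u‖ / length V) u :=
  (intervalIntegral.integral_hasDerivAt_right (hV.norm.intervalIntegrable 0 u)
    hV.norm.stronglyMeasurable.stronglyMeasurableAtFilter hV.norm.continuousAt).div_const _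

theorem arc_add_one (hV : Continuous V) (hp : Function.Periodic V 1) (hL : 0 < length V) (u : ℝ) :
    arc V (u + 1) = arc V u + 1 := by
  have hp' : Function.Periodic (fun s => ‖V s‖) 1 := fun s => by simp only [hp s]
  rw [arc, hp'.intervalIntegral_add_eq_add 0 u fun a b => hV.norm.intervalIntegrable a b, zero_add,
    add_div, arc]
  congr 1
  exact div_self hL.ne'

theorem conv_eq_shiftConv (hV : Continuous V) (hp : Function.Periodic V 1) (hL : 0 < length V)
    (hw : Continuous w) (hwp : Function.Periodic w 1) {u : ℝ} (hu : u ∈ Icc (0 : ℝ) 1) :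
    conv lam V w u = shiftConv lam V w u := by
  have hA := arc_continuous hV
  set g : ℝ → Plane := fun v => (Real.cosh ((arc V v - arc V u - 1 / 2) / lam) /
    (2 * lam * Real.sinh (1 / (2 * lam)))) • w v with hg
  have hgc : Continuous g := by fun_prop
  have hmono := arc_monotoneOn (hV.intervalIntegrable 0 1)
  have hkc : Continuous fun v => kernel lam (arc V v - arc V u) • w v := by fun_prop
  have h1 : ∫ v in (0 : ℝ)..u, kernel lam (arc V v - arc V u) • w v =
      ∫ v in (1 : ℝ)..(u + 1), g v := by
    have h2 : ∫ v in (0 : ℝ)..u, g (v + 1) = ∫ v in (1 : ℝ)..(u + 1), g v := by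
      rw [intervalIntegral.integral_comp_add_right g 1, zero_add]
    rw [← h2]
    apply intervalIntegral.integral_congr
    intro v hv
    rw [uIcc_of_le hu.1] at hv
    have hvu := hmono ⟨hv.1, hv.2.trans hu.2⟩ hu hv.2
    simp only [hg, hwp v, arc_add_one hV hp hL]
    rw [kernel_eq, abs_of_nonpos (by linarith), ← Real.cosh_neg]
    congr 3
    ring
  have h3 : ∫ v in u..1, kernel lam (arc V v - arc V u) • w v = ∫ v in u..1, g v := by
    apply intervalIntegral.integral_congr
    intro v hv
    rw [uIcc_of_le hu.2] at hv
    have hvu := hmono hu ⟨hu.1.trans hv.1, hv.2⟩ hv.1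
    simp only [hg]
    rw [kernel_eq, abs_of_nonneg (by linarith)]
  rw [conv, shiftConv, ← intervalIntegral.integral_add_adjacent_intervals
    (hkc.intervalIntegrable 0 u) (hkc.intervalIntegrable u 1), h1, h3, add_comm,
    intervalIntegral.integral_add_adjacent_intervals (hgc.intervalIntegrable _ _)
      (hgc.intervalIntegrable _ _)]

theorem hasDerivAt_integral_period {g : ℝ → Plane} (hg : Continuous g) (u : ℝ) :
    HasDerivAt (fun y => ∫ v in y..(y + 1), g v) (g (u + 1) - g u) u := by
  have hint : ∀ a b, IntervalIntegrable g volume a b := fun a b => hg.intervalIntegrable a b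
  have h0 : ∀ y, HasDerivAt (fun x => ∫ v in (0 : ℝ)..x, g v) (g y) y := fun y =>
    intervalIntegral.integral_hasDerivAt_right (hint _ _)
      hg.stronglyMeasurable.stronglyMeasurableAtFilter hg.continuousAt
  have h1 : (fun y => ∫ v in y..(y + 1), g v) =
      fun y => (∫ v in (0 : ℝ)..(y + 1), g v) - ∫ v in (0 : ℝ)..y, g v := by
    ext1 y
    rw [intervalIntegral.integral_interval_sub_left (hint _ _) (hint _ _)]
  rw [h1]
  exact ((h0 (u + 1)).comp_add_const u 1).sub (h0 u)

theorem shiftConv_eq (hV : Continuous V) (hw : Continuous w) (u : ℝ) :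
    shiftConv lam V w u = (2 * lam * Real.sinh (1 / (2 * lam)))⁻¹ •
      (Real.cosh (arc V u / lam) •
          (∫ v in u..(u + 1), Real.cosh ((arc V v - 1 / 2) / lam) • w v) -
        Real.sinh (arc V u / lam) •
          ∫ v in u..(u + 1), Real.sinh ((arc V v - 1 / 2) / lam) • w v) := by
  have hA := arc_continuous hV
  have h1 : Continuous fun v => Real.cosh ((arc V v - 1 / 2) / lam) • w v := by fun_prop
  have h2 : Continuous fun v => Real.sinh ((arc V v - 1 / 2) / lam) • w v := by fun_prop
  have h1' : Continuous fun v =>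
      Real.cosh (arc V u / lam) • Real.cosh ((arc V v - 1 / 2) / lam) • w v := by fun_prop
  have h2' : Continuous fun v =>
      Real.sinh (arc V u / lam) • Real.sinh ((arc V v - 1 / 2) / lam) • w v := by fun_prop
  rw [← intervalIntegral.integral_smul, ← intervalIntegral.integral_smul,
    ← intervalIntegral.integral_sub (h1'.intervalIntegrable _ _) (h2'.intervalIntegrable _ _),
    ← intervalIntegral.integral_smul, shiftConv]
  congr 1; ext1 v
  have : (arc V v - arc V u - 1 / 2) / lam = (arc V v - 1 / 2) / lam - arc V u / lam := by ring
  rw [this, Real.cosh_sub, smul_smul, smul_smul, ← sub_smul, smul_smul]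
  congr 1
  ring

theorem hasDerivAt_shiftConv (hV : Continuous V) (hp : Function.Periodic V 1)
    (hL : 0 < length V) (hw : Continuous w) (hwp : Function.Periodic w 1) (u : ℝ) :
    HasDerivAt (shiftConv lam V w)
      (-((‖V u‖ / length V / lam / (2 * lam * Real.sinh (1 / (2 * lam)))) •
        ∫ v in u..(u + 1), Real.sinh ((arc V v - arc V u - 1 / 2) / lam) • w v)) u := by
  have hA := arc_continuous hV
  have h1 : Continuous fun v => Real.cosh ((arc V v - 1 / 2) / lam) • w v := by fun_prop
  have h2 : Continuous fun v => Real.sinh ((arc V v - 1 / 2) / lam) • w v := by fun_prop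
  have hA' : HasDerivAt (fun y => arc V y / lam) (‖V u‖ / length V / lam) u :=
    (hasDerivAt_arc hV u).div_const _
  rw [funext (shiftConv_eq (lam := lam) hV hw)]
  have h3 := ((hA'.cosh.smul (hasDerivAt_integral_period h1 u)).sub
    (hA'.sinh.smul (hasDerivAt_integral_period h2 u))).const_smul
      (2 * lam * Real.sinh (1 / (2 * lam)))⁻¹
  refine h3.congr_deriv ?_
  set D := 2 * lam * Real.sinh (1 / (2 * lam)) with hD
  set ρ := ‖V u‖ / length V / lam with hρ
  have h4 : ∫ v in u..(u + 1), Real.sinh ((arc V v - arc V u - 1 / 2) / lam) • w v =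
      Real.cosh (arc V u / lam) • (∫ v in u..(u + 1), Real.sinh ((arc V v - 1 / 2) / lam) • w v) -
      Real.sinh (arc V u / lam) •
        ∫ v in u..(u + 1), Real.cosh ((arc V v - 1 / 2) / lam) • w v := by
    have h1' : Continuous fun v =>
        Real.sinh (arc V u / lam) • Real.cosh ((arc V v - 1 / 2) / lam) • w v := by fun_prop
    have h2' : Continuous fun v =>
        Real.cosh (arc V u / lam) • Real.sinh ((arc V v - 1 / 2) / lam) • w v := by fun_prop
    rw [← intervalIntegral.integral_smul, ← intervalIntegral.integral_smul,
      ← intervalIntegral.integral_sub (h2'.intervalIntegrable _ _) (h1'.intervalIntegrable _ _)]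
    congr 1; ext1 v
    have : (arc V v - arc V u - 1 / 2) / lam = (arc V v - 1 / 2) / lam - arc V u / lam := by ring
    rw [this, Real.sinh_sub, smul_smul, smul_smul, ← sub_smul]
    congr 1
    ring
  -- the boundary terms cancel because the kernel has equal values at both ends of the period
  have h5 : Real.cosh (arc V u / lam) * Real.cosh ((arc V u + 1 - 1 / 2) / lam) -
      Real.sinh (arc V u / lam) * Real.sinh ((arc V u + 1 - 1 / 2) / lam) =
      Real.cosh (arc V u / lam) * Real.cosh ((arc V u - 1 / 2) / lam) -
      Real.sinh (arc V u / lam) * Real.sinh ((arc V u - 1 / 2) / lam) := by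
    rw [← Real.cosh_sub, ← Real.cosh_sub, ← Real.cosh_neg]
    congr 1
    ring
  rw [h4, hwp u, arc_add_one hV hp hL]
  set I := ∫ v in u..(u + 1), Real.cosh ((arc V v - 1 / 2) / lam) • w v
  set J := ∫ v in u..(u + 1), Real.sinh ((arc V v - 1 / 2) / lam) • w v
  have h6 : ∀ c d s e f g : ℝ, c * e - s * f = c * d - s * g →
      c • (e • w u - d • w u) - s • (f • w u - g • w u) = 0 := by
    intro c d s e f g h
    have : c • (e • w u - d • w u) - s • (f • w u - g • w u) =
        ((c * e - s * f) - (c * d - s * g)) • w u := by module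
    rw [this, h, sub_self, zero_smul]
  have h7 := h6 _ _ _ _ _ _ h5
  have h8 : ∀ p q x y : Plane, p - q = 0 → D⁻¹ • (p + x - (q + y)) = D⁻¹ • (x - y) := by
    intro p q x y h
    rw [add_sub_add_comm, h, zero_add]
  rw [h8 _ _ _ _ h7, div_eq_inv_mul ρ D]
  module

/-- Differentiating the averaged tangent amounts to applying the differential equation of the
kernel. -/
theorem hasDerivAt_shiftConv_tangent (hlam : 0 < lam) {γ : ℝ → Plane} (hV : Continuous V)
    (hp : Function.Periodic V 1) (hL : 0 < length V) (hγ : ∀ x, HasDerivAt γ (V x) x)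
    (hγp : Function.Periodic γ 1) (u : ℝ) :
    HasDerivAt (shiftConv lam V fun v => (length V)⁻¹ • V v)
      ((‖V u‖ / (lam ^ 2 * length V ^ 2)) •
        (shiftConv lam V (fun v => (‖V v‖ / length V) • γ v) u - γ u)) u := by
  have hA := arc_continuous hV
  have hγc : Continuous γ := continuous_iff_continuousAt.2 fun x => (hγ x).continuousAt
  have h1 := hasDerivAt_shiftConv (lam := lam) (w := fun v => (length V)⁻¹ • V v) hV hp hL
    (hV.const_smul (length V)⁻¹) (fun v => by simp only [hp v]) u
  refine h1.congr_deriv ?_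
  have hs : ∀ v, HasDerivAt (fun y => Real.sinh ((arc V y - arc V u - 1 / 2) / lam))
      (Real.cosh ((arc V v - arc V u - 1 / 2) / lam) * (‖V v‖ / length V / lam)) v := fun v =>
    ((((hasDerivAt_arc hV v).sub_const _).sub_const _).div_const lam).sinh
  have h2 := intervalIntegral.integral_smul_deriv_eq_deriv_smul (a := u) (b := u + 1)
    (fun v _ => hs v) (fun v _ => hγ v)
    (Continuous.intervalIntegrable (by fun_prop) _ _) (hV.intervalIntegrable _ _)
  set D := 2 * lam * Real.sinh (1 / (2 * lam)) with hD
  have hD0 : 0 < D := kernel_den_pos hlam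
  set L := length V with hLd
  have e1 : Real.sinh ((arc V (u + 1) - arc V u - 1 / 2) / lam) = D / (2 * lam) := by
    rw [arc_add_one hV hp hL, hD]
    have : (arc V u + 1 - arc V u - 1 / 2) / lam = 1 / (2 * lam) := by field_simp; ring
    rw [this]
    field_simp
  have e2 : Real.sinh ((arc V u - arc V u - 1 / 2) / lam) = -(D / (2 * lam)) := by
    rw [hD]
    have : (arc V u - arc V u - 1 / 2) / lam = -(1 / (2 * lam)) := by field_simp; ring
    rw [this, Real.sinh_neg]
    field_simp
  have e3 : ∫ v in u..(u + 1),
      (Real.cosh ((arc V v - arc V u - 1 / 2) / lam) * (‖V v‖ / L / lam)) • γ v =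
      (D / lam) • shiftConv lam V (fun v => (‖V v‖ / L) • γ v) u := by
    rw [shiftConv, ← intervalIntegral.integral_smul, ← hD]
    congr 1; ext1 v
    rw [smul_smul, smul_smul]
    congr 1
    field_simp
  have e4 : ∫ v in u..(u + 1), Real.sinh ((arc V v - arc V u - 1 / 2) / lam) • L⁻¹ • V v =
      L⁻¹ • ((D / lam) • (γ u - shiftConv lam V (fun v => (‖V v‖ / L) • γ v) u)) := by
    have : ∀ v, Real.sinh ((arc V v - arc V u - 1 / 2) / lam) • L⁻¹ • V v =
        L⁻¹ • (Real.sinh ((arc V v - arc V u - 1 / 2) / lam) • V v) := fun v => smul_comm _ _ _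
    simp only [this]
    rw [intervalIntegral.integral_smul, h2, e1, e2, e3, hγp u]
    congr 1
    have : D / lam = D / (2 * lam) + D / (2 * lam) := by field_simp; ring
    rw [this]
    module
  rw [e4, smul_smul, smul_smul, ← smul_neg, neg_sub]
  congr 1
  field_simp

end Shift

/-! ### The averaged position and tangent of a regular loop -/

namespace CkLoop

variable {n : ℕ} {lam : ℝ}

/-- The position averaged with the kernel along arc length. -/
def smoothed (lam : ℝ) (γ : CkLoop (n + 1)) : C(UnitAddCircle, Plane) :=
  W11Loop.smoothed lam (toW11 γ)

/-- The unit tangent averaged with the kernel along arc length. -/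
def tangent (lam : ℝ) (γ : CkLoop (n + 1)) : C(UnitAddCircle, Plane) :=
  W11Loop.tangent lam (toW11 γ)

theorem smoothed_coe {γ : CkLoop (n + 1)} (hL : 0 < γ.len) {u : ℝ} (hu : u ∈ Icc (0 : ℝ) 1) :
    γ.smoothed lam (u : UnitAddCircle) = conv lam (fun x : ℝ => γ.jet 1 (x : UnitAddCircle))
      (fun v : ℝ => (‖γ.jet 1 (v : UnitAddCircle)‖ / γ.len) • γ.jet 0 (v : UnitAddCircle)) u := by
  rw [smoothed, W11Loop.smoothed_coe (by rw [len_eq]; exact hL) hu]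
  refine conv_congr γ.toW11_weakDeriv ?_ hu
  filter_upwards [γ.toW11_weakDeriv] with v hv
  rw [hv, toW11_curve, len_eq]

theorem tangent_coe {γ : CkLoop (n + 1)} (hL : 0 < γ.len) {u : ℝ} (hu : u ∈ Icc (0 : ℝ) 1) :
    γ.tangent lam (u : UnitAddCircle) = conv lam (fun x : ℝ => γ.jet 1 (x : UnitAddCircle))
      (fun v : ℝ => γ.len⁻¹ • γ.jet 1 (v : UnitAddCircle)) u := by
  rw [tangent, W11Loop.tangent_coe (by rw [len_eq]; exact hL) hu]
  refine conv_congr γ.toW11_weakDeriv ?_ hu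
  filter_upwards [γ.toW11_weakDeriv] with v hv
  rw [hv, len_eq]

theorem smoothed_coe_shift {γ : CkLoop (n + 1)} (hL : 0 < γ.len) {u : ℝ}
    (hu : u ∈ Icc (0 : ℝ) 1) :
    γ.smoothed lam (u : UnitAddCircle) = shiftConv lam (fun x : ℝ => γ.jet 1 (x : UnitAddCircle))
      (fun v : ℝ => (‖γ.jet 1 (v : UnitAddCircle)‖ / γ.len) • γ.jet 0 (v : UnitAddCircle)) u := by
  have h0 := loop_comp_continuous (γ.jet 0)
  have h1 := loop_comp_continuous (γ.jet 1)
  rw [smoothed_coe hL hu]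
  exact conv_eq_shiftConv h1 (loop_periodic (γ.jet 1)) hL (by fun_prop)
    (loop_periodic fun q => (‖γ.jet 1 q‖ / γ.len) • γ.jet 0 q) hu

theorem tangent_coe_shift {γ : CkLoop (n + 1)} (hL : 0 < γ.len) {u : ℝ}
    (hu : u ∈ Icc (0 : ℝ) 1) :
    γ.tangent lam (u : UnitAddCircle) = shiftConv lam (fun x : ℝ => γ.jet 1 (x : UnitAddCircle))
      (fun v : ℝ => γ.len⁻¹ • γ.jet 1 (v : UnitAddCircle)) u := by
  have h1 := loop_comp_continuous (γ.jet 1)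
  rw [tangent_coe hL hu]
  exact conv_eq_shiftConv h1 (loop_periodic (γ.jet 1)) hL (by fun_prop)
    (loop_periodic fun q => γ.len⁻¹ • γ.jet 1 q) hu

theorem norm_tangent_le (hlam : 0 < lam) {γ : CkLoop (n + 1)} (hL : 0 < γ.len)
    (q : UnitAddCircle) : ‖γ.tangent lam q‖ ≤ 1 :=
  W11Loop.norm_tangent_le hlam (by rw [len_eq]; exact hL) q

theorem norm_smoothed_le (hlam : 0 < lam) {γ : CkLoop (n + 1)} (hL : 0 < γ.len)
    (q : UnitAddCircle) : ‖γ.smoothed lam q‖ ≤ ‖γ.jet 0‖ := by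
  obtain ⟨u, hu, rfl⟩ := exists_coe_eq q
  have h0 := loop_comp_continuous (γ.jet 0)
  have h1 := loop_comp_continuous (γ.jet 1)
  have hA := arc_continuous h1
  have hI := integral_kernel_arc hlam (h1.intervalIntegrable 0 1) hL hu
  have e : ‖γ.jet 0‖ = ∫ v in (0 : ℝ)..1, ‖γ.jet 0‖ *
      (kernel lam (arc (fun x : ℝ => γ.jet 1 (x : UnitAddCircle)) v -
        arc (fun x : ℝ => γ.jet 1 (x : UnitAddCircle)) u) *
        (‖γ.jet 1 (v : UnitAddCircle)‖ / length fun x : ℝ => γ.jet 1 (x : UnitAddCircle))) := by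
    rw [intervalIntegral.integral_const_mul, hI, mul_one]
  rw [smoothed_coe hL hu, e]
  refine (intervalIntegral.norm_integral_le_integral_norm zero_le_one).trans ?_
  refine intervalIntegral.integral_mono_on zero_le_one
    (Continuous.intervalIntegrable (by fun_prop) _ _)
    (Continuous.intervalIntegrable (by fun_prop) _ _) fun v _ => ?_
  have hk := kernel_pos hlam (arc (fun x : ℝ => γ.jet 1 (x : UnitAddCircle)) v -
    arc (fun x : ℝ => γ.jet 1 (x : UnitAddCircle)) u)
  have hr : 0 ≤ ‖γ.jet 1 (v : UnitAddCircle)‖ / γ.len := by positivity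
  rw [norm_smul, norm_smul, Real.norm_of_nonneg hk.le, Real.norm_of_nonneg hr, ← mul_assoc,
    mul_comm]
  exact mul_le_mul_of_nonneg_right ((γ.jet 0).norm_coe_le_norm _) (mul_nonneg hk.le hr)

theorem hasDerivAt_smoothed (hlam : 0 < lam) {γ : CkLoop (n + 1)} (hL : 0 < γ.len) (x : ℝ) :
    HasDerivAt (fun y : ℝ => γ.smoothed lam (y : UnitAddCircle))
      (‖γ.jet 1 (x : UnitAddCircle)‖ • γ.tangent lam (x : UnitAddCircle)) x := by
  refine hasDerivAt_loop_of_integral (f := γ.smoothed lam)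
    (g := ⟨fun q => ‖γ.jet 1 q‖ • γ.tangent lam q, by fun_prop⟩) (fun u hu => ?_) x
  rw [smoothed, W11Loop.smoothed_sub hlam (by rw [len_eq]; exact hL) hu]
  refine integral_congr_unit ?_ hu
  filter_upwards [γ.toW11_weakDeriv] with v hv
  rw [hv]
  rfl

theorem hasDerivAt_tangent (hlam : 0 < lam) {γ : CkLoop (n + 1)} (hL : 0 < γ.len) (x : ℝ) :
    HasDerivAt (fun y : ℝ => γ.tangent lam (y : UnitAddCircle))
      ((‖γ.jet 1 (x : UnitAddCircle)‖ / (lam ^ 2 * γ.len ^ 2)) •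
        (γ.smoothed lam (x : UnitAddCircle) - γ.jet 0 (x : UnitAddCircle))) x := by
  refine hasDerivAt_loop_of_integral (f := γ.tangent lam)
    (g := ⟨fun q => (‖γ.jet 1 q‖ / (lam ^ 2 * γ.len ^ 2)) • (γ.smoothed lam q - γ.jet 0 q),
      by fun_prop⟩) (fun u hu => ?_) x
  have h0 := loop_comp_continuous (γ.jet 0)
  have h1 := loop_comp_continuous (γ.jet 1)
  have h2 := loop_comp_continuous (γ.smoothed lam)
  rw [tangent_coe_shift hL hu, tangent_coe_shift hL unit_left_mem]
  refine (intervalIntegral.integral_eq_sub_of_hasDerivAt (fun v hv => ?_)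
    (Continuous.intervalIntegrable ?_ _ _)).symm
  · have hv' : v ∈ Icc (0 : ℝ) 1 := by
      rw [uIcc_of_le hu.1] at hv; exact ⟨hv.1, hv.2.trans hu.2⟩
    have := hasDerivAt_shiftConv_tangent hlam h1 (loop_periodic (γ.jet 1)) hL
      γ.hasDerivAt_jet_zero (loop_periodic (γ.jet 0)) v
    simp only [ContinuousMap.coe_mk]
    rw [smoothed_coe_shift hL hv']
    exact this
  · simp only [ContinuousMap.coe_mk]
    fun_prop

theorem hasDerivAt_norm_jet_one {γ : CkLoop 2} (hγ : IsImmersed γ) (x : ℝ) :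
    HasDerivAt (fun y : ℝ => ‖γ.jet 1 (y : UnitAddCircle)‖)
      (inner ℝ (γ.jet 1 (x : UnitAddCircle)) (γ.jet 2 (x : UnitAddCircle)) *
        ‖γ.jet 1 (x : UnitAddCircle)‖⁻¹) x := by
  have h0 : 0 < ‖γ.jet 1 (x : UnitAddCircle)‖ := norm_pos_iff.2 (hγ _)
  have h := (γ.hasDerivAt_jet_one x).norm_sq.sqrt (by positivity)
  simp only [Real.sqrt_sq (norm_nonneg _)] at h
  refine h.congr_deriv ?_
  field_simp

end CkLoop

/-! ### The vector field on regular loops -/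

open Classical in
/-- The vector field of the flow with `a = 2` on `C¹` loops; loops that are not immersed get the
value zero. -/
def fieldOne (lam : ℝ) (γ : CkLoop 1) : CkLoop 1 :=
  if h : 0 < lam ∧ IsImmersed γ then
    (lam ^ 2)⁻¹ • ⟨![γ.smoothed lam - γ.jet 0,
      ⟨fun q => ‖γ.jet 1 q‖ • γ.tangent lam q - γ.jet 1 q, by fun_prop⟩], by
      intro j x
      fin_cases j
      exact (CkLoop.hasDerivAt_smoothed h.1 (CkLoop.len_pos_of_isImmersed h.2) x).sub
        (γ.hasDerivAt_jet_zero x)⟩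
  else 0

open Classical in
/-- The vector field of the flow with `a = 2` on `C²` loops; loops that are not immersed get the
value zero. -/
def fieldTwo (lam : ℝ) (γ : CkLoop 2) : CkLoop 2 :=
  if h : 0 < lam ∧ IsImmersed γ then
    (lam ^ 2)⁻¹ • ⟨![γ.smoothed lam - γ.jet 0,
      ⟨fun q => ‖γ.jet 1 q‖ • γ.tangent lam q - γ.jet 1 q, by fun_prop⟩,
      ⟨fun q => ‖γ.jet 1 q‖ • (‖γ.jet 1 q‖ / (lam ^ 2 * γ.len ^ 2)) •
          (γ.smoothed lam q - γ.jet 0 q) +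
        (inner ℝ (γ.jet 1 q) (γ.jet 2 q) * ‖γ.jet 1 q‖⁻¹) • γ.tangent lam q - γ.jet 2 q, by
        have h2 : ∀ q, ‖γ.jet 1 q‖ ≠ 0 := fun q => norm_ne_zero_iff.2 (h.2 q)
        have h3 : Continuous fun q => ‖γ.jet 1 q‖⁻¹ :=
          (γ.jet 1).continuous.norm.inv₀ h2
        fun_prop⟩], by
      intro j x
      have hL := CkLoop.len_pos_of_isImmersed h.2
      fin_cases j
      · exact (CkLoop.hasDerivAt_smoothed h.1 hL x).sub (γ.hasDerivAt_jet_zero x)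
      · exact ((CkLoop.hasDerivAt_norm_jet_one h.2 x).smul
          (CkLoop.hasDerivAt_tangent h.1 hL x)).sub (γ.hasDerivAt_jet_one x)⟩
  else 0

/-- The field `F` on `C^(n+1)` loops represents the flow with `a = 2`: it is given by the averaged
position and tangent on immersed loops, and vanishes on all other loops. -/
def IsFlowField {n : ℕ} (lam : ℝ) (F : CkLoop (n + 1) → CkLoop (n + 1)) : Prop :=
  (∀ γ, IsImmersed γ → ∀ q,
    (F γ).jet 0 q = (lam ^ 2)⁻¹ • (γ.smoothed lam q - γ.jet 0 q) ∧
    (F γ).jet 1 q = (lam ^ 2)⁻¹ • (‖γ.jet 1 q‖ • γ.tangent lam q - γ.jet 1 q)) ∧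
  ∀ γ, ¬ IsImmersed γ → F γ = 0

theorem isFlowField_fieldOne {lam : ℝ} (hlam : 0 < lam) : IsFlowField lam (fieldOne lam) := by
  refine ⟨fun γ hγ q => ?_, fun γ hγ => ?_⟩
  · rw [fieldOne, dif_pos ⟨hlam, hγ⟩]
    exact ⟨rfl, rfl⟩
  · rw [fieldOne, dif_neg fun h => hγ h.2]

theorem isFlowField_fieldTwo {lam : ℝ} (hlam : 0 < lam) : IsFlowField lam (fieldTwo lam) := by
  refine ⟨fun γ hγ q => ?_, fun γ hγ => ?_⟩
  · rw [fieldTwo, dif_pos ⟨hlam, hγ⟩]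
    exact ⟨rfl, rfl⟩
  · rw [fieldTwo, dif_neg fun h => hγ h.2]

theorem fieldTwo_jet_two {lam : ℝ} (hlam : 0 < lam) {γ : CkLoop 2} (hγ : IsImmersed γ)
    (q : UnitAddCircle) :
    (fieldTwo lam γ).jet 2 q = (lam ^ 2)⁻¹ •
      (‖γ.jet 1 q‖ • (‖γ.jet 1 q‖ / (lam ^ 2 * γ.len ^ 2)) • (γ.smoothed lam q - γ.jet 0 q) +
        (inner ℝ (γ.jet 1 q) (γ.jet 2 q) * ‖γ.jet 1 q‖⁻¹) • γ.tangent lam q - γ.jet 2 q) := by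
  rw [fieldTwo, dif_pos ⟨hlam, hγ⟩]
  rfl

theorem IsFlowField.flowField_eq {n : ℕ} {lam : ℝ} {F : CkLoop (n + 1) → CkLoop (n + 1)}
    (hF : IsFlowField lam F) {γ : CkLoop (n + 1)} (hγ : IsImmersed γ) {u : ℝ}
    (hu : u ∈ Icc (0 : ℝ) 1) :
    flowField lam 2 (fun x : ℝ => γ.jet 0 (x : UnitAddCircle))
      (fun x : ℝ => γ.jet 1 (x : UnitAddCircle)) u = (F γ).jet 0 (u : UnitAddCircle) := by
  have hL := CkLoop.len_pos_of_isImmersed hγ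
  have hL' : (length fun x : ℝ => γ.jet 1 (x : UnitAddCircle)) ≠ 0 := ne_of_gt hL
  rw [(hF.1 γ hγ _).1, CkLoop.smoothed_coe hL hu, flowField, if_neg hL', gradLength,
    greenConv_eq_neg_conv, sub_self, Real.rpow_zero, one_div, ← smul_neg]
  congr 1
  rw [neg_add_rev, neg_neg, sub_eq_add_neg]
  rfl

/-! ### Bounded Lipschitz families -/

/-- The functions `f x`, `x ∈ S`, are bounded and depend on `x` in a Lipschitz way, uniformly on
their common domain. -/
def LipBdd {E Q F : Type*} [SeminormedAddCommGroup E] [SeminormedAddCommGroup F] (S : Set E)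
    (f : E → Q → F) : Prop :=
  ∃ C, 0 ≤ C ∧ ∀ x ∈ S, ∀ q, ‖f x q‖ ≤ C ∧ ∀ y ∈ S, ‖f x q - f y q‖ ≤ C * ‖x - y‖

namespace LipBdd

variable {E Q F : Type*} [SeminormedAddCommGroup E] [SeminormedAddCommGroup F] {S : Set E}

theorem of_bounds {f : E → Q → F} {B C : ℝ} (hB : ∀ x ∈ S, ∀ q, ‖f x q‖ ≤ B)
    (hC : ∀ x ∈ S, ∀ q, ∀ y ∈ S, ‖f x q - f y q‖ ≤ C * ‖x - y‖) : LipBdd S f := by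
  refine ⟨max 0 (max B C), le_max_left _ _, fun x hx q => ⟨(hB x hx q).trans ?_, fun y hy =>
    (hC x hx q y hy).trans (mul_le_mul_of_nonneg_right ?_ (norm_nonneg _))⟩⟩
  · exact (le_max_left _ _).trans (le_max_right _ _)
  · exact (le_max_right _ _).trans (le_max_right _ _)

theorem const (c : F) : LipBdd S fun (_ : E) (_ : Q) => c :=
  of_bounds (B := ‖c‖) (C := 0) (fun _ _ _ => le_rfl) fun _ _ _ _ _ => by simp

theorem add {f g : E → Q → F} (hf : LipBdd S f) (hg : LipBdd S g) :
    LipBdd S fun x q => f x q + g x q := by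
  obtain ⟨A, hA, hf⟩ := hf
  obtain ⟨B, hB, hg⟩ := hg
  refine of_bounds (B := A + B) (C := A + B)
    (fun x hx q => (norm_add_le _ _).trans (add_le_add (hf x hx q).1 (hg x hx q).1))
    fun x hx q y hy => ?_
  rw [add_sub_add_comm, add_mul]
  exact (norm_add_le _ _).trans (add_le_add ((hf x hx q).2 y hy) ((hg x hx q).2 y hy))

theorem norm {f : E → Q → F} (hf : LipBdd S f) : LipBdd S fun x q => ‖f x q‖ := by
  obtain ⟨A, hA, hf⟩ := hf
  exact of_bounds (fun x hx q => by rw [norm_norm]; exact (hf x hx q).1)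
    fun x hx q y hy => (abs_norm_sub_norm_le _ _).trans ((hf x hx q).2 y hy)

theorem inv {f : E → Q → ℝ} (hf : LipBdd S f) {m : ℝ} (hm : 0 < m)
    (h : ∀ x ∈ S, ∀ q, m ≤ f x q) : LipBdd S fun x q => (f x q)⁻¹ := by
  obtain ⟨A, hA, hf⟩ := hf
  refine of_bounds (B := m⁻¹) (C := m⁻¹ * m⁻¹ * A) (fun x hx q => ?_) fun x hx q y hy => ?_
  · have h1 := h x hx q
    rw [Real.norm_of_nonneg (inv_nonneg.2 (hm.le.trans h1))]
    exact inv_anti₀ hm h1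
  · have h1 := h x hx q
    have h2 := h y hy q
    have h3 := (hf x hx q).2 y hy
    have p1 := hm.trans_le h1
    have p2 := hm.trans_le h2
    rw [inv_sub_inv p1.ne' p2.ne', norm_div, norm_sub_rev, div_eq_inv_mul, norm_mul,
      Real.norm_of_nonneg p1.le, Real.norm_of_nonneg p2.le, mul_inv, mul_assoc (m⁻¹ * m⁻¹)]
    have i1 := inv_anti₀ hm h1
    have i2 := inv_anti₀ hm h2
    have := inv_nonneg.2 p1.le
    have := inv_nonneg.2 p2.le
    gcongr

variable [NormedSpace ℝ F]

theorem smul {f : E → Q → ℝ} {g : E → Q → F} (hf : LipBdd S f) (hg : LipBdd S g) :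
    LipBdd S fun x q => f x q • g x q := by
  obtain ⟨A, hA, hf⟩ := hf
  obtain ⟨B, hB, hg⟩ := hg
  refine of_bounds (B := A * B) (C := A * B + A * B) (fun x hx q => ?_) fun x hx q y hy => ?_
  · rw [norm_smul]
    exact mul_le_mul (hf x hx q).1 (hg x hx q).1 (norm_nonneg _) hA
  · refine (norm_smul_sub_smul_le _ _ _ _).trans ?_
    have h1 := (hf x hx q).1
    have h2 := (hf x hx q).2 y hy
    have h3 := (hg y hy q).1
    have h4 := (hg x hx q).2 y hy
    rw [Real.norm_eq_abs] at h1 h2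
    have e : (A * B + A * B) * ‖x - y‖ = A * (B * ‖x - y‖) + (A * ‖x - y‖) * B := by ring
    rw [e]
    gcongr

theorem sub {f g : E → Q → F} (hf : LipBdd S f) (hg : LipBdd S g) :
    LipBdd S fun x q => f x q - g x q := by
  have h := hf.add ((const (-1 : ℝ)).smul hg)
  simpa only [neg_smul, one_smul, ← sub_eq_add_neg] using h

end LipBdd

theorem LipBdd.inner {E Q F : Type*} [SeminormedAddCommGroup E] [NormedAddCommGroup F]
    [InnerProductSpace ℝ F] {S : Set E} {f g : E → Q → F} (hf : LipBdd S f) (hg : LipBdd S g) :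
    LipBdd S fun x q => Inner.inner ℝ (f x q) (g x q) := by
  obtain ⟨A, hA, hf⟩ := hf
  obtain ⟨B, hB, hg⟩ := hg
  refine of_bounds (B := A * B) (C := A * B + A * B) (fun x hx q => ?_) fun x hx q y hy => ?_
  · exact (norm_inner_le_norm _ _).trans
      (mul_le_mul (hf x hx q).1 (hg x hx q).1 (norm_nonneg _) hA)
  · have h1 := (hf x hx q).1
    have h2 := (hf x hx q).2 y hy
    have h3 := (hg y hy q).1
    have h4 := (hg x hx q).2 y hy
    have e : Inner.inner ℝ (f x q) (g x q) - Inner.inner ℝ (f y q) (g y q) =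
        Inner.inner ℝ (f x q) (g x q - g y q) + Inner.inner ℝ (f x q - f y q) (g y q) := by
      rw [inner_sub_right, inner_sub_left]; ring
    rw [e]
    refine (norm_add_le _ _).trans ?_
    have e' : (A * B + A * B) * ‖x - y‖ = A * (B * ‖x - y‖) + (A * ‖x - y‖) * B := by ring
    rw [e']
    refine add_le_add ((norm_inner_le_norm _ _).trans ?_) ((norm_inner_le_norm _ _).trans ?_)
    · gcongr
    · gcongr

/-! ### The field is locally Lipschitz -/

/-- Loops of norm at most `M` and speed at least `m`. -/
def speedSet (n : ℕ) (M m : ℝ) : Set (CkLoop (n + 1)) := {γ | ‖γ‖ ≤ M ∧ ∀ q, m ≤ ‖γ.jet 1 q‖}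

namespace CkLoop

variable {n : ℕ} {lam M m : ℝ}

theorem norm_jet_sub_le (γ β : CkLoop n) (j : Fin (n + 1)) (q : UnitAddCircle) :
    ‖γ.jet j q - β.jet j q‖ ≤ ‖γ - β‖ :=
  ((γ - β).jet j).norm_coe_le_norm q |>.trans ((γ - β).norm_jet_le j)

theorem isImmersed_of_mem_speedSet (hm : 0 < m) {γ : CkLoop (n + 1)} (h : γ ∈ speedSet n M m) :
    IsImmersed γ := fun q => norm_pos_iff.1 (hm.trans_le (h.2 q))

theorem le_len {γ : CkLoop (n + 1)} (h : ∀ q, m ≤ ‖γ.jet 1 q‖) : m ≤ γ.len := by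
  have h := intervalIntegral.integral_mono_on zero_le_one
    (intervalIntegrable_const (μ := volume) (c := m))
    ((loop_comp_continuous (γ.jet 1)).norm.intervalIntegrable 0 1) fun x _ => h _
  rw [intervalIntegral.integral_const, sub_zero, one_smul] at h
  exact h

theorem toW11_sub_le (γ β : CkLoop (n + 1)) : ‖toW11 γ - toW11 β‖ ≤ ‖γ - β‖ := by
  have : toW11 γ - toW11 β = toW11 (γ - β) := (map_sub toW11 γ β).symm
  rw [this]
  exact norm_toW11_le (γ - β)

theorem lipBdd_jet (j : Fin (n + 2)) :
    LipBdd (speedSet n M m) fun (γ : CkLoop (n + 1)) q => γ.jet j q :=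
  LipBdd.of_bounds (B := M) (C := 1)
    (fun γ hγ q => ((γ.jet j).norm_coe_le_norm q).trans ((γ.norm_jet_le j).trans hγ.1))
    fun γ _ q β _ => by rw [one_mul]; exact norm_jet_sub_le γ β j q

theorem lipBdd_len :
    LipBdd (speedSet n M m) fun (γ : CkLoop (n + 1)) (_ : UnitAddCircle) => γ.len := by
  refine LipBdd.of_bounds (B := M) (C := 1) (fun γ hγ q => ?_) fun γ _ q β _ => ?_
  · rw [← len_eq, W11Loop.len_eq_norm, norm_norm]
    exact (W11Loop.norm_weakDeriv_le _).trans ((norm_toW11_le γ).trans hγ.1)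
  · rw [← len_eq, ← len_eq, one_mul]
    exact (W11Loop.abs_len_sub_le _ _).trans (toW11_sub_le γ β)

theorem lipBdd_tangent (hlam : 0 < lam) (hm : 0 < m) :
    LipBdd (speedSet n M m) fun (γ : CkLoop (n + 1)) q => γ.tangent lam q := by
  obtain ⟨C, hC, h⟩ := W11Loop.exists_norm_tangent_sub_le lam
  refine LipBdd.of_bounds (B := 1) (C := C / m)
    (fun γ hγ q => norm_tangent_le hlam (hm.trans_le (le_len hγ.2)) q) fun γ hγ q β hβ => ?_
  have l1 := le_len hγ.2
  have l2 := le_len hβ.2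
  have := h (toW11 γ) (toW11 β) (by rw [len_eq]; exact hm.trans_le l1)
    (by rw [len_eq]; exact hm.trans_le l2)
  rw [len_eq] at this
  refine ((γ.tangent lam - β.tangent lam).norm_coe_le_norm q).trans (this.trans ?_)
  have h3 := toW11_sub_le γ β
  gcongr

theorem lipBdd_smoothed (hlam : 0 < lam) (hm : 0 < m) :
    LipBdd (speedSet n M m) fun (γ : CkLoop (n + 1)) q => γ.smoothed lam q := by
  obtain ⟨C, hC, h⟩ := W11Loop.exists_norm_smoothed_sub_le lam
  refine LipBdd.of_bounds (B := M) (C := C * (1 + (M + M) / m))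
    (fun γ hγ q => (norm_smoothed_le hlam (hm.trans_le (le_len hγ.2)) q).trans
      ((γ.norm_jet_le 0).trans hγ.1)) fun γ hγ q β hβ => ?_
  have l1 := le_len hγ.2
  have l2 := le_len hβ.2
  have := h (toW11 γ) (toW11 β) (by rw [len_eq]; exact hm.trans_le l1)
    (by rw [len_eq]; exact hm.trans_le l2)
  rw [len_eq] at this
  refine ((γ.smoothed lam - β.smoothed lam).norm_coe_le_norm q).trans (this.trans ?_)
  have h3 := toW11_sub_le γ β
  have h4 := (norm_toW11_le γ).trans hγ.1
  have h5 := (norm_toW11_le β).trans hβ.1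
  have h6 : 0 ≤ M := (norm_nonneg γ).trans hγ.1
  gcongr

/-- Local Lipschitz bounds for a map into `C^n` follow from those of the derivatives. -/
theorem exists_bounds_of_lipBdd {S : Set (CkLoop n)} {F : CkLoop n → CkLoop n}
    (h : ∀ j, LipBdd S fun γ q => (F γ).jet j q) :
    ∃ K : ℝ≥0, LipschitzOnWith K F S ∧ ∀ γ ∈ S, ‖F γ‖ ≤ K := by
  choose C hC h using h
  have hs : ∀ j, C j ≤ ∑ i, C i := fun j =>
    Finset.single_le_sum (fun i _ => hC i) (Finset.mem_univ j)
  have hs0 : 0 ≤ ∑ i, C i := Finset.sum_nonneg fun i _ => hC i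
  obtain ⟨K, hK⟩ : ∃ K : ℝ≥0, (K : ℝ) = ∑ i, C i := ⟨Real.toNNReal _, Real.coe_toNNReal _ hs0⟩
  rw [← hK] at hs0
  refine ⟨K, LipschitzOnWith.of_dist_le_mul fun γ hγ β hβ => ?_, fun γ hγ => ?_⟩
  · have e1 : dist (F γ) (F β) = ‖F γ - F β‖ := dist_eq_norm _ _
    have e2 : dist γ β = ‖γ - β‖ := dist_eq_norm _ _
    rw [e1, e2]
    refine norm_le_of_jet (mul_nonneg hs0 (norm_nonneg (γ - β))) fun j => ?_
    rw [ContinuousMap.norm_le _ (mul_nonneg hs0 (norm_nonneg (γ - β)))]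
    intro q
    refine ((h j γ hγ q).2 β hβ).trans (mul_le_mul_of_nonneg_right ?_ (norm_nonneg (γ - β)))
    rw [hK]
    exact hs j
  · refine norm_le_of_jet hs0 fun j => ?_
    rw [ContinuousMap.norm_le _ hs0, hK]
    exact fun q => (h j γ hγ q).1.trans (hs j)

end CkLoop

theorem LipBdd.congr {E Q F : Type*} [SeminormedAddCommGroup E] [SeminormedAddCommGroup F]
    {S : Set E} {f g : E → Q → F} (hf : LipBdd S f) (h : ∀ x ∈ S, ∀ q, g x q = f x q) :
    LipBdd S g := by
  obtain ⟨C, hC, hf⟩ := hf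
  refine ⟨C, hC, fun x hx q => ⟨?_, fun y hy => ?_⟩⟩
  · rw [h x hx q]; exact (hf x hx q).1
  · rw [h x hx q, h y hy q]; exact (hf x hx q).2 y hy

section Field

variable {lam M m : ℝ}

theorem IsFlowField.lipBdd_zero {n : ℕ} (hlam : 0 < lam) (hm : 0 < m)
    {F : CkLoop (n + 1) → CkLoop (n + 1)} (hF : IsFlowField lam F) :
    LipBdd (speedSet n M m) fun γ q => (F γ).jet 0 q :=
  ((LipBdd.const ((lam ^ 2)⁻¹ : ℝ)).smul
    ((CkLoop.lipBdd_smoothed hlam hm).sub (CkLoop.lipBdd_jet 0))).congr fun γ hγ q =>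
    (hF.1 γ (CkLoop.isImmersed_of_mem_speedSet hm hγ) q).1

theorem IsFlowField.lipBdd_one {n : ℕ} (hlam : 0 < lam) (hm : 0 < m)
    {F : CkLoop (n + 1) → CkLoop (n + 1)} (hF : IsFlowField lam F) :
    LipBdd (speedSet n M m) fun γ q => (F γ).jet 1 q :=
  ((LipBdd.const ((lam ^ 2)⁻¹ : ℝ)).smul
    (((CkLoop.lipBdd_jet 1).norm.smul (CkLoop.lipBdd_tangent hlam hm)).sub
      (CkLoop.lipBdd_jet 1))).congr fun γ hγ q =>
    (hF.1 γ (CkLoop.isImmersed_of_mem_speedSet hm hγ) q).2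

theorem exists_bounds_fieldOne (hlam : 0 < lam) (hm : 0 < m) (M : ℝ) :
    ∃ K : ℝ≥0, LipschitzOnWith K (fieldOne lam) (speedSet 0 M m) ∧
      ∀ γ ∈ speedSet 0 M m, ‖fieldOne lam γ‖ ≤ K := by
  refine CkLoop.exists_bounds_of_lipBdd fun j => ?_
  fin_cases j
  · exact (isFlowField_fieldOne hlam).lipBdd_zero hlam hm
  · exact (isFlowField_fieldOne hlam).lipBdd_one hlam hm

theorem exists_bounds_fieldTwo (hlam : 0 < lam) (hm : 0 < m) (M : ℝ) :
    ∃ K : ℝ≥0, LipschitzOnWith K (fieldTwo lam) (speedSet 1 M m) ∧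
      ∀ γ ∈ speedSet 1 M m, ‖fieldTwo lam γ‖ ≤ K := by
  refine CkLoop.exists_bounds_of_lipBdd fun j => ?_
  fin_cases j
  · exact (isFlowField_fieldTwo hlam).lipBdd_zero hlam hm
  · exact (isFlowField_fieldTwo hlam).lipBdd_one hlam hm
  · have hV := CkLoop.lipBdd_jet (n := 1) (M := M) (m := m) 1
    have hP := (CkLoop.lipBdd_smoothed (n := 1) (M := M) hlam hm).sub (CkLoop.lipBdd_jet 0)
    have hL : LipBdd (speedSet 1 M m) fun (γ : CkLoop 2) (_ : UnitAddCircle) => γ.len⁻¹ :=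
      CkLoop.lipBdd_len.inv hm fun γ hγ _ => CkLoop.le_len hγ.2
    have hW := CkLoop.lipBdd_jet (n := 1) (M := M) (m := m) 2
    have hVi := hV.norm.inv hm fun γ hγ q => hγ.2 q
    have h1 := hV.norm.smul ((hV.norm.smul ((LipBdd.const ((lam ^ 2)⁻¹ : ℝ)).smul
      (hL.smul hL))).smul hP)
    have h2 := ((hV.inner hW).smul hVi).smul (CkLoop.lipBdd_tangent (n := 1) (M := M) hlam hm)
    refine ((LipBdd.const ((lam ^ 2)⁻¹ : ℝ)).smul ((h1.add h2).sub hW)).congr fun γ hγ q => ?_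
    refine (fieldTwo_jet_two hlam (CkLoop.isImmersed_of_mem_speedSet hm hγ) q).trans ?_
    simp only [smul_eq_mul]
    rw [div_eq_mul_inv, mul_inv, sq γ.len, mul_inv]

end Field

/-! ### Continuation of solutions -/

section Continuation

variable {E : Type*} [NormedAddCommGroup E] [NormedSpace ℝ E]

/-- `X` is an integral curve of the field `F` on `[0,b]`. -/
def IsIntegral (F : E → E) (X : ℝ → E) (b : ℝ) : Prop :=
  ∀ t ∈ Icc 0 b, HasDerivWithinAt X (F (X t)) (Icc 0 b) t

theorem IsIntegral.mono {F : E → E} {X : ℝ → E} {b t : ℝ} (hX : IsIntegral F X b) (ht : t ≤ b) :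
    IsIntegral F X t :=
  fun s hs => (hX s ⟨hs.1, hs.2.trans ht⟩).mono (Icc_subset_Icc_right ht)

/-- One Picard–Lindelöf step: the length `δ` of the continuation depends only on the size of a ball
around the endpoint and on a bound of the field there. -/
theorem IsIntegral.step [CompleteSpace E] {F : E → E} {X : ℝ → E} {b δ a : ℝ} {K B : ℝ≥0}
    (hb : 0 ≤ b) (hδ : 0 < δ) (ha : 0 ≤ a)
    (hX : IsIntegral F X b) (hK : LipschitzOnWith K F (Metric.closedBall (X b) a))
    (hB : ∀ y ∈ Metric.closedBall (X b) a, ‖F y‖ ≤ B) (hBδ : B * δ ≤ a) :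
    ∃ Y, IsIntegral F Y (b + δ) ∧ EqOn Y X (Icc 0 b) := by
  lift a to ℝ≥0 using ha
  have hmem : b ∈ Icc b (b + δ) := ⟨le_rfl, by linarith⟩
  have hPL : IsPicardLindelof (fun _ => F) (⟨b, hmem⟩ : Icc b (b + δ)) (X b) a 0 B K :=
    { lipschitzOnWith := fun _ _ => hK
      continuousOn := fun _ _ => continuousOn_const
      norm_le := fun _ _ y hy => hB y hy
      mul_max_le := by
        have : max (b + δ - b) (b - b) = δ := by
          rw [add_sub_cancel_left, sub_self, max_eq_left hδ.le]
        rw [this]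
        simpa using hBδ }
  obtain ⟨Z, hZ0, hZ⟩ := hPL.exists_eq_forall_mem_Icc_hasDerivWithinAt₀
  simp only at hZ0
  refine ⟨fun t => if t ≤ b then X t else Z t, fun t ht => ?_, fun t ht => if_pos ht.2⟩
  have hU : Icc 0 (b + δ) = Icc 0 b ∪ Icc b (b + δ) :=
    (Icc_union_Icc_eq_Icc hb hmem.2).symm
  have eX : EqOn (fun t => if t ≤ b then X t else Z t) X (Icc 0 b) := fun t ht => if_pos ht.2
  have eZ : EqOn (fun t => if t ≤ b then X t else Z t) Z (Icc b (b + δ)) := by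
    intro t ht
    rcases ht.1.eq_or_lt with h | h
    · simp only [← h, le_refl, if_true, hZ0]
    · exact if_neg (not_le.2 h)
  rcases lt_trichotomy t b with h | h | h
  · have ht' : t ∈ Icc 0 b := ⟨ht.1, h.le⟩
    rw [eX ht']
    refine ((hX t ht').congr eX (eX ht')).mono_of_mem_nhdsWithin ?_
    filter_upwards [self_mem_nhdsWithin, mem_nhdsWithin_of_mem_nhds (Iio_mem_nhds h)] with s h1 h2
    exact ⟨h1.1, le_of_lt h2⟩
  · subst h
    have ht' : t ∈ Icc 0 t := ⟨ht.1, le_rfl⟩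
    rw [hU, eX ht']
    refine ((hX t ht').congr eX (eX ht')).union ?_
    have := (hZ t hmem).congr eZ (eZ hmem)
    rwa [hZ0] at this
  · have ht' : t ∈ Icc b (b + δ) := ⟨h.le, ht.2⟩
    rw [eZ ht']
    refine ((hZ t ht').congr eZ (eZ ht')).mono_of_mem_nhdsWithin ?_
    filter_upwards [self_mem_nhdsWithin, mem_nhdsWithin_of_mem_nhds (Ioi_mem_nhds h)] with s h1 h2
    exact ⟨le_of_lt h2, h1.2⟩

/-- If up to each time `T` the integral curves starting at `x₀` end in a set around whose points
the field is bounded and Lipschitz on balls of a fixed radius, then there is an integral curve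
for all positive times. -/
theorem exists_global_integral [CompleteSpace E] {F : E → E} {x₀ : E} (S : ℝ → Set E)
    (hS : ∀ T, 0 ≤ T → ∃ a > 0, ∃ K : ℝ≥0, ∀ x ∈ S T,
      LipschitzOnWith K F (Metric.closedBall x a) ∧ ∀ y ∈ Metric.closedBall x a, ‖F y‖ ≤ K)
    (hap : ∀ T b X, 0 ≤ b → b ≤ T → X 0 = x₀ → IsIntegral F X b → X b ∈ S T) :
    ∃ X : ℝ → E, X 0 = x₀ ∧ ∀ t, 0 ≤ t → HasDerivWithinAt X (F (X t)) (Ici 0) t := by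
  have hext : ∀ (n : ℕ) (X : ℝ → E), X 0 = x₀ → IsIntegral F X n →
      ∃ Y, IsIntegral F Y (n + 1 : ℕ) ∧ EqOn Y X (Icc 0 n) := by
    intro n X hX0 hX
    obtain ⟨a, ha, K, hK⟩ := hS (n + 1) (by positivity)
    obtain ⟨N, hN⟩ := exists_nat_gt ((K : ℝ) / a)
    have hN0 : (0 : ℝ) < N := (div_nonneg K.coe_nonneg ha.le).trans_lt hN
    have key : ∀ k : ℕ, k ≤ N → ∃ Y, IsIntegral F Y (n + k / N) ∧ EqOn Y X (Icc 0 n) := by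
      intro k
      induction k with
      | zero => exact fun _ => ⟨X, by simpa using hX, fun _ _ => rfl⟩
      | succ k ih =>
        intro hk
        obtain ⟨Y, hY, hYX⟩ := ih (by omega)
        have hb : (0 : ℝ) ≤ n + k / N := by positivity
        have hkN : (k : ℝ) / N ≤ 1 := by
          rw [div_le_one hN0]; exact_mod_cast (by omega : k ≤ N)
        have hY0 : Y 0 = x₀ := (hYX ⟨le_rfl, by positivity⟩).trans hX0
        have hmem := hap (n + 1) (n + k / N) Y hb (by linarith) hY0 hY
        obtain ⟨Z, hZ, hZY⟩ := hY.step (δ := 1 / N) hb (by positivity) ha.le (hK _ hmem).1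
          (hK _ hmem).2 (by
            rw [mul_one_div, div_le_iff₀ hN0]
            rw [div_lt_iff₀ ha] at hN
            linarith)
        refine ⟨Z, ?_, fun t ht => (hZY ⟨ht.1, ht.2.trans ?_⟩).trans (hYX ht)⟩
        · have : (n : ℝ) + k / N + 1 / N = n + (k + 1 : ℕ) / N := by push_cast; ring
          rwa [this] at hZ
        · have : (0 : ℝ) ≤ k / N := by positivity
          linarith
    obtain ⟨Y, hY, hYX⟩ := key N le_rfl
    rw [div_self hN0.ne'] at hY
    exact ⟨Y, by push_cast; exact hY, hYX⟩
  choose! ext hextI hextE using hext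
  let seq : ℕ → ℝ → E := fun n => Nat.rec (fun _ => x₀) (fun n X => ext n X) n
  have hseq : ∀ n, seq n 0 = x₀ ∧ IsIntegral F (seq n) n := by
    intro n
    induction n with
    | zero =>
      refine ⟨rfl, fun t ht => ?_⟩
      have : Icc (0 : ℝ) ((0 : ℕ) : ℝ) = {0} := by simp
      rw [this] at ht ⊢
      rw [mem_singleton_iff.1 ht]
      exact HasFDerivWithinAt.singleton
    | succ n ih =>
      exact ⟨(hextE n _ ih.1 ih.2 ⟨le_rfl, by positivity⟩).trans ih.1, hextI n _ ih.1 ih.2⟩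
  have hagree : ∀ n m, n ≤ m → EqOn (seq m) (seq n) (Icc 0 n) := by
    intro n m hnm
    induction m, hnm using Nat.le_induction with
    | base => exact fun _ _ => rfl
    | succ m hm ih =>
      intro t ht
      have : (n : ℝ) ≤ m := by exact_mod_cast hm
      exact (hextE m _ (hseq m).1 (hseq m).2 ⟨ht.1, ht.2.trans this⟩).trans (ih ht)
  have hX : ∀ (n : ℕ) t, t ∈ Icc (0 : ℝ) n → seq ⌈t⌉₊ t = seq n t := fun n t ht =>
    (hagree ⌈t⌉₊ n (Nat.ceil_le.2 ht.2) ⟨ht.1, Nat.le_ceil t⟩).symm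
  refine ⟨fun t => seq ⌈t⌉₊ t, by simpa using (hseq 0).1, fun t ht => ?_⟩
  obtain ⟨n, hn⟩ := exists_nat_gt t
  have ht' : t ∈ Icc (0 : ℝ) n := ⟨ht, hn.le⟩
  have h1 := ((hseq n).2 t ht').congr (fun s hs => hX n s hs) (hX n t ht')
  rw [← hX n t ht'] at h1
  refine h1.mono_of_mem_nhdsWithin ?_
  filter_upwards [self_mem_nhdsWithin, mem_nhdsWithin_of_mem_nhds (Iio_mem_nhds hn)] with s h1 h2
  exact ⟨h1, le_of_lt h2⟩

end Continuation

/-! ### A priori bounds and global solutions -/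

namespace CkLoop

/-- Evaluation of the `j`-th derivative at a point, as a continuous linear functional. -/
def jetAtL {k : ℕ} (j : Fin (k + 1)) (q : UnitAddCircle) : CkLoop k →L[ℝ] Plane :=
  (ContinuousMap.evalCLM ℝ q).comp (jetL k j)

theorem hasDerivWithinAt_jet {k : ℕ} {X : ℝ → CkLoop k} {X' : CkLoop k} {s : Set ℝ} {t : ℝ}
    (h : HasDerivWithinAt X X' s t) (j : Fin (k + 1)) :
    HasDerivWithinAt (fun τ => (X τ).jet j) (X'.jet j) s t := by
  have h1 := (jetL k j).hasFDerivAt.comp_hasDerivWithinAt t h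
  exact h1

theorem hasDerivWithinAt_jet_apply {k : ℕ} {X : ℝ → CkLoop k} {X' : CkLoop k} {s : Set ℝ} {t : ℝ}
    (h : HasDerivWithinAt X X' s t) (j : Fin (k + 1)) (q : UnitAddCircle) :
    HasDerivWithinAt (fun τ => (X τ).jet j q) (X'.jet j q) s t := by
  have h1 := (jetAtL j q).hasFDerivAt.comp_hasDerivWithinAt t h
  exact h1

theorem exists_speed_lower_bound {n : ℕ} {γ : CkLoop (n + 1)} (h : IsImmersed γ) :
    ∃ m > 0, ∀ q, m ≤ ‖γ.jet 1 q‖ := by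
  obtain ⟨q₀, -, hq⟩ := isCompact_univ.exists_isMinOn univ_nonempty
    (γ.jet 1).continuous.norm.continuousOn
  exact ⟨_, norm_pos_iff.2 (h q₀), fun q => hq (mem_univ q)⟩

end CkLoop

namespace IsFlowField

variable {n : ℕ} {lam : ℝ} {F : CkLoop (n + 1) → CkLoop (n + 1)}

/-- Since `V = γ_u` evolves by `lam⁻² (|V| N - V)` with the averaged unit tangent `N`, the bound
`|N| ≤ 1` gives `-2|V|² ≤ ⟨V, |V| N - V⟩ ≤ 0`. -/
theorem inner_bounds (hlam : 0 < lam) (hF : IsFlowField lam F) (γ : CkLoop (n + 1))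
    (q : UnitAddCircle) :
    -(4 / lam ^ 2) * ‖γ.jet 1 q‖ ^ 2 ≤ 2 * inner ℝ (γ.jet 1 q) ((F γ).jet 1 q) ∧
      2 * inner ℝ (γ.jet 1 q) ((F γ).jet 1 q) ≤ 0 := by
  by_cases hγ : IsImmersed γ
  · have hN := CkLoop.norm_tangent_le hlam (CkLoop.len_pos_of_isImmersed hγ) q
    rw [(hF.1 γ hγ q).2, inner_smul_right, inner_sub_right, inner_smul_right,
      real_inner_self_eq_norm_sq]
    have h1 := abs_real_inner_le_norm (γ.jet 1 q) (γ.tangent lam q)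
    have h2 : ‖γ.jet 1 q‖ * ‖γ.tangent lam q‖ ≤ ‖γ.jet 1 q‖ * 1 :=
      mul_le_mul_of_nonneg_left hN (norm_nonneg _)
    have h3 := abs_le.1 (h1.trans h2)
    have h0 := norm_nonneg (γ.jet 1 q)
    have hl : 0 < (lam ^ 2)⁻¹ := by positivity
    constructor
    · have : -(4 / lam ^ 2) * ‖γ.jet 1 q‖ ^ 2 =
          2 * ((lam ^ 2)⁻¹ * (-(2 * ‖γ.jet 1 q‖ ^ 2))) := by
        rw [div_eq_mul_inv]; ring
      rw [this]
      gcongr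
      nlinarith
    · have : ‖γ.jet 1 q‖ * inner ℝ (γ.jet 1 q) (γ.tangent lam q) - ‖γ.jet 1 q‖ ^ 2 ≤ 0 := by
        nlinarith
      nlinarith
  · rw [hF.2 γ hγ]
    have h0 : (0 : CkLoop (n + 1)).jet 1 q = 0 := rfl
    rw [h0, inner_zero_right, mul_zero]
    refine ⟨?_, le_rfl⟩
    rw [neg_mul, neg_nonpos]
    positivity

section Curve

variable {X : ℝ → CkLoop (n + 1)} {D : Set ℝ}

theorem hasDerivWithinAt_speed_sq {t : ℝ} (hX : HasDerivWithinAt X (F (X t)) D t)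
    (q : UnitAddCircle) : HasDerivWithinAt (fun τ => ‖(X τ).jet 1 q‖ ^ 2)
      (2 * inner ℝ ((X t).jet 1 q) ((F (X t)).jet 1 q)) D t :=
  (CkLoop.hasDerivWithinAt_jet_apply hX 1 q).norm_sq

theorem speed_antitoneOn (hlam : 0 < lam) (hF : IsFlowField lam F) (hD : Convex ℝ D)
    (hX : ∀ t ∈ D, HasDerivWithinAt X (F (X t)) D t) (q : UnitAddCircle) :
    AntitoneOn (fun t => ‖(X t).jet 1 q‖) D := by
  have h : AntitoneOn (fun t => ‖(X t).jet 1 q‖ ^ 2) D :=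
    antitoneOn_of_hasDerivWithinAt_nonpos hD
      (fun t ht => (hasDerivWithinAt_speed_sq (hX t ht) q).continuousWithinAt)
      (fun t ht => (hasDerivWithinAt_speed_sq (hX t (interior_subset ht)) q).mono interior_subset)
      fun t _ => (inner_bounds hlam hF (X t) q).2
  intro s hs t ht hst
  exact le_of_sq_le_sq (h hs ht hst) (norm_nonneg _)

theorem speed_sq_lower (hlam : 0 < lam) (hF : IsFlowField lam F) (hD : Convex ℝ D)
    (h0 : (0 : ℝ) ∈ D) (hX : ∀ t ∈ D, HasDerivWithinAt X (F (X t)) D t) {t : ℝ} (ht : t ∈ D)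
    (ht0 : 0 ≤ t) (q : UnitAddCircle) :
    ‖(X 0).jet 1 q‖ ^ 2 * Real.exp (-4 * t / lam ^ 2) ≤ ‖(X t).jet 1 q‖ ^ 2 := by
  have hd : ∀ t ∈ D, HasDerivWithinAt (fun τ => ‖(X τ).jet 1 q‖ ^ 2 * Real.exp (4 * τ / lam ^ 2))
      (2 * inner ℝ ((X t).jet 1 q) ((F (X t)).jet 1 q) * Real.exp (4 * t / lam ^ 2) +
        ‖(X t).jet 1 q‖ ^ 2 * (Real.exp (4 * t / lam ^ 2) * (4 * 1 / lam ^ 2))) D t := fun t ht =>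
    (hasDerivWithinAt_speed_sq (hX t ht) q).mul
      ((((hasDerivAt_id t).const_mul 4).div_const (lam ^ 2)).exp.hasDerivWithinAt)
  have h : MonotoneOn (fun τ => ‖(X τ).jet 1 q‖ ^ 2 * Real.exp (4 * τ / lam ^ 2)) D := by
    refine monotoneOn_of_hasDerivWithinAt_nonneg hD (fun t ht => (hd t ht).continuousWithinAt)
      (fun t ht => (hd t (interior_subset ht)).mono interior_subset) fun t _ => ?_
    have := (inner_bounds hlam hF (X t) q).1
    have e : 2 * inner ℝ ((X t).jet 1 q) ((F (X t)).jet 1 q) * Real.exp (4 * t / lam ^ 2) +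
        ‖(X t).jet 1 q‖ ^ 2 * (Real.exp (4 * t / lam ^ 2) * (4 * 1 / lam ^ 2)) =
        (2 * inner ℝ ((X t).jet 1 q) ((F (X t)).jet 1 q) - -(4 / lam ^ 2) * ‖(X t).jet 1 q‖ ^ 2) *
          Real.exp (4 * t / lam ^ 2) := by ring
    rw [e]
    exact mul_nonneg (sub_nonneg.2 this) (Real.exp_pos _).le
  have h1 := h h0 ht ht0
  simp only [mul_zero, zero_div, Real.exp_zero, mul_one] at h1
  have e : -4 * t / lam ^ 2 = -(4 * t / lam ^ 2) := by ring
  rw [e, Real.exp_neg, ← div_eq_mul_inv, div_le_iff₀ (Real.exp_pos _)]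
  exact h1

theorem isImmersed_of_integral (hlam : 0 < lam) (hF : IsFlowField lam F) (hD : Convex ℝ D)
    (h0 : (0 : ℝ) ∈ D) (hX : ∀ t ∈ D, HasDerivWithinAt X (F (X t)) D t) (hX0 : IsImmersed (X 0))
    {t : ℝ} (ht : t ∈ D) (ht0 : 0 ≤ t) : IsImmersed (X t) := by
  intro q hq
  have h1 := speed_sq_lower hlam hF hD h0 hX ht ht0 q
  rw [hq, norm_zero, zero_pow two_ne_zero] at h1
  have h2 : 0 < ‖(X 0).jet 1 q‖ := norm_pos_iff.2 (hX0 q)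
  have : 0 < ‖(X 0).jet 1 q‖ ^ 2 * Real.exp (-4 * t / lam ^ 2) := by positivity
  linarith

end Curve

/-- Grönwall's inequality for a single derivative of the solution, with a bound that does not depend
on the solution. -/
theorem exists_jet_bound_of_growth {X₀ : CkLoop (n + 1)} {j : Fin (n + 2)} {T K ε : ℝ}
    (hK : 0 ≤ K) (hε : 0 ≤ ε)
    (h : ∀ b X, 0 ≤ b → b ≤ T → X 0 = X₀ → IsIntegral F X b → ∀ t ∈ Icc 0 b,
      ‖(F (X t)).jet j‖ ≤ K * ‖(X t).jet j‖ + ε) :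
    ∃ M, 0 ≤ M ∧ ∀ b X, 0 ≤ b → b ≤ T → X 0 = X₀ → IsIntegral F X b → ‖(X b).jet j‖ ≤ M := by
  refine ⟨max 0 (gronwallBound ‖X₀.jet j‖ K ε T), le_max_left _ _,
    fun b X hb hbT hX0 hX => le_max_of_le_right ?_⟩
  have hd : ∀ t ∈ Icc 0 b, HasDerivWithinAt (fun τ => (X τ).jet j) ((F (X t)).jet j) (Icc 0 b) t :=
    fun t ht => CkLoop.hasDerivWithinAt_jet (hX t ht) j
  have h1 := norm_le_gronwallBound_of_norm_deriv_right_le (δ := ‖X₀.jet j‖)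
    (fun t ht => (hd t ht).continuousWithinAt)
    (fun t ht => (hd t (Ico_subset_Icc_self ht)).mono_of_mem_nhdsWithin
      (Icc_mem_nhdsGE_of_mem ht)) (by rw [hX0])
    (fun t ht => h b X hb hbT hX0 hX t (Ico_subset_Icc_self ht)) b ⟨hb, le_rfl⟩
  rw [sub_zero] at h1
  exact h1.trans (gronwallBound_mono (norm_nonneg _) hε hK hbT)

theorem norm_field_zero_le (hlam : 0 < lam) (hF : IsFlowField lam F) {γ : CkLoop (n + 1)}
    (hγ : IsImmersed γ) : ‖(F γ).jet 0‖ ≤ 2 / lam ^ 2 * ‖γ.jet 0‖ := by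
  rw [ContinuousMap.norm_le _ (by positivity)]
  intro q
  rw [(hF.1 γ hγ q).1, norm_smul, norm_inv, norm_pow, Real.norm_of_nonneg hlam.le]
  have h1 := CkLoop.norm_smoothed_le hlam (CkLoop.len_pos_of_isImmersed hγ) q
  have h2 := (γ.jet 0).norm_coe_le_norm q
  have h3 := (norm_sub_le (γ.smoothed lam q) (γ.jet 0 q)).trans (add_le_add h1 h2)
  calc (lam ^ 2)⁻¹ * ‖γ.smoothed lam q - γ.jet 0 q‖ ≤ (lam ^ 2)⁻¹ * (‖γ.jet 0‖ + ‖γ.jet 0‖) := by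
        gcongr
    _ = 2 / lam ^ 2 * ‖γ.jet 0‖ := by ring

theorem exists_jet_zero_bound (hlam : 0 < lam) (hF : IsFlowField lam F) {X₀ : CkLoop (n + 1)}
    (h0 : IsImmersed X₀) (T : ℝ) :
    ∃ M, 0 ≤ M ∧ ∀ b X, 0 ≤ b → b ≤ T → X 0 = X₀ → IsIntegral F X b → ‖(X b).jet 0‖ ≤ M := by
  refine exists_jet_bound_of_growth (K := 2 / lam ^ 2) (ε := 0) (by positivity) le_rfl
    fun b X hb hbT hX0 hX t ht => ?_
  rw [add_zero]
  exact norm_field_zero_le hlam hF (isImmersed_of_integral hlam hF (convex_Icc 0 b)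
    ⟨le_rfl, hb⟩ hX (by rw [hX0]; exact h0) ht ht.1)

theorem norm_jet_one_le (hlam : 0 < lam) (hF : IsFlowField lam F) {X : ℝ → CkLoop (n + 1)} {b : ℝ}
    (hb : 0 ≤ b) (hX : IsIntegral F X b) : ‖(X b).jet 1‖ ≤ ‖(X 0).jet 1‖ := by
  rw [ContinuousMap.norm_le _ (norm_nonneg _)]
  exact fun q => (speed_antitoneOn hlam hF (convex_Icc 0 b) hX q ⟨le_rfl, hb⟩ ⟨hb, le_rfl⟩ hb).trans
    (((X 0).jet 1).norm_coe_le_norm q)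

theorem exists_speed_bound (hlam : 0 < lam) (hF : IsFlowField lam F) {X₀ : CkLoop (n + 1)}
    (h0 : IsImmersed X₀) (T : ℝ) : ∃ m > 0, ∀ b X, 0 ≤ b → b ≤ T → X 0 = X₀ → IsIntegral F X b →
      ∀ q, m ≤ ‖(X b).jet 1 q‖ := by
  obtain ⟨m, hm, h⟩ := CkLoop.exists_speed_lower_bound h0
  refine ⟨m * Real.exp (-2 * T / lam ^ 2), by positivity, fun b X hb hbT hX0 hX q => ?_⟩
  have h1 := speed_sq_lower hlam hF (convex_Icc 0 b) ⟨le_rfl, hb⟩ hX ⟨hb, le_rfl⟩ hb q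
  refine le_of_sq_le_sq (le_trans ?_ h1) (norm_nonneg _)
  rw [hX0, mul_pow, ← Real.exp_nat_mul]
  have h2 := h q
  have h3 : ((2 : ℕ) : ℝ) * (-2 * T / lam ^ 2) ≤ -4 * b / lam ^ 2 := by
    rw [← mul_div_assoc]
    push_cast
    gcongr ?_ / _
    linarith
  gcongr

/-- If the `C^(n+1)` norm stays bounded in finite time, the flow exists for all times. -/
theorem exists_global (hlam : 0 < lam) (hF : IsFlowField lam F)
    (hLip : ∀ M m, 0 < m → ∃ K : ℝ≥0, LipschitzOnWith K F (speedSet n M m) ∧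
      ∀ γ ∈ speedSet n M m, ‖F γ‖ ≤ K) {X₀ : CkLoop (n + 1)} (h0 : IsImmersed X₀)
    (hbd : ∀ T, ∃ M, ∀ b X, 0 ≤ b → b ≤ T → X 0 = X₀ → IsIntegral F X b → ‖X b‖ ≤ M) :
    ∃ X : ℝ → CkLoop (n + 1), X 0 = X₀ ∧
      ∀ t, 0 ≤ t → HasDerivWithinAt X (F (X t)) (Ici 0) t := by
  choose M hM using hbd
  choose m hm0 hm using exists_speed_bound hlam hF h0
  refine exists_global_integral (fun T => speedSet n (M T) (m T)) (fun T _ => ?_)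
    fun T b X hb hbT hX0 hX => ⟨hM T b X hb hbT hX0 hX, hm T b X hb hbT hX0 hX⟩
  have hm2 : 0 < m T / 2 := half_pos (hm0 T)
  obtain ⟨K, hK1, hK2⟩ := hLip (M T + m T / 2) (m T / 2) hm2
  refine ⟨m T / 2, hm2, K, fun γ hγ => ?_⟩
  have hsub : Metric.closedBall γ (m T / 2) ⊆ speedSet n (M T + m T / 2) (m T / 2) := by
    intro β hβ
    have h1 : ‖β - γ‖ ≤ m T / 2 := by
      have : dist β γ = ‖β - γ‖ := dist_eq_norm β γ
      rw [← this]; exact hβ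
    refine ⟨(norm_le_insert' β γ).trans (add_le_add hγ.1 h1), fun q => ?_⟩
    have h2 := (CkLoop.norm_jet_sub_le β γ 1 q).trans h1
    have h3 := norm_sub_norm_le (γ.jet 1 q) (β.jet 1 q)
    rw [norm_sub_rev] at h3
    have h4 := hγ.2 q
    linarith
  exact ⟨hK1.mono hsub, fun β hβ => hK2 β (hsub hβ)⟩

theorem continuousAt (hLip : ∀ M m, 0 < m → ∃ K : ℝ≥0, LipschitzOnWith K F (speedSet n M m) ∧
      ∀ γ ∈ speedSet n M m, ‖F γ‖ ≤ K) {γ : CkLoop (n + 1)} (hγ : IsImmersed γ) :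
    ContinuousAt F γ := by
  obtain ⟨m, hm, h⟩ := CkLoop.exists_speed_lower_bound hγ
  obtain ⟨K, hK, -⟩ := hLip (‖γ‖ + m / 2) (m / 2) (half_pos hm)
  refine hK.continuousOn.continuousAt ?_
  filter_upwards [Metric.closedBall_mem_nhds γ (half_pos hm)] with β hβ
  have h1 : ‖β - γ‖ ≤ m / 2 := by
    have : dist β γ = ‖β - γ‖ := dist_eq_norm β γ
    rw [← this]; exact hβ
  refine ⟨(norm_le_insert' β γ).trans (add_le_add le_rfl h1), fun q => ?_⟩
  have h2 := (CkLoop.norm_jet_sub_le β γ 1 q).trans h1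
  have h3 := norm_sub_norm_le (γ.jet 1 q) (β.jet 1 q)
  rw [norm_sub_rev] at h3
  have h4 := h q
  linarith

end IsFlowField

theorem IsCkFlow.mono {n : ℕ} {lam a : ℝ} {T T' : EReal} {X : ℝ → CkLoop (n + 1)}
    (h : IsCkFlow lam a T X) (hT : T' ≤ T) : IsCkFlow lam a T' X := by
  have hs : timeInterval T' ⊆ timeInterval T := fun t ht => ⟨ht.1, ht.2.trans_le hT⟩
  exact ⟨h.1.mono hs, fun t ht u hu => (h.2 t (hs ht) u hu).mono hs⟩

namespace IsFlowField

variable {n : ℕ} {lam : ℝ} {F : CkLoop (n + 1) → CkLoop (n + 1)}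

theorem isCkFlow (hlam : 0 < lam) (hF : IsFlowField lam F)
    (hLip : ∀ M m, 0 < m → ∃ K : ℝ≥0, LipschitzOnWith K F (speedSet n M m) ∧
      ∀ γ ∈ speedSet n M m, ‖F γ‖ ≤ K) {X : ℝ → CkLoop (n + 1)} (h0 : IsImmersed (X 0))
    (hX : ∀ t, 0 ≤ t → HasDerivWithinAt X (F (X t)) (Ici 0) t) : IsCkFlow lam 2 ⊤ X := by
  have him : ∀ t, 0 ≤ t → IsImmersed (X t) := fun t ht =>
    isImmersed_of_integral hlam hF (convex_Ici 0) self_mem_Ici hX h0 ht ht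
  rw [IsCkFlow, timeInterval_top]
  refine ⟨?_, fun t ht u hu => ?_⟩
  · rw [contDiffOn_one_iff_derivWithin (uniqueDiffOn_Ici 0)]
    refine ⟨fun t ht => (hX t ht).differentiableWithinAt, ?_⟩
    have hc : ContinuousOn (fun t => F (X t)) (Ici 0) := fun t ht =>
      (continuousAt hLip (him t ht)).comp_continuousWithinAt (hX t ht).continuousWithinAt
    exact hc.congr fun t ht => (hX t ht).derivWithin (uniqueDiffOn_Ici 0 t ht)
  · rw [hF.flowField_eq (him t ht) hu]
    exact CkLoop.hasDerivWithinAt_jet_apply (hX t ht) 0 _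

theorem isTheGlobalFlow (hlam : 0 < lam) (hF : IsFlowField lam F)
    (hLip : ∀ M m, 0 < m → ∃ K : ℝ≥0, LipschitzOnWith K F (speedSet n M m) ∧
      ∀ γ ∈ speedSet n M m, ‖F γ‖ ≤ K) {X : ℝ → CkLoop (n + 1)} (h0 : IsImmersed (X 0))
    (hX : ∀ t, 0 ≤ t → HasDerivWithinAt X (F (X t)) (Ici 0) t) :
    IsTheGlobalFlow lam (X 0) X := by
  have h := hF.isCkFlow hlam hLip h0 hX
  refine ⟨rfl, h, fun T Y hY hY0 t ht => ?_⟩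
  have := (h.mono (le_top (a := T))).unique hlam hY (fun s hs => CkLoop.len_pos_of_isImmersed
    (isImmersed_of_integral hlam hF (convex_Ici 0) self_mem_Ici hX h0 hs.1 hs.1)) hY0 t ht
  rw [this, CkLoop.toW11_curve]

end IsFlowField

theorem exists_global_one {lam : ℝ} (hlam : 0 < lam) {X₀ : CkLoop 1} (h0 : IsImmersed X₀) :
    ∃ X : ℝ → CkLoop 1, X 0 = X₀ ∧
      ∀ t, 0 ≤ t → HasDerivWithinAt X (fieldOne lam (X t)) (Ici 0) t := by
  have hF := isFlowField_fieldOne hlam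
  refine hF.exists_global hlam (fun M m hm => exists_bounds_fieldOne hlam hm M) h0 fun T => ?_
  obtain ⟨M, hM0, hM⟩ := hF.exists_jet_zero_bound hlam h0 T
  refine ⟨max M ‖X₀.jet 1‖, fun b X hb hbT hX0 hX =>
    CkLoop.norm_le_of_jet (le_max_of_le_left hM0) fun j => ?_⟩
  fin_cases j
  · exact le_max_of_le_left (hM b X hb hbT hX0 hX)
  · rw [← hX0]
    exact le_max_of_le_right (hF.norm_jet_one_le hlam hb hX)

/-- Once the lower derivatives and the speed are under control, the field grows at most linearly in
the second derivative. -/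
theorem norm_fieldTwo_jet_two_le {lam M m : ℝ} (hlam : 0 < lam) (hm : 0 < m) (hM : 0 ≤ M)
    {γ : CkLoop 2} (h0 : ‖γ.jet 0‖ ≤ M) (h1 : ‖γ.jet 1‖ ≤ M) (h : ∀ q, m ≤ ‖γ.jet 1 q‖) :
    ‖(fieldTwo lam γ).jet 2‖ ≤
      2 / lam ^ 2 * ‖γ.jet 2‖ + (lam ^ 2)⁻¹ * (M * (M / (lam ^ 2 * m ^ 2)) * (2 * M)) := by
  have hγ : IsImmersed γ := fun q => norm_pos_iff.1 (hm.trans_le (h q))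
  rw [ContinuousMap.norm_le _ (by positivity)]
  intro q
  have hL := CkLoop.le_len h
  have hN := CkLoop.norm_tangent_le hlam (CkLoop.len_pos_of_isImmersed hγ) q
  have hP := (CkLoop.norm_smoothed_le hlam (CkLoop.len_pos_of_isImmersed hγ) q).trans h0
  have hX := ((γ.jet 0).norm_coe_le_norm q).trans h0
  have hV := ((γ.jet 1).norm_coe_le_norm q).trans h1
  have hW := (γ.jet 2).norm_coe_le_norm q
  have hV0 : 0 < ‖γ.jet 1 q‖ := hm.trans_le (h q)
  have hPX : ‖γ.smoothed lam q - γ.jet 0 q‖ ≤ 2 * M := (norm_sub_le _ _).trans (by linarith)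
  rw [fieldTwo_jet_two hlam hγ, norm_smul, norm_inv, norm_pow, Real.norm_of_nonneg hlam.le]
  have e1 : ‖‖γ.jet 1 q‖ • (‖γ.jet 1 q‖ / (lam ^ 2 * γ.len ^ 2)) •
      (γ.smoothed lam q - γ.jet 0 q)‖ ≤ M * (M / (lam ^ 2 * m ^ 2)) * (2 * M) := by
    have hL0 : 0 < γ.len := hm.trans_le hL
    rw [norm_smul, norm_smul, norm_norm, Real.norm_of_nonneg (by positivity), ← mul_assoc]
    gcongr
  have e2 : ‖(inner ℝ (γ.jet 1 q) (γ.jet 2 q) * ‖γ.jet 1 q‖⁻¹) • γ.tangent lam q‖ ≤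
      ‖γ.jet 2‖ := by
    have hi := norm_inner_le_norm (𝕜 := ℝ) (γ.jet 1 q) (γ.jet 2 q)
    rw [norm_smul, norm_mul, norm_inv, norm_norm]
    calc _ ≤ ‖γ.jet 1 q‖ * ‖γ.jet 2 q‖ * ‖γ.jet 1 q‖⁻¹ * 1 := by gcongr
      _ = ‖γ.jet 2 q‖ := by field_simp
      _ ≤ _ := hW
  have e3 := (norm_sub_le _ _).trans (add_le_add ((norm_add_le _ _).trans (add_le_add e1 e2)) hW)
  calc _ ≤ (lam ^ 2)⁻¹ * (M * (M / (lam ^ 2 * m ^ 2)) * (2 * M) + ‖γ.jet 2‖ + ‖γ.jet 2‖) := by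
        gcongr
    _ = _ := by ring

theorem exists_global_two {lam : ℝ} (hlam : 0 < lam) {X₀ : CkLoop 2} (h0 : IsImmersed X₀) :
    ∃ X : ℝ → CkLoop 2, X 0 = X₀ ∧
      ∀ t, 0 ≤ t → HasDerivWithinAt X (fieldTwo lam (X t)) (Ici 0) t := by
  have hF := isFlowField_fieldTwo hlam
  refine hF.exists_global hlam (fun M m hm => exists_bounds_fieldTwo hlam hm M) h0 fun T => ?_
  obtain ⟨M, hM0, hM⟩ := hF.exists_jet_zero_bound hlam h0 T
  obtain ⟨m, hm0, hm⟩ := hF.exists_speed_bound hlam h0 T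
  obtain ⟨R, hR⟩ : ∃ R, R = max M ‖X₀.jet 1‖ := ⟨_, rfl⟩
  have hR0 : 0 ≤ R := hR ▸ le_max_of_le_left hM0
  have hgrow := fun γ => norm_fieldTwo_jet_two_le (γ := γ) hlam hm0 hR0
  obtain ⟨A, hA0, hA⟩ := IsFlowField.exists_jet_bound_of_growth (n := 1) (F := fieldTwo lam)
    (X₀ := X₀) (j := 2) (T := T) (K := 2 / lam ^ 2)
    (ε := (lam ^ 2)⁻¹ * (R * (R / (lam ^ 2 * m ^ 2)) * (2 * R))) (by positivity) (by positivity)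
    fun b X hb hbT hX0 hX t ht => by
      have hXt := hX.mono ht.2
      refine hgrow _ (hR ▸ le_max_of_le_left (hM t X ht.1 (ht.2.trans hbT) hX0 hXt))
        (hR ▸ le_max_of_le_right ?_) (hm t X ht.1 (ht.2.trans hbT) hX0 hXt)
      rw [← hX0]
      exact hF.norm_jet_one_le hlam ht.1 hXt
  refine ⟨max A (max M ‖X₀.jet 1‖), fun b X hb hbT hX0 hX =>
    CkLoop.norm_le_of_jet (le_max_of_le_left hA0) fun j => ?_⟩
  fin_cases j
  · exact le_max_of_le_right (le_max_of_le_left (hM b X hb hbT hX0 hX))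
  · refine le_max_of_le_right (le_max_of_le_right ?_)
    rw [← hX0]
    exact hF.norm_jet_one_le hlam hb hX
  · exact le_max_of_le_left (hA b X hb hbT hX0 hX)

/-! ### Change of time -/

theorem IsW11Flow.mono {lam a : ℝ} {T T' : EReal} {X : ℝ → W11Loop}
    (h : IsW11Flow lam a T X) (hT : T' ≤ T) : IsW11Flow lam a T' X := by
  have hs : timeInterval T' ⊆ timeInterval T := fun t ht => ⟨ht.1, ht.2.trans_le hT⟩
  exact ⟨h.1.mono hs, fun t ht u hu => (h.2 t (hs ht) u hu).mono hs⟩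

/-- The fields for different `a` are proportional, with a factor that depends on the length only. -/
theorem flowField_eq_smul (lam a : ℝ) {γ V : ℝ → Plane} (hV : length V ≠ 0) (u : ℝ) :
    flowField lam a γ V u = length V ^ (a - 2) • flowField lam 2 γ V u := by
  rw [flowField, flowField, if_neg hV, if_neg hV, gradLength, gradLength, sub_self,
    Real.rpow_zero, smul_neg, smul_smul, mul_one_div]

theorem CkLoop.continuous_len {n : ℕ} : Continuous (CkLoop.len : CkLoop (n + 1) → ℝ) := by
  have : (CkLoop.len : CkLoop (n + 1) → ℝ) = fun γ => (toW11 γ).len :=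
    funext fun γ => γ.len_eq.symm
  rw [this]
  exact W11Loop.continuous_len.comp toW11.continuous

/-- A strictly increasing clock `τ` on the real line with positive continuous rate `g`. -/
structure IsClock (g τ : ℝ → ℝ) : Prop where
  pos : ∀ s, 0 < g s
  zero : τ 0 = 0
  hasStrictDerivAt : ∀ s, HasStrictDerivAt τ (g s) s

namespace IsClock

variable {g τ : ℝ → ℝ}

theorem integral (hg : Continuous g) (hpos : ∀ s, 0 < g s) :
    IsClock g fun s => ∫ x in (0 : ℝ)..s, g x :=
  ⟨hpos, intervalIntegral.integral_same, fun _ =>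
    intervalIntegral.integral_hasStrictDerivAt_right (hg.intervalIntegrable _ _)
      hg.stronglyMeasurable.stronglyMeasurableAtFilter hg.continuousAt⟩

/-- The supremum of the values of the clock. -/
def horizon (τ : ℝ → ℝ) : EReal := ⨆ s, (τ s : EReal)

theorem strictMono (h : IsClock g τ) : StrictMono τ :=
  strictMono_of_deriv_pos fun s => by rw [(h.hasStrictDerivAt s).hasDerivAt.deriv]; exact h.pos s

theorem continuous (h : IsClock g τ) : Continuous τ :=
  continuous_iff_continuousAt.2 fun s => (h.hasStrictDerivAt s).hasDerivAt.continuousAt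

theorem mem_timeInterval (h : IsClock g τ) {s : ℝ} (hs : 0 ≤ s) :
    τ s ∈ timeInterval (horizon τ) := by
  refine ⟨h.zero ▸ h.strictMono.monotone hs, ?_⟩
  exact (EReal.coe_lt_coe_iff.2 (h.strictMono (lt_add_one s))).trans_le
    (le_iSup (fun s => (τ s : EReal)) (s + 1))

theorem exists_eq (h : IsClock g τ) {t : ℝ} (ht : t ∈ timeInterval (horizon τ)) :
    ∃ s, 0 ≤ s ∧ τ s = t := by
  obtain ⟨s', hs'⟩ := lt_iSup_iff.1 ht.2
  have hs' : t < τ s' := EReal.coe_lt_coe_iff.1 hs'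
  have h0 : 0 ≤ s' := by
    by_contra hc
    have := h.strictMono (not_le.1 hc)
    rw [h.zero] at this
    linarith [ht.1]
  obtain ⟨s, hs, hst⟩ := intermediate_value_Icc h0 h.continuous.continuousOn
    (show t ∈ Icc (τ 0) (τ s') from ⟨by rw [h.zero]; exact ht.1, hs'.le⟩)
  exact ⟨s, hs.1, hst⟩

/-- The inverse of the clock. Its values beyond the range of the clock are arbitrary. -/
def inverse (τ : ℝ → ℝ) : ℝ → ℝ := Function.invFun τ

theorem inverse_apply (h : IsClock g τ) (s : ℝ) : inverse τ (τ s) = s :=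
  Function.leftInverse_invFun h.strictMono.injective s

theorem hasStrictDerivAt_inverse (h : IsClock g τ) (s : ℝ) :
    HasStrictDerivAt (inverse τ) (g s)⁻¹ (τ s) :=
  (h.hasStrictDerivAt s).to_local_left_inverse (h.pos s).ne'
    (Eventually.of_forall h.inverse_apply)

theorem inverse_strictMonoOn (h : IsClock g τ) :
    StrictMonoOn (inverse τ) (timeInterval (horizon τ)) := by
  intro t₁ h₁ t₂ h₂ hlt
  obtain ⟨s₁, -, rfl⟩ := h.exists_eq h₁
  obtain ⟨s₂, -, rfl⟩ := h.exists_eq h₂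
  rw [h.inverse_apply, h.inverse_apply]
  exact h.strictMono.lt_iff_lt.1 hlt

theorem inverse_bijOn (h : IsClock g τ) :
    BijOn (inverse τ) (timeInterval (horizon τ)) (Ici 0) := by
  refine ⟨fun t ht => ?_, h.inverse_strictMonoOn.injOn, fun s hs =>
    ⟨τ s, h.mem_timeInterval hs, h.inverse_apply s⟩⟩
  obtain ⟨s, hs, rfl⟩ := h.exists_eq ht
  rw [h.inverse_apply]
  exact hs

/-- A clock whose rate is bounded from below runs for all times. -/
theorem horizon_eq_top (h : IsClock g τ) {k : ℝ} (hk : 0 < k) (hg : ∀ s, 0 ≤ s → k ≤ g s) :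
    horizon τ = ⊤ := by
  have hm : MonotoneOn (fun s => τ s - k * s) (Ici 0) := by
    refine monotoneOn_of_hasDerivWithinAt_nonneg (f' := fun s => g s - k * 1) (convex_Ici 0)
      (h.continuous.sub (continuous_const.mul continuous_id)).continuousOn (fun s _ =>
        ((h.hasStrictDerivAt s).hasDerivAt.sub
          ((hasDerivAt_id s).const_mul k)).hasDerivWithinAt) fun s hs => ?_
    have := hg s (interior_subset hs)
    linarith
  have hge : ∀ s, 0 ≤ s → k * s ≤ τ s := fun s hs => by
    have := hm self_mem_Ici hs hs
    simp only [h.zero, mul_zero, sub_self] at this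
    linarith
  refine EReal.eq_top_iff_forall_lt _ |>.2 fun y => ?_
  have h1 : y < τ (|y| / k + 1) := by
    have := hge (|y| / k + 1) (by positivity)
    have e : k * (|y| / k + 1) = |y| + k := by field_simp
    rw [e] at this
    linarith [le_abs_self y]
  exact (EReal.coe_lt_coe_iff.2 h1).trans_le (le_iSup (fun s => (τ s : EReal)) _)

end IsClock

section TimeChange

variable {n : ℕ} {lam a : ℝ} {X : ℝ → CkLoop (n + 1)}

/-- The clock rate `𝓛(X(s))^(2-a)`, extended to negative times by its value at zero. -/
def clockRate (a : ℝ) (X : ℝ → CkLoop (n + 1)) (s : ℝ) : ℝ := (X (max s 0)).len ^ (2 - a)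

/-- The time of the flow with parameter `a` as a function of the time of the flow with `a = 2`. -/
def clock (a : ℝ) (X : ℝ → CkLoop (n + 1)) (s : ℝ) : ℝ := ∫ x in (0 : ℝ)..s, clockRate a X x

theorem isClock_clock (hX : ContinuousOn X (Ici 0)) (hpos : ∀ t, 0 ≤ t → 0 < (X t).len) :
    IsClock (clockRate a X) (clock a X) := by
  have hp : ∀ s : ℝ, 0 < (X (max s 0)).len := fun s => hpos _ (le_max_right _ _)
  refine IsClock.integral ?_ fun s => Real.rpow_pos_of_pos (hp s) _
  have hc : Continuous fun s : ℝ => X (max s 0) :=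
    hX.comp_continuous (by fun_prop) fun s => le_max_right s 0
  exact (CkLoop.continuous_len.comp hc).rpow_const fun s => Or.inl (hp s).ne'

theorem isTimeChange_clock (hX : ContinuousOn X (Ici 0)) (hpos : ∀ t, 0 ≤ t → 0 < (X t).len) :
    IsTimeChange a X (IsClock.horizon (clock a X)) (IsClock.inverse (clock a X)) := by
  have h := isClock_clock (a := a) hX hpos
  refine ⟨?_, h.inverse_strictMonoOn, h.inverse_bijOn, fun t ht => ?_⟩
  · have := h.inverse_apply 0
    rwa [h.zero] at this
  · obtain ⟨s, hs, rfl⟩ := h.exists_eq ht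
    rw [h.inverse_apply]
    have h1 := (h.hasStrictDerivAt_inverse s).hasDerivAt.hasDerivWithinAt
      (s := timeInterval (IsClock.horizon (clock a X)))
    rw [clockRate, max_eq_left hs, ← Real.rpow_neg (hpos s hs).le, neg_sub] at h1
    exact h1

/-- Composing a solution of the flow with `a = 2` with the time change gives a solution of the
flow with parameter `a`. -/
theorem IsCkFlow.comp_timeChange (hX : IsCkFlow lam 2 ⊤ X) (hpos : ∀ t, 0 ≤ t → 0 < (X t).len)
    {T : EReal} {φ : ℝ → ℝ} (hφ : IsTimeChange a X T φ) :
    IsCkFlow lam a T (fun t => X (φ t)) := by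
  obtain ⟨-, -, hb, hd⟩ := hφ
  rw [IsCkFlow, timeInterval_top] at hX
  refine ⟨hX.1.comp ?_ hb.mapsTo, fun t ht u hu => ?_⟩
  · rw [contDiffOn_one_iff_derivWithin (uniqueDiffOn_timeInterval T)]
    refine ⟨fun t ht => (hd t ht).differentiableWithinAt, ?_⟩
    have hc : ContinuousOn (fun t => (X (φ t)).len ^ (a - 2)) (timeInterval T) := by
      refine ContinuousOn.rpow_const (CkLoop.continuous_len.comp_continuousOn
        (hX.1.continuousOn.comp (fun t ht => (hd t ht).continuousWithinAt) hb.mapsTo))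
        fun t ht => Or.inl (hpos _ (hb.mapsTo ht)).ne'
    exact hc.congr fun t ht => (hd t ht).derivWithin (uniqueDiffOn_timeInterval T t ht)
  · have h1 := hX.2 (φ t) (hb.mapsTo ht) u hu
    have h2 := h1.scomp t (hd t ht) hb.mapsTo
    have hL : (length fun x : ℝ => (X (φ t)).jet 1 (x : UnitAddCircle)) ≠ 0 :=
      (hpos _ (hb.mapsTo ht)).ne'
    rw [flowField_eq_smul lam a hL]
    exact h2

/-- The time-changed solution is the maximal one. -/
theorem isTheMaximalFlow_clock (hlam : 0 < lam) (hX : IsCkFlow lam 2 ⊤ X)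
    (hpos : ∀ t, 0 ≤ t → 0 < (X t).len) :
    IsTheMaximalFlow lam a (X 0) (IsClock.horizon (clock a X))
      (fun t => X (IsClock.inverse (clock a X) t)) := by
  have hXc : ContinuousOn X (Ici 0) := by
    have := hX.1.continuousOn
    rwa [timeInterval_top] at this
  have hφ := isTimeChange_clock (a := a) hXc hpos
  have h := isClock_clock (a := a) hXc hpos
  have hZ := hX.comp_timeChange hpos hφ
  have hZpos : ∀ t ∈ timeInterval (IsClock.horizon (clock a X)),
      0 < (X (IsClock.inverse (clock a X) t)).len := fun t ht => hpos _ (hφ.2.2.1.mapsTo ht)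
  have h0 := h.mem_timeInterval le_rfl
  rw [h.zero] at h0
  refine ⟨by simpa using h0.2, by simp only [hφ.1], hZ, hZpos, fun T' Y hY hY0 => ?_⟩
  have hagree : ∀ t ∈ timeInterval (IsClock.horizon (clock a X)) ∩ timeInterval T',
      Y t = CkLoop.toW11 (X (IsClock.inverse (clock a X) t)) := by
    intro t ht
    refine (hZ.mono (min_le_left _ T')).unique hlam (hY.mono (min_le_right _ _))
      (fun s hs => hZpos s ⟨hs.1, hs.2.trans_le (min_le_left _ _)⟩) (by simp only [hφ.1]; exact hY0)
      t ⟨ht.1.1, lt_min ht.1.2 ht.2.2⟩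
  refine ⟨fun t ht => by rw [hagree t ht, CkLoop.toW11_curve], fun hYpos => ?_⟩
  by_contra hlt
  rw [not_le] at hlt
  -- the length of `Y` is bounded away from zero up to the horizon, so the clock cannot stop there
  obtain ⟨T₀, hT₀⟩ : ∃ T₀ : ℝ, (T₀ : EReal) = IsClock.horizon (clock a X) :=
    ⟨_, EReal.coe_toReal hlt.ne_top (ne_bot_of_gt h0.2)⟩
  have hT₀0 : 0 ≤ T₀ := by
    have := h0.2
    rw [← hT₀] at this
    exact (EReal.coe_lt_coe_iff.1 this).le
  have hsub : Icc 0 T₀ ⊆ timeInterval T' := fun t ht =>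
    ⟨ht.1, (EReal.coe_le_coe_iff.2 ht.2).trans_lt (hT₀ ▸ hlt)⟩
  have hc : ContinuousOn (fun t => (Y t).len ^ (2 - a)) (Icc 0 T₀) :=
    ContinuousOn.rpow_const (W11Loop.continuous_len.comp_continuousOn (hY.1.continuousOn.mono hsub))
      fun t ht => Or.inl (hYpos t (hsub ht)).ne'
  obtain ⟨t₁, ht₁, hmin⟩ := isCompact_Icc.exists_isMinOn ⟨0, le_rfl, hT₀0⟩ hc
  refine hlt.ne_top (h.horizon_eq_top (Real.rpow_pos_of_pos (hYpos t₁ (hsub ht₁)) (2 - a))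
    fun s hs => ?_)
  have hs' := h.mem_timeInterval hs
  have hmem : clock a X s ∈ Icc 0 T₀ := by
    have := hs'.2
    rw [← hT₀] at this
    exact ⟨hs'.1, (EReal.coe_lt_coe_iff.1 this).le⟩
  have h2 := hmin hmem
  simp only [mem_ofPred_eq] at h2
  rw [hagree _ ⟨hs', hsub hmem⟩, CkLoop.len_eq, h.inverse_apply] at h2
  rw [clockRate, max_eq_left hs]
  exact h2

/-- For `a ≥ 2` the clock rate `𝓛^(2-a)` is bounded from below because the length decreases, so the
solution exists for all times. -/
theorem exists_timeChange (hlam : 0 < lam) (hX : IsCkFlow lam 2 ⊤ X)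
    (hpos : ∀ t, 0 ≤ t → 0 < (X t).len) (hanti : ∀ t, 0 ≤ t → (X t).len ≤ (X 0).len) (a : ℝ) :
    ∃ (T : EReal) (φ : ℝ → ℝ), (2 ≤ a → T = ⊤) ∧ IsTimeChange a X T φ ∧
      IsTheMaximalFlow lam a (X 0) T (fun t => X (φ t)) := by
  have hXc : ContinuousOn X (Ici 0) := by
    have := hX.1.continuousOn
    rwa [timeInterval_top] at this
  refine ⟨_, _, fun ha => ?_, isTimeChange_clock hXc hpos, isTheMaximalFlow_clock hlam hX hpos⟩
  refine (isClock_clock hXc hpos).horizon_eq_top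
    (Real.rpow_pos_of_pos (hpos 0 le_rfl) (2 - a)) fun s hs => ?_
  rw [clockRate, max_eq_left hs]
  exact Real.rpow_le_rpow_of_nonpos (hpos s hs) (hanti s hs) (by linarith)

end TimeChange

theorem IsFlowField.len_le {n : ℕ} {lam : ℝ} {F : CkLoop (n + 1) → CkLoop (n + 1)}
    (hlam : 0 < lam) (hF : IsFlowField lam F) {X : ℝ → CkLoop (n + 1)}
    (hX : ∀ t, 0 ≤ t → HasDerivWithinAt X (F (X t)) (Ici 0) t) {t : ℝ} (ht : 0 ≤ t) :
    (X t).len ≤ (X 0).len :=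
  intervalIntegral.integral_mono_on zero_le_one
    ((loop_comp_continuous ((X t).jet 1)).norm.intervalIntegrable 0 1)
    ((loop_comp_continuous ((X 0).jet 1)).norm.intervalIntegrable 0 1) fun u _ =>
    speed_antitoneOn hlam hF (convex_Ici 0) hX (u : UnitAddCircle) self_mem_Ici ht ht

theorem preservation_of_immersion {lam : ℝ} (hlam : 0 < lam) {X₀ : CkLoop 1} (h0 : IsImmersed X₀) :
    ∃ X : ℝ → CkLoop 1, IsTheGlobalFlow lam X₀ X ∧
        (∀ t : ℝ, 0 ≤ t →
          IsImmersed (X t) ∧ SpeedSqBound (X t) X₀ (Real.exp (-4 * t / lam ^ 2))) ∧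
        ∀ a : ℝ, ∃ (T : EReal) (φ : ℝ → ℝ),
          (2 ≤ a → T = ⊤) ∧ IsTimeChange a X T φ ∧
          IsTheMaximalFlow lam a X₀ T (fun t => X (φ t)) ∧
          ∀ t ∈ timeInterval T,
            IsImmersed (X (φ t)) ∧
            SpeedSqBound (X (φ t)) X₀ (Real.exp (-4 * φ t / lam ^ 2)) := by
  obtain ⟨X, rfl, hX⟩ := exists_global_one hlam h0
  have hF := isFlowField_fieldOne hlam
  have hLip := fun M m hm => exists_bounds_fieldOne (lam := lam) (m := m) hlam hm M
  have him : ∀ t, 0 ≤ t → IsImmersed (X t) := fun t ht =>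
    hF.isImmersed_of_integral hlam (convex_Ici 0) self_mem_Ici hX h0 ht ht
  have hsp : ∀ t, 0 ≤ t → SpeedSqBound (X t) (X 0) (Real.exp (-4 * t / lam ^ 2)) :=
    fun t ht q => hF.speed_sq_lower hlam (convex_Ici 0) self_mem_Ici hX ht ht q
  refine ⟨X, hF.isTheGlobalFlow hlam hLip h0 hX, fun t ht => ⟨him t ht, hsp t ht⟩, fun a => ?_⟩
  obtain ⟨T, φ, h1, h2, h3⟩ := exists_timeChange hlam (hF.isCkFlow hlam hLip h0 hX)
    (fun t ht => CkLoop.len_pos_of_isImmersed (him t ht)) (fun t ht => hF.len_le hlam hX ht) a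
  exact ⟨T, φ, h1, h2, h3, fun t ht =>
    ⟨him _ (h2.2.2.1.mapsTo ht), hsp _ (h2.2.2.1.mapsTo ht)⟩⟩

/-! ### The oriented area form -/

/-- The area form of the plane, multiplied by the sign `σ` that fixes the orientation. -/
def wedge (σ : ℝ) (a b : Plane) : ℝ := σ * (a 0 * b 1 - a 1 * b 0)

section Wedge

variable {σ : ℝ}

theorem wedge_add_right (a b c : Plane) : wedge σ a (b + c) = wedge σ a b + wedge σ a c := by
  simp only [wedge, PiLp.add_apply]; ring

theorem wedge_sub_right (a b c : Plane) : wedge σ a (b - c) = wedge σ a b - wedge σ a c := by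
  simp only [wedge, PiLp.sub_apply]; ring

theorem wedge_sub_left (a b c : Plane) : wedge σ (a - b) c = wedge σ a c - wedge σ b c := by
  simp only [wedge, PiLp.sub_apply]; ring

theorem wedge_smul_right (r : ℝ) (a b : Plane) : wedge σ a (r • b) = r * wedge σ a b := by
  simp only [wedge, PiLp.smul_apply, smul_eq_mul]; ring

theorem wedge_smul_left (r : ℝ) (a b : Plane) : wedge σ (r • a) b = r * wedge σ a b := by
  simp only [wedge, PiLp.smul_apply, smul_eq_mul]; ring

theorem wedge_self (a : Plane) : wedge σ a a = 0 := by
  simp only [wedge]; ring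

theorem wedge_neg_left (a b : Plane) : wedge σ (-a) b = -wedge σ a b := by
  simp only [wedge, PiLp.neg_apply]; ring

theorem wedge_neg_sign (a b : Plane) : wedge (-σ) a b = -wedge σ a b := by
  simp only [wedge]; ring

theorem plane_inner (a b : Plane) : inner ℝ a b = a 0 * b 0 + a 1 * b 1 := by
  simp [PiLp.inner_apply, Fin.sum_univ_two]; ring

theorem plane_norm_sq (a : Plane) : ‖a‖ ^ 2 = a 0 * a 0 + a 1 * a 1 := by
  rw [← real_inner_self_eq_norm_sq, plane_inner]

theorem plane_ext {a b : Plane} (h0 : a 0 = b 0) (h1 : a 1 = b 1) : a = b := by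
  ext i
  fin_cases i
  · exact h0
  · exact h1

/-- The wedge with a fixed vector as a continuous linear functional. -/
def wedgeL (σ : ℝ) (a : Plane) : Plane →L[ℝ] ℝ :=
  LinearMap.toContinuousLinearMap
    { toFun := wedge σ a
      map_add' := wedge_add_right a
      map_smul' := fun r b => wedge_smul_right r a b }

theorem wedgeL_apply (a b : Plane) : wedgeL σ a b = wedge σ a b := rfl

theorem continuous_plane_apply (i : Fin 2) : Continuous fun a : Plane => a i :=
  (EuclideanSpace.proj i : Plane →L[ℝ] ℝ).continuous

theorem Continuous.wedge {α : Type*} [TopologicalSpace α] {f g : α → Plane} (hf : Continuous f)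
    (hg : Continuous g) : Continuous fun x => wedge σ (f x) (g x) :=
  continuous_const.mul ((((continuous_plane_apply 0).comp hf).mul
    ((continuous_plane_apply 1).comp hg)).sub (((continuous_plane_apply 1).comp hf).mul
    ((continuous_plane_apply 0).comp hg)))

theorem hasDerivWithinAt_plane_apply {f : ℝ → Plane} {f' : Plane} {s : Set ℝ} {t : ℝ}
    (hf : HasDerivWithinAt f f' s t) (i : Fin 2) :
    HasDerivWithinAt (fun x => f x i) (f' i) s t := by
  have h := (EuclideanSpace.proj i : Plane →L[ℝ] ℝ).hasFDerivAt.comp_hasDerivWithinAt t hf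
  exact h

theorem HasDerivWithinAt.wedge {f g : ℝ → Plane} {f' g' : Plane} {s : Set ℝ} {t : ℝ}
    (hf : HasDerivWithinAt f f' s t) (hg : HasDerivWithinAt g g' s t) :
    HasDerivWithinAt (fun x => wedge σ (f x) (g x)) (wedge σ f' (g t) + wedge σ (f t) g') s t := by
  have h := (((hasDerivWithinAt_plane_apply hf 0).mul (hasDerivWithinAt_plane_apply hg 1)).sub
    ((hasDerivWithinAt_plane_apply hf 1).mul (hasDerivWithinAt_plane_apply hg 0))).const_mul σ
  refine h.congr_deriv ?_
  simp only [SobolevLengthFlow.wedge]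
  ring

theorem hasDerivAt_wedge_const (a : Plane) {g : ℝ → Plane} {g' : Plane} {t : ℝ}
    (hg : HasDerivAt g g' t) : HasDerivAt (fun x => wedge σ a (g x)) (wedge σ a g') t := by
  have h := (wedgeL σ a).hasFDerivAt.comp_hasDerivAt t hg
  exact h

/-- A vector whose wedge with `a ≠ 0` vanishes is a multiple of `a`. -/
theorem eq_smul_of_wedge_eq_zero (hσ : σ ≠ 0) {a b : Plane} (ha : a ≠ 0)
    (h : wedge σ a b = 0) : b = (inner ℝ a b / ‖a‖ ^ 2) • a := by
  have hn : ‖a‖ ^ 2 ≠ 0 := pow_ne_zero 2 (norm_ne_zero_iff.2 ha)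
  have h' : a 0 * b 1 - a 1 * b 0 = 0 := (mul_eq_zero.1 h).resolve_left hσ
  rw [plane_norm_sq] at hn
  rw [plane_inner, plane_norm_sq]
  apply plane_ext
  · rw [PiLp.smul_apply, smul_eq_mul, div_mul_eq_mul_div, eq_div_iff hn]
    linear_combination (-(a 1)) * h'
  · rw [PiLp.smul_apply, smul_eq_mul, div_mul_eq_mul_div, eq_div_iff hn]
    linear_combination (a 0) * h'

/-- Expansion of a wedge in the orthogonal frame given by `a`. -/
theorem norm_sq_mul_wedge (a b c : Plane) :
    ‖a‖ ^ 2 * wedge σ b c = inner ℝ a b * wedge σ a c - wedge σ a b * inner ℝ a c := by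
  rw [plane_norm_sq, plane_inner, plane_inner]
  simp only [wedge]
  ring

/-- A vector pointing to the side of `a` where the wedge with `a` is negative. -/
theorem exists_wedge_neg (hσ : σ ≠ 0) {a : Plane} (ha : a ≠ 0) : ∃ b, wedge σ a b < 0 := by
  by_contra! h
  have h0 : ∀ b, wedge σ a b = 0 := fun b => by
    refine le_antisymm ?_ (h b)
    have := h ((-1 : ℝ) • b)
    rw [wedge_smul_right] at this
    linarith
  have h1 := h0 (EuclideanSpace.single 1 1)
  have h2 := h0 (EuclideanSpace.single 0 1)
  simp [wedge, hσ] at h1 h2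
  exact ha (plane_ext (by simpa using h1) (by simpa using h2))

end Wedge

/-! ### Evolution of the curvature -/

theorem sign_mul_signedCurvature (σ : ℝ) (γ : CkLoop 2) (q : UnitAddCircle) :
    σ * signedCurvature γ q = wedge σ (γ.jet 1 q) (γ.jet 2 q) / ‖γ.jet 1 q‖ ^ 3 := by
  rw [signedCurvature, wedge, mul_div_assoc]

theorem curvature_algebra {l n c w w' g : ℝ} (hn : n ≠ 0)
    (h : w' = l * ((c - 2) * w + n ^ 2 * g)) :
    (w' * n ^ 3 - w * (3 * n ^ 2 * (l * ((c - 1) * n)))) / (n ^ 3) ^ 2 =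
      l * ((1 - 2 * c) * (w / n ^ 3) + g / n) := by
  rw [h]
  field_simp
  ring

/-- The curvature satisfies an equation whose reaction term is the component of `P - X` on the
inner side of the tangent. -/
theorem hasDerivWithinAt_curvature {lam σ : ℝ} (hlam : 0 < lam) {X : ℝ → CkLoop 2} {D : Set ℝ}
    {t : ℝ} (hX : HasDerivWithinAt X (fieldTwo lam (X t)) D t) (him : IsImmersed (X t))
    (q : UnitAddCircle) :
    HasDerivWithinAt (fun τ => σ * signedCurvature (X τ) q)
      ((lam ^ 2)⁻¹ * ((1 - 2 * (inner ℝ ((X t).jet 1 q) ((X t).tangent lam q) / ‖(X t).jet 1 q‖)) *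
        (σ * signedCurvature (X t) q) +
        wedge σ ((X t).jet 1 q) ((X t).smoothed lam q - (X t).jet 0 q) /
          (lam ^ 2 * (X t).len ^ 2) / ‖(X t).jet 1 q‖)) D t := by
  simp only [sign_mul_signedCurvature]
  have hF := isFlowField_fieldTwo hlam
  have h1 := CkLoop.hasDerivWithinAt_jet_apply hX 1 q
  have h2 := CkLoop.hasDerivWithinAt_jet_apply hX 2 q
  rw [(hF.1 _ him q).2] at h1
  rw [fieldTwo_jet_two hlam him q] at h2
  have hn : 0 < ‖(X t).jet 1 q‖ := norm_pos_iff.2 (him q)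
  have h3 : HasDerivWithinAt (fun τ => ‖(X τ).jet 1 q‖)
      ((lam ^ 2)⁻¹ * ((inner ℝ ((X t).jet 1 q) ((X t).tangent lam q) / ‖(X t).jet 1 q‖ - 1) *
        ‖(X t).jet 1 q‖)) D t := by
    have h := h1.norm_sq.sqrt (by positivity)
    simp only [Real.sqrt_sq (norm_nonneg _)] at h
    refine h.congr_deriv ?_
    rw [inner_smul_right, inner_sub_right, inner_smul_right, real_inner_self_eq_norm_sq]
    field_simp
  have h5 : HasDerivWithinAt (fun τ => ‖(X τ).jet 1 q‖ ^ 3) (3 * ‖(X t).jet 1 q‖ ^ 2 *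
      ((lam ^ 2)⁻¹ * ((inner ℝ ((X t).jet 1 q) ((X t).tangent lam q) / ‖(X t).jet 1 q‖ - 1) *
        ‖(X t).jet 1 q‖))) D t := (h3.pow 3).congr_deriv (by push_cast; ring)
  refine ((HasDerivWithinAt.wedge (σ := σ) h1 h2).div h5 (pow_ne_zero 3 hn.ne')).congr_deriv
    (curvature_algebra hn.ne' ?_)
  have key := norm_sq_mul_wedge (σ := σ) ((X t).jet 1 q) ((X t).tangent lam q) ((X t).jet 2 q)
  rw [wedge_smul_left, wedge_sub_left, wedge_smul_left, wedge_smul_right,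
    wedge_sub_right, wedge_add_right, wedge_smul_right, wedge_smul_right, wedge_smul_right]
  generalize wedge σ ((X t).jet 1 q) ((X t).tangent lam q) = wN at *
  generalize wedge σ ((X t).tangent lam q) ((X t).jet 2 q) = wNW at *
  generalize wedge σ ((X t).jet 1 q) ((X t).jet 2 q) = w at *
  generalize wedge σ ((X t).jet 1 q) ((X t).smoothed lam q - (X t).jet 0 q) = g at *
  generalize inner ℝ ((X t).jet 1 q) ((X t).tangent lam q) = i at *
  generalize inner ℝ ((X t).jet 1 q) ((X t).jet 2 q) = j at *
  have hw : wNW = (i * w - wN * j) / ‖(X t).jet 1 q‖ ^ 2 := by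
    rw [eq_div_iff (by positivity)]; linarith
  rw [hw]
  have hL : (X t).len ≠ 0 := (CkLoop.len_pos_of_isImmersed him).ne'
  field_simp
  ring

/-! ### The angle function -/

section Angle

variable {σ : ℝ} {γ V W : ℝ → Plane}

/-- The plane as the complex line; the sign `σ` decides about conjugation. -/
def toC (σ : ℝ) (a : Plane) : ℂ := ⟨a 0, σ * a 1⟩

theorem toC_ne_zero (hσ : σ ≠ 0) {a : Plane} (ha : a ≠ 0) : toC σ a ≠ 0 := by
  intro h
  have h0 : a 0 = 0 := congrArg Complex.re h
  have h1 : σ * a 1 = 0 := congrArg Complex.im h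
  exact ha (plane_ext h0 ((mul_eq_zero.1 h1).resolve_left hσ))

theorem toC_smul (r : ℝ) (a : Plane) : toC σ (r • a) = r * toC σ a := by
  apply Complex.ext
  · simp [toC]
  · simp [toC]; ring

theorem wedge_eq_im (a b : Plane) : wedge σ a b = ((starRingEnd ℂ) (toC σ a) * toC σ b).im := by
  simp only [wedge, toC, Complex.mul_im, Complex.conj_re, Complex.conj_im]
  ring

/-- Identification with the complex line as a continuous linear map. -/
def toCL (σ : ℝ) : Plane →L[ℝ] ℂ :=
  LinearMap.toContinuousLinearMap
    { toFun := toC σ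
      map_add' := fun a b => by apply Complex.ext <;> simp [toC]; ring
      map_smul' := fun r a => by rw [toC_smul]; simp }

/-- The logarithm of the quotient of the velocities at `v` and `u`, as the integral of the
logarithmic derivative. Its imaginary part is the turning angle from `u` to `v`. -/
def logRatio (σ : ℝ) (V W : ℝ → Plane) (u v : ℝ) : ℂ :=
  ∫ x in u..v, toC σ (W x) / toC σ (V x)

theorem logDeriv_continuous (hσ : σ ≠ 0) (hV : Continuous V) (hW : Continuous W)
    (h0 : ∀ x, V x ≠ 0) : Continuous fun x => toC σ (W x) / toC σ (V x) :=
  ((toCL σ).continuous.comp hW).div ((toCL σ).continuous.comp hV) fun x => toC_ne_zero hσ (h0 x)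

theorem toC_eq_mul_exp (hσ : σ ≠ 0) (hV : ∀ x, HasDerivAt V (W x) x) (hW : Continuous W)
    (h0 : ∀ x, V x ≠ 0) (u v : ℝ) :
    toC σ (V v) = toC σ (V u) * Complex.exp (logRatio σ V W u v) := by
  have hVc : Continuous V := continuous_iff_continuousAt.2 fun x => (hV x).continuousAt
  have hq := logDeriv_continuous hσ hVc hW h0
  have hd : ∀ x, HasDerivAt (fun y => toC σ (V y) * Complex.exp (-logRatio σ V W u y)) 0 x := by
    intro x
    have h1 : HasDerivAt (fun y => toC σ (V y)) (toC σ (W x)) x := by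
      have h := (toCL σ).hasFDerivAt.comp_hasDerivAt x (hV x)
      exact h
    have h2 : HasDerivAt (fun y => logRatio σ V W u y) (toC σ (W x) / toC σ (V x)) x :=
      intervalIntegral.integral_hasDerivAt_right (hq.intervalIntegrable _ _)
        hq.stronglyMeasurable.stronglyMeasurableAtFilter hq.continuousAt
    refine (h1.mul h2.neg.cexp).congr_deriv ?_
    have := toC_ne_zero hσ (h0 x)
    field_simp
    ring
  have hc := is_const_of_deriv_eq_zero (fun x => (hd x).differentiableAt)
    (fun x => (hd x).deriv) v u
  have e : logRatio σ V W u u = 0 := intervalIntegral.integral_same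
  simp only [e, neg_zero, Complex.exp_zero, mul_one] at hc
  rw [← hc, mul_assoc, ← Complex.exp_add, neg_add_cancel, Complex.exp_zero, mul_one]

theorem wedge_eq_sin (hσ : σ ≠ 0) (hV : ∀ x, HasDerivAt V (W x) x) (hW : Continuous W)
    (h0 : ∀ x, V x ≠ 0) (u v : ℝ) :
    wedge σ (V u) (V v) = Complex.normSq (toC σ (V u)) * Real.exp (logRatio σ V W u v).re *
      Real.sin (logRatio σ V W u v).im := by
  rw [wedge_eq_im, toC_eq_mul_exp hσ hV hW h0 u v, ← mul_assoc, mul_comm _ (toC σ (V u)),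
    Complex.mul_conj, Complex.im_ofReal_mul, Complex.exp_im, mul_assoc]

theorem logRatio_add (hσ : σ ≠ 0) (hV : Continuous V) (hW : Continuous W)
    (h0 : ∀ x, V x ≠ 0) (u v w : ℝ) :
    logRatio σ V W u v + logRatio σ V W v w = logRatio σ V W u w :=
  intervalIntegral.integral_add_adjacent_intervals
    ((logDeriv_continuous hσ hV hW h0).intervalIntegrable _ _)
    ((logDeriv_continuous hσ hV hW h0).intervalIntegrable _ _)

theorem logDeriv_im (a b : Plane) :
    (toC σ b / toC σ a).im = wedge σ a b / Complex.normSq (toC σ a) := by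
  rw [Complex.div_im, wedge_eq_im]
  simp only [Complex.mul_im, Complex.conj_re, Complex.conj_im]
  ring

theorem logRatio_im_eq (hσ : σ ≠ 0) (hV : Continuous V) (hW : Continuous W)
    (h0 : ∀ x, V x ≠ 0) (u v : ℝ) :
    (logRatio σ V W u v).im = ∫ x in u..v, wedge σ (V x) (W x) / Complex.normSq (toC σ (V x)) := by
  have h := Complex.imCLM.intervalIntegral_comp_comm
    ((logDeriv_continuous hσ hV hW h0).intervalIntegrable (μ := volume) u v)
  simp only [Complex.imCLM_apply, logDeriv_im] at h
  exact h.symm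

theorem logRatio_im_nonneg (hσ : σ ≠ 0) (hV : Continuous V) (hW : Continuous W)
    (h0 : ∀ x, V x ≠ 0) (hk : ∀ x, 0 ≤ wedge σ (V x) (W x)) {u v : ℝ} (huv : u ≤ v) :
    0 ≤ (logRatio σ V W u v).im := by
  rw [logRatio_im_eq hσ hV hW h0]
  exact intervalIntegral.integral_nonneg huv fun x _ =>
    div_nonneg (hk x) (Complex.normSq_nonneg _)

/-- A closed arc of nonnegative curvature that turns exactly once lies on one side of its
initial tangent. -/
theorem wedge_nonneg_of_turning (hσ : σ ≠ 0) (hγ : ∀ x, HasDerivAt γ (V x) x)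
    (hV : ∀ x, HasDerivAt V (W x) x) (hW : Continuous W) (h0 : ∀ x, V x ≠ 0)
    (hk : ∀ x, 0 ≤ wedge σ (V x) (W x)) {u u' : ℝ} (hcl : γ u' = γ u)
    (hturn : (logRatio σ V W u u').im = 2 * Real.pi) {v : ℝ} (hv : v ∈ Icc u u') :
    0 ≤ wedge σ (V u) (γ v - γ u) := by
  have hVc : Continuous V := continuous_iff_continuousAt.2 fun x => (hV x).continuousAt
  have hmono : ∀ x y, x ≤ y → (logRatio σ V W u x).im ≤ (logRatio σ V W u y).im := by
    intro x y hxy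
    rw [← logRatio_add hσ hVc hW h0 u x y, Complex.add_im]
    linarith [logRatio_im_nonneg hσ hVc hW h0 hk hxy]
  have hzero : (logRatio σ V W u u).im = 0 := by
    rw [logRatio, intervalIntegral.integral_same]; rfl
  have hd : ∀ x, HasDerivAt (fun y => wedge σ (V u) (γ y - γ u)) (wedge σ (V u) (V x)) x :=
    fun x => hasDerivAt_wedge_const (V u) ((hγ x).sub_const (γ u))
  have hc : Continuous fun y => wedge σ (V u) (γ y - γ u) :=
    continuous_iff_continuousAt.2 fun x => (hd x).continuousAt
  have hpos : ∀ x, 0 ≤ Complex.normSq (toC σ (V u)) * Real.exp (logRatio σ V W u x).re :=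
    fun x => mul_nonneg (Complex.normSq_nonneg _) (Real.exp_pos _).le
  -- the height over the tangent at `u` increases until the turning angle reaches `π`, and then
  -- decreases to its value zero at `u'`
  rcases le_total (logRatio σ V W u v).im Real.pi with h | h
  · have hm : MonotoneOn (fun y => wedge σ (V u) (γ y - γ u)) (Icc u v) := by
      refine monotoneOn_of_hasDerivWithinAt_nonneg (convex_Icc u v) hc.continuousOn
        (fun x _ => (hd x).hasDerivWithinAt) fun x hx => ?_
      have hx' := interior_subset hx
      rw [wedge_eq_sin hσ hV hW h0]
      refine mul_nonneg (hpos x) (Real.sin_nonneg_of_nonneg_of_le_pi ?_ ?_)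
      · rw [← hzero]; exact hmono _ _ hx'.1
      · exact (hmono _ _ hx'.2).trans h
    have := hm ⟨le_rfl, hv.1⟩ ⟨hv.1, le_rfl⟩ hv.1
    simpa [wedge] using this
  · have hm : AntitoneOn (fun y => wedge σ (V u) (γ y - γ u)) (Icc v u') := by
      refine antitoneOn_of_hasDerivWithinAt_nonpos (convex_Icc v u') hc.continuousOn
        (fun x _ => (hd x).hasDerivWithinAt) fun x hx => ?_
      have hx' := interior_subset hx
      rw [wedge_eq_sin hσ hV hW h0]
      refine mul_nonpos_of_nonneg_of_nonpos (hpos x) ?_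
      have h1 := h.trans (hmono _ _ hx'.1)
      have h2 := (hmono _ _ hx'.2).trans hturn.le
      rw [← Real.sin_sub_two_pi]
      exact Real.sin_nonpos_of_nonpos_of_neg_pi_le (by linarith) (by linarith)
    have := hm ⟨le_rfl, hv.2⟩ ⟨hv.2, le_rfl⟩ hv.2
    beta_reduce at this
    rw [hcl, sub_self] at this
    simpa [wedge] using this

end Angle

/-! ### Curves on one side of their tangents -/

/-- The curve lies on the inner side, with respect to the orientation `σ`, of all its tangents. -/
def ChordCondition {n : ℕ} (σ : ℝ) (γ : CkLoop (n + 1)) : Prop :=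
  ∀ u v, 0 ≤ wedge σ (γ.jet 1 u) (γ.jet 0 v - γ.jet 0 u)

section Chord

variable {n : ℕ} {σ lam : ℝ}

theorem exists_wedge_chord_ne_zero {γ : CkLoop (n + 1)} (hσ : σ ≠ 0) (him : IsImmersed γ)
    (u : UnitAddCircle) : ∃ v, wedge σ (γ.jet 1 u) (γ.jet 0 v - γ.jet 0 u) ≠ 0 := by
  by_contra! h
  -- at a point that is extremal in the direction of the tangent the velocity would vanish
  obtain ⟨v, -, hv⟩ := isCompact_univ.exists_isMaxOn univ_nonempty
    (Continuous.continuousOn (f := fun q => inner ℝ (γ.jet 1 u) (γ.jet 0 q)) (by fun_prop))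
  obtain ⟨x, -, rfl⟩ := exists_coe_eq v
  have hd := γ.hasDerivAt_jet_zero x
  have h1 : HasDerivAt (fun y : ℝ => inner ℝ (γ.jet 1 u) (γ.jet 0 (y : UnitAddCircle)))
      (inner ℝ (γ.jet 1 u) (γ.jet 1 (x : UnitAddCircle))) x :=
    (innerSL ℝ (γ.jet 1 u)).hasFDerivAt.comp_hasDerivAt x hd
  have h2 : inner ℝ (γ.jet 1 u) (γ.jet 1 (x : UnitAddCircle)) = 0 :=
    IsLocalMax.hasDerivAt_eq_zero (Eventually.of_forall fun y => hv (mem_univ _)) h1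
  have h3 : HasDerivAt (fun y : ℝ => wedge σ (γ.jet 1 u) (γ.jet 0 (y : UnitAddCircle) - γ.jet 0 u))
      (wedge σ (γ.jet 1 u) (γ.jet 1 (x : UnitAddCircle))) x :=
    hasDerivAt_wedge_const _ (hd.sub_const _)
  have h4 : wedge σ (γ.jet 1 u) (γ.jet 1 (x : UnitAddCircle)) = 0 := by
    have e : (fun y : ℝ => wedge σ (γ.jet 1 u) (γ.jet 0 (y : UnitAddCircle) - γ.jet 0 u)) =
        fun _ => 0 := funext fun y => h _
    rw [e] at h3
    exact h3.unique (hasDerivAt_const x 0)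
  have h5 := eq_smul_of_wedge_eq_zero hσ (him u) h4
  rw [h2, zero_div, zero_smul] at h5
  exact him _ h5

/-- If a curve lies on the inner side of its tangents, then so does its averaged position, and
strictly. -/
theorem ChordCondition.smoothed_pos {γ : CkLoop (n + 1)} (hσ : σ ≠ 0) (hlam : 0 < lam)
    (h : ChordCondition σ γ) (him : IsImmersed γ) (q : UnitAddCircle) :
    0 < wedge σ (γ.jet 1 q) (γ.smoothed lam q - γ.jet 0 q) := by
  obtain ⟨v₀, hv₀⟩ := exists_wedge_chord_ne_zero hσ him q
  obtain ⟨u, hu, rfl⟩ := exists_coe_eq q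
  obtain ⟨w₀, hw₀, rfl⟩ := exists_coe_eq v₀
  have hL := CkLoop.len_pos_of_isImmersed him
  have h0 := loop_comp_continuous (γ.jet 0)
  have h1 := loop_comp_continuous (γ.jet 1)
  have hA := arc_continuous h1
  have hI := integral_kernel_arc hlam (h1.intervalIntegrable 0 1) hL hu
  set k : ℝ → ℝ := fun v => kernel lam (arc (fun x : ℝ => γ.jet 1 (x : UnitAddCircle)) v -
    arc (fun x : ℝ => γ.jet 1 (x : UnitAddCircle)) u) *
    (‖γ.jet 1 (v : UnitAddCircle)‖ / length fun x : ℝ => γ.jet 1 (x : UnitAddCircle)) with hk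
  have hkc : Continuous k := by fun_prop
  have hkpos : ∀ v, 0 < k v := fun v => mul_pos (kernel_pos hlam _)
    (div_pos (norm_pos_iff.2 (him _)) hL)
  have e1 : γ.smoothed lam (u : UnitAddCircle) - γ.jet 0 (u : UnitAddCircle) =
      ∫ v in (0 : ℝ)..1, k v • (γ.jet 0 (v : UnitAddCircle) - γ.jet 0 (u : UnitAddCircle)) := by
    have c1 : Continuous fun v : ℝ => k v • γ.jet 0 (v : UnitAddCircle) := by fun_prop
    have c2 : Continuous fun v : ℝ => k v • γ.jet 0 (u : UnitAddCircle) := by fun_prop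
    simp only [smul_sub]
    rw [intervalIntegral.integral_sub (c1.intervalIntegrable _ _) (c2.intervalIntegrable _ _),
      intervalIntegral.integral_smul_const, hI, one_smul, CkLoop.smoothed_coe hL hu, conv]
    congr 2
    ext1 v
    rw [smul_smul]
    rfl
  have c3 : Continuous fun v : ℝ =>
      k v • (γ.jet 0 (v : UnitAddCircle) - γ.jet 0 (u : UnitAddCircle)) := by fun_prop
  have e2 := (wedgeL σ (γ.jet 1 (u : UnitAddCircle))).intervalIntegral_comp_comm
    (c3.intervalIntegrable (μ := volume) 0 1)
  rw [← e1] at e2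
  simp only [wedgeL_apply, wedge_smul_right] at e2
  rw [← e2]
  have c4 : Continuous fun v : ℝ => k v * wedge σ (γ.jet 1 (u : UnitAddCircle))
      (γ.jet 0 (v : UnitAddCircle) - γ.jet 0 (u : UnitAddCircle)) :=
    hkc.mul (Continuous.wedge continuous_const (h0.sub continuous_const))
  exact intervalIntegral.integral_pos zero_lt_one c4.continuousOn
    (fun v _ => mul_nonneg (hkpos v).le (h _ _))
    ⟨w₀, hw₀, mul_pos (hkpos w₀) (lt_of_le_of_ne (h _ _) hv₀.symm)⟩

end Chord

section Support

variable {σ : ℝ} {γ V : ℝ → Plane}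

/-- A point on the tangent at `u`, ahead of `u`, that lies on the inner side of all tangents is a
point of the curve: the curve follows its tangent until it reaches that point. -/
theorem exists_eq_of_mem_tangent_ahead (hσ : σ ≠ 0) (hγ : ∀ x, HasDerivAt γ (V x) x)
    (hV : Continuous V) (h0 : ∀ x, V x ≠ 0) (hp : Function.Periodic γ 1)
    (hch : ∀ u v, 0 ≤ wedge σ (V u) (γ v - γ u)) {y : Plane}
    (hy : ∀ v, 0 ≤ wedge σ (V v) (y - γ v)) {u : ℝ}
    (hnc : ∃ v, wedge σ (V u) (γ v - γ u) ≠ 0) (hu : wedge σ (V u) (y - γ u) = 0)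
    (hahead : 0 ≤ inner ℝ (V u) (y - γ u)) : ∃ a, γ a = y := by
  set e := V u with he
  set h : ℝ → ℝ := fun v => wedge σ e (γ v - γ u) with hh
  set p : ℝ → ℝ := fun v => inner ℝ e (γ v - γ u) with hpdef
  have hγc : Continuous γ := continuous_iff_continuousAt.2 fun x => (hγ x).continuousAt
  have hhd : ∀ x, HasDerivAt h (wedge σ e (V x)) x := fun x =>
    hasDerivAt_wedge_const e ((hγ x).sub_const (γ u))
  have hpd : ∀ x, HasDerivAt p (inner ℝ e (V x)) x := fun x =>
    (innerSL ℝ e).hasFDerivAt.comp_hasDerivAt x ((hγ x).sub_const (γ u))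
  have hhc : Continuous h := continuous_iff_continuousAt.2 fun x => (hhd x).continuousAt
  have hpc : Continuous p := continuous_iff_continuousAt.2 fun x => (hpd x).continuousAt
  have hn : 0 < ‖e‖ := norm_pos_iff.2 (h0 u)
  have hfold : ∀ x, ∃ x' ∈ Icc (0 : ℝ) 1, h x' = h x ∧ p x' = p x := by
    intro x
    obtain ⟨x', hx', hxx⟩ := hp.exists_mem_Ico₀ zero_lt_one x
    exact ⟨x', Ico_subset_Icc_self hx', by simp only [hh, hxx], by simp only [hpdef, hxx]⟩
  set A : Set ℝ := {v | v ∈ Icc (0 : ℝ) 1 ∧ h v = 0 ∧ p v ≤ inner ℝ e (y - γ u)} with hA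
  have hAc : IsCompact A := by
    have : A = Icc 0 1 ∩ (h ⁻¹' {0} ∩ p ⁻¹' Iic (inner ℝ e (y - γ u))) := rfl
    rw [this]
    exact isCompact_Icc.inter_right ((isClosed_singleton.preimage hhc).inter
      (isClosed_Iic.preimage hpc))
  have hu0 : h u = 0 ∧ p u = 0 := by simp [hh, hpdef, wedge]
  have hAne : A.Nonempty := by
    obtain ⟨x', hx', h1, h2⟩ := hfold u
    exact ⟨x', hx', h1.trans hu0.1, by rw [h2, hu0.2]; exact hahead⟩
  obtain ⟨a, ha, hmax⟩ := hAc.exists_isMaxOn hAne hpc.continuousOn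
  have hmax' : ∀ v, h v = 0 → p v ≤ inner ℝ e (y - γ u) → p v ≤ p a := by
    intro v h1 h2
    obtain ⟨x', hx', h3, h4⟩ := hfold v
    rw [← h4]
    exact hmax ⟨hx', h3.trans h1, h4.trans_le h2⟩
  rcases ha.2.2.eq_or_lt with hpa | hpa
  · refine ⟨a, ?_⟩
    have e1 := eq_smul_of_wedge_eq_zero hσ (h0 u) hu
    have e2 := eq_smul_of_wedge_eq_zero hσ (h0 u) ha.2.1
    have e3 : γ a - γ u = y - γ u := by
      rw [e1, e2]
      congr 2
    exact sub_left_injective e3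
  · exfalso
    have hla : wedge σ e (V a) = 0 :=
      IsLocalMin.hasDerivAt_eq_zero (Eventually.of_forall fun v => by
        rw [ha.2.1]; exact hch u v) (hhd a)
    have hVa := eq_smul_of_wedge_eq_zero hσ (h0 u) hla
    set c := inner ℝ e (V a) / ‖e‖ ^ 2 with hc
    have hc0 : 0 < c := by
      obtain ⟨v, hv⟩ := hnc
      have hv' : 0 < wedge σ e (γ v - γ u) := lt_of_le_of_ne (hch u v) (Ne.symm hv)
      have h1 := hch a v
      have h2 : γ v - γ a = (γ v - γ u) - (γ a - γ u) := by abel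
      have h3 : wedge σ e (γ a - γ u) = 0 := ha.2.1
      rw [hVa, wedge_smul_left, h2, wedge_sub_right, h3, sub_zero] at h1
      have h4 : 0 ≤ c := nonneg_of_mul_nonneg_left h1 hv'
      refine lt_of_le_of_ne h4 fun h5 => h0 a ?_
      rw [hVa, ← h5, zero_smul]
    have hpa' : 0 < inner ℝ e (V a) := by
      rw [hVa, inner_smul_right, real_inner_self_eq_norm_sq]; positivity
    have hev : ∀ᶠ v in 𝓝 a, 0 < inner ℝ e (V v) ∧ p v < inner ℝ e (y - γ u) :=
      ((continuous_const.inner hV).continuousAt.eventually (lt_mem_nhds hpa')).and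
        (hpc.continuousAt.eventually (gt_mem_nhds hpa))
    obtain ⟨δ, hδ, hball⟩ := Metric.eventually_nhds_iff.1 hev
    have hI : ∀ v ∈ Icc a (a + δ / 2), 0 < inner ℝ e (V v) ∧ p v < inner ℝ e (y - γ u) := by
      intro v hv
      apply hball
      rw [Real.dist_eq, abs_of_nonneg (by linarith [hv.1])]
      linarith [hv.2]
    have hanti : AntitoneOn h (Icc a (a + δ / 2)) := by
      refine antitoneOn_of_hasDerivWithinAt_nonpos (convex_Icc _ _) hhc.continuousOn
        (fun x _ => (hhd x).hasDerivWithinAt) fun v hv => ?_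
      obtain ⟨h1, h2⟩ := hI v (interior_subset hv)
      have h3 := norm_sq_mul_wedge (σ := σ) e (V v) (y - γ v)
      have h4 : y - γ v = (y - γ u) - (γ v - γ u) := by abel
      have h5 : wedge σ e (y - γ v) = -h v := by rw [h4, wedge_sub_right, hu, zero_sub]
      have h6 : inner ℝ e (y - γ v) = inner ℝ e (y - γ u) - p v := by rw [h4, inner_sub_right]
      rw [h5, h6] at h3
      have h7 : 0 ≤ ‖e‖ ^ 2 * wedge σ (V v) (y - γ v) := mul_nonneg (sq_nonneg _) (hy v)
      have h8 : 0 ≤ h v := hch u v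
      have h9 : wedge σ e (V v) * (inner ℝ e (y - γ u) - p v) ≤ 0 := by nlinarith
      by_contra hcon
      have := mul_pos (not_le.1 hcon) (sub_pos.2 h2)
      linarith
    have hmono : StrictMonoOn p (Icc a (a + δ / 2)) :=
      strictMonoOn_of_deriv_pos (convex_Icc _ _) hpc.continuousOn fun v hv => by
        rw [(hpd v).deriv]; exact (hI v (interior_subset hv)).1
    have m1 : a ∈ Icc a (a + δ / 2) := ⟨le_rfl, by linarith⟩
    have m2 : a + δ / 2 ∈ Icc a (a + δ / 2) := ⟨by linarith, le_rfl⟩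
    have h1 : h (a + δ / 2) = 0 :=
      le_antisymm ((hanti m1 m2 (by linarith)).trans ha.2.1.le) (hch u _)
    have h2 := hmax' _ h1 (hI _ m2).2.le
    have h3 := hmono m1 m2 (by linarith)
    linarith

/-- A point on the tangent at `u` that lies on the inner side of all tangents is a point of the
curve. -/
theorem exists_eq_of_mem_tangent (hσ : σ ≠ 0) (hγ : ∀ x, HasDerivAt γ (V x) x)
    (hV : Continuous V) (h0 : ∀ x, V x ≠ 0) (hp : Function.Periodic γ 1)
    (hch : ∀ u v, 0 ≤ wedge σ (V u) (γ v - γ u)) {y : Plane}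
    (hy : ∀ v, 0 ≤ wedge σ (V v) (y - γ v)) {u : ℝ}
    (hnc : ∃ v, wedge σ (V u) (γ v - γ u) ≠ 0) (hu : wedge σ (V u) (y - γ u) = 0) :
    ∃ a, γ a = y := by
  rcases le_total 0 (inner ℝ (V u) (y - γ u)) with h | h
  · exact exists_eq_of_mem_tangent_ahead hσ hγ hV h0 hp hch hy hnc hu h
  · -- reverse the direction of the curve together with the orientation
    have key : ∀ a b : Plane, wedge (-σ) (-a) b = wedge σ a b := fun a b => by
      rw [wedge_neg_left, wedge_neg_sign, neg_neg]
    obtain ⟨a, ha⟩ := exists_eq_of_mem_tangent_ahead (σ := -σ) (γ := fun x => γ (-x))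
      (V := fun x => -V (-x)) (u := -u) (y := y) (neg_ne_zero.2 hσ)
      (fun x => by
        have := (hγ (-x)).scomp x (hasDerivAt_neg x)
        rw [neg_smul, one_smul] at this
        exact this)
      (hV.comp continuous_neg).neg (fun x => neg_ne_zero.2 (h0 _))
      (fun x => by
        have := hp (-(x + 1))
        simp only
        rw [← this]
        congr 1
        ring)
      (fun a b => by rw [key]; exact hch _ _) (fun v => by rw [key]; exact hy _)
      (by
        obtain ⟨v, hv⟩ := hnc
        exact ⟨-v, by rw [key, neg_neg, neg_neg]; exact hv⟩)
      (by rw [key, neg_neg]; exact hu)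
      (by rw [neg_neg, inner_neg_left]; linarith)
    exact ⟨-a, ha⟩

end Support

/-- A curve that lies on the inner side of all its tangents bounds the intersection of the
corresponding half planes. -/
theorem ChordCondition.boundsConvexSet {n : ℕ} {σ : ℝ} {γ : CkLoop (n + 1)} (hσ : σ ≠ 0)
    (h : ChordCondition σ γ) (him : IsImmersed γ) : BoundsConvexSet γ := by
  set K : Set Plane := ⋂ q, {y | 0 ≤ wedge σ (γ.jet 1 q) (y - γ.jet 0 q)} with hK
  have hmem : ∀ y, y ∈ K ↔ ∀ q, 0 ≤ wedge σ (γ.jet 1 q) (y - γ.jet 0 q) := fun y => mem_iInter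
  have hKc : IsClosed K := isClosed_iInter fun q => isClosed_le continuous_const
    (Continuous.wedge continuous_const (continuous_id.sub continuous_const))
  refine ⟨K, ?_, ?_⟩
  · intro x hx y hy a b ha hb hab
    rw [hmem] at hx hy ⊢
    intro q
    have e : a • x + b • y - γ.jet 0 q = a • (x - γ.jet 0 q) + b • (y - γ.jet 0 q) := by
      have : γ.jet 0 q = (a + b) • γ.jet 0 q := by rw [hab, one_smul]
      nth_rewrite 1 [this]
      module
    rw [e, wedge_add_right, wedge_smul_right, wedge_smul_right]
    exact add_nonneg (mul_nonneg ha (hx q)) (mul_nonneg hb (hy q))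
  · rw [hKc.frontier_eq]
    apply Subset.antisymm
    · rintro y ⟨hyK, hyI⟩
      have hyK' := (hmem y).1 hyK
      have hex : ∃ q, wedge σ (γ.jet 1 q) (y - γ.jet 0 q) = 0 := by
        by_contra! hne
        apply hyI
        -- the distance to the tangents is positive on the compact circle
        have hpos : ∀ q, 0 < wedge σ (γ.jet 1 q) (y - γ.jet 0 q) := fun q =>
          lt_of_le_of_ne (hyK' q) (hne q).symm
        have hjoint : Continuous fun z : Plane × UnitAddCircle =>
            wedge σ (γ.jet 1 z.2) (z.1 - γ.jet 0 z.2) :=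
          Continuous.wedge (by fun_prop) (by fun_prop)
        have := (isCompact_univ (X := UnitAddCircle)).eventually_forall_of_forall_eventually
          (x₀ := y) (P := fun z q => 0 < wedge σ (γ.jet 1 q) (z - γ.jet 0 q)) fun q _ => by
            exact hjoint.continuousAt.eventually (lt_mem_nhds (hpos q))
        rw [mem_interior_iff_mem_nhds]
        filter_upwards [this] with z hz
        exact (hmem z).2 fun q => (hz q (mem_univ q)).le
      obtain ⟨q, hq⟩ := hex
      obtain ⟨v, hv⟩ := exists_wedge_chord_ne_zero hσ him q
      obtain ⟨u, -, rfl⟩ := exists_coe_eq q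
      obtain ⟨w, -, rfl⟩ := exists_coe_eq v
      obtain ⟨a, ha⟩ := exists_eq_of_mem_tangent hσ γ.hasDerivAt_jet_zero
        (loop_comp_continuous (γ.jet 1)) (fun x => him _) (loop_periodic (γ.jet 0))
        (fun u v => h _ _) (fun v => hyK' _) ⟨w, hv⟩ hq
      exact ⟨_, ha⟩
    · rintro _ ⟨q, rfl⟩
      refine ⟨(hmem _).2 fun p => h p q, fun hint => ?_⟩
      obtain ⟨b, hb⟩ := exists_wedge_neg hσ (him q)
      rw [mem_interior_iff_mem_nhds] at hint
      have hc : Continuous fun s : ℝ => γ.jet 0 q + s • b := by fun_prop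
      have h1 : ∀ᶠ s in 𝓝 (0 : ℝ), γ.jet 0 q + s • b ∈ K :=
        hc.continuousAt.eventually (by simpa using hint)
      obtain ⟨s, hs, hs0⟩ := ((h1.filter_mono nhdsWithin_le_nhds).and
        (self_mem_nhdsWithin (s := Ioi (0 : ℝ)))).exists
      have h2 := (hmem _).1 hs q
      rw [add_sub_cancel_left, wedge_smul_right] at h2
      have := mul_neg_of_pos_of_neg (show 0 < s from hs0) hb
      linarith

/-! ### Boundaries of strictly convex domains -/

/-- The curve meets each of its tangents only in the point of contact. -/
def IsStrictChord {n : ℕ} (σ : ℝ) (γ : CkLoop (n + 1)) : Prop :=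
  ∀ u v, wedge σ (γ.jet 1 u) (γ.jet 0 v - γ.jet 0 u) = 0 → γ.jet 0 v = γ.jet 0 u

/-- The curvature of a curve on the inner side of its tangents is nonnegative. -/
theorem ChordCondition.wedge_nonneg {σ : ℝ} {γ : CkLoop 2} (h : ChordCondition σ γ)
    (q : UnitAddCircle) : 0 ≤ wedge σ (γ.jet 1 q) (γ.jet 2 q) := by
  obtain ⟨u, -, rfl⟩ := exists_coe_eq q
  set e := γ.jet 1 (u : UnitAddCircle)
  set f : ℝ → ℝ := fun v => -wedge σ e (γ.jet 0 (v : UnitAddCircle) - γ.jet 0 (u : UnitAddCircle))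
    with hf
  have h1 : ∀ x : ℝ, HasDerivAt f (-wedge σ e (γ.jet 1 (x : UnitAddCircle))) x := fun x =>
    (hasDerivAt_wedge_const e ((γ.hasDerivAt_jet_zero x).sub_const _)).neg
  have h2 : ∀ x : ℝ, HasDerivAt (fun y : ℝ => -wedge σ e (γ.jet 1 (y : UnitAddCircle)))
      (-wedge σ e (γ.jet 2 (x : UnitAddCircle))) x := fun x =>
    (hasDerivAt_wedge_const e (γ.hasDerivAt_jet_one x)).neg
  have e1 : deriv f = fun x : ℝ => -wedge σ e (γ.jet 1 (x : UnitAddCircle)) :=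
    funext fun x => (h1 x).deriv
  have fu : f u = 0 := by simp [hf, wedge]
  by_contra hneg
  rw [not_le] at hneg
  have hmin : IsLocalMin f u := by
    apply isLocalMin_of_deriv_deriv_pos
    · rw [e1, (h2 u).deriv]
      linarith
    · rw [e1]
      simp only [e, wedge_self, neg_zero]
    · exact (h1 u).continuousAt
  -- a function with a maximum and a local minimum at the same point is constant nearby
  have hev : f =ᶠ[𝓝 u] fun _ => 0 := by
    filter_upwards [hmin] with x hx
    rw [fu] at hx
    exact le_antisymm (neg_nonpos.2 (h _ _)) hx
  have h3 : deriv (deriv f) u = 0 := by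
    rw [hev.deriv.deriv_eq]
    simp
  rw [e1, (h2 u).deriv] at h3
  linarith

theorem exists_eq_mul_wedge_of_apply_eq_zero {f : Plane →L[ℝ] ℝ} {e : Plane} (he : e ≠ 0)
    (hf : f e = 0) : ∃ c : ℝ, ∀ b, f b = c * wedge 1 e b := by
  refine ⟨f !₂[-e 1, e 0] / ‖e‖ ^ 2, fun b => ?_⟩
  have hn : ‖e‖ ^ 2 ≠ 0 := pow_ne_zero 2 (norm_ne_zero_iff.2 he)
  have key : ‖e‖ ^ 2 • b = inner ℝ e b • e + wedge 1 e b • !₂[-e 1, e 0] := by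
    rw [plane_norm_sq, plane_inner]
    apply plane_ext
    · simp [wedge]; ring
    · simp [wedge]; ring
  have h := congrArg f key
  rw [map_smul, map_add, map_smul, map_smul, hf, smul_zero, zero_add, smul_eq_mul,
    smul_eq_mul] at h
  rw [div_mul_eq_mul_div, eq_div_iff hn]
  linarith

/-- An immersed boundary of a strictly convex domain lies on one side of its tangents, with the
same orientation everywhere, and meets them only in the point of contact. -/
theorem BoundsStrictlyConvexDomain.exists_chordCondition {n : ℕ} {γ : CkLoop (n + 1)}
    (h : BoundsStrictlyConvexDomain γ) (him : IsImmersed γ) :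
    ∃ σ : ℝ, (σ = 1 ∨ σ = -1) ∧ ChordCondition σ γ ∧ IsStrictChord σ γ := by
  obtain ⟨Ω, hΩo, ⟨y₀, hy₀⟩, hΩc, hΩs, hfr⟩ := h
  have hcl : ∀ q, γ.jet 0 q ∈ closure Ω := fun q =>
    frontier_subset_closure (hfr ▸ mem_range_self q)
  have hsupp : ∀ q, wedge 1 (γ.jet 1 q) (y₀ - γ.jet 0 q) ≠ 0 ∧ ∀ z ∈ closure Ω,
      0 ≤ wedge 1 (γ.jet 1 q) (y₀ - γ.jet 0 q) * wedge 1 (γ.jet 1 q) (z - γ.jet 0 q) := by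
    intro q
    have hq : γ.jet 0 q ∉ Ω := by
      have : γ.jet 0 q ∈ frontier Ω := hfr ▸ mem_range_self q
      rw [hΩo.frontier_eq] at this
      exact this.2
    obtain ⟨f, hf⟩ := geometric_hahn_banach_open_point hΩc hΩo hq
    have hfc : ∀ z ∈ closure Ω, f z ≤ f (γ.jet 0 q) := fun z hz =>
      closure_minimal (fun a ha => (hf a ha).le) (isClosed_le f.continuous continuous_const) hz
    have hfd : f (γ.jet 1 q) = 0 := by
      obtain ⟨u, -, rfl⟩ := exists_coe_eq q
      have h1 : HasDerivAt (fun v : ℝ => f (γ.jet 0 (v : UnitAddCircle)))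
          (f (γ.jet 1 (u : UnitAddCircle))) u :=
        f.hasFDerivAt.comp_hasDerivAt u (γ.hasDerivAt_jet_zero u)
      have h2 : IsLocalMax (fun v : ℝ => f (γ.jet 0 (v : UnitAddCircle))) u :=
        Eventually.of_forall fun v => hfc _ (hcl _)
      exact h2.hasDerivAt_eq_zero h1
    -- the supporting line at a point of the curve is its tangent
    obtain ⟨c, hc⟩ := exists_eq_mul_wedge_of_apply_eq_zero (him q) hfd
    have h1 : c * wedge 1 (γ.jet 1 q) (y₀ - γ.jet 0 q) < 0 := by
      rw [← hc, map_sub]; linarith [hf y₀ hy₀]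
    refine ⟨fun h0 => by rw [h0, mul_zero] at h1; exact lt_irrefl _ h1, fun z hz => ?_⟩
    have h2 : c * wedge 1 (γ.jet 1 q) (z - γ.jet 0 q) ≤ 0 := by
      rw [← hc, map_sub]; linarith [hfc z hz]
    have h3 : c ≠ 0 := fun h0 => by rw [h0, zero_mul] at h1; exact lt_irrefl _ h1
    have h4 := mul_nonneg_of_nonpos_of_nonpos h1.le h2
    have h5 : c * wedge 1 (γ.jet 1 q) (y₀ - γ.jet 0 q) * (c * wedge 1 (γ.jet 1 q) (z - γ.jet 0 q)) =
        c ^ 2 * (wedge 1 (γ.jet 1 q) (y₀ - γ.jet 0 q) * wedge 1 (γ.jet 1 q) (z - γ.jet 0 q)) := by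
      ring
    rw [h5] at h4
    exact nonneg_of_mul_nonneg_right h4 (by positivity)
  have hcont : Continuous fun x : ℝ => wedge 1 (γ.jet 1 (x : UnitAddCircle))
      (y₀ - γ.jet 0 (x : UnitAddCircle)) :=
    Continuous.wedge (loop_comp_continuous (γ.jet 1))
      (continuous_const.sub (loop_comp_continuous (γ.jet 0)))
  have hno : ¬ ∃ x : ℝ,
      wedge 1 (γ.jet 1 (x : UnitAddCircle)) (y₀ - γ.jet 0 (x : UnitAddCircle)) = 0 :=
    fun ⟨x, hx⟩ => (hsupp _).1 hx
  have hside : ∃ σ : ℝ, (σ = 1 ∨ σ = -1) ∧ ∀ q, ∀ z ∈ closure Ω,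
      0 ≤ wedge σ (γ.jet 1 q) (z - γ.jet 0 q) := by
    have e : ∀ σ : ℝ, ∀ a b, wedge σ a b = σ * wedge 1 a b := fun σ a b => by
      simp only [wedge]; ring
    by_cases hpos : ∀ x : ℝ, 0 < wedge 1 (γ.jet 1 (x : UnitAddCircle))
        (y₀ - γ.jet 0 (x : UnitAddCircle))
    · refine ⟨1, Or.inl rfl, fun q z hz => ?_⟩
      obtain ⟨u, -, rfl⟩ := exists_coe_eq q
      exact nonneg_of_mul_nonneg_right ((hsupp _).2 z hz) (hpos u)
    · obtain ⟨x, hx⟩ := not_forall.1 hpos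
      refine ⟨-1, Or.inr rfl, fun q z hz => ?_⟩
      obtain ⟨u, -, rfl⟩ := exists_coe_eq q
      have hneg : wedge 1 (γ.jet 1 (u : UnitAddCircle)) (y₀ - γ.jet 0 (u : UnitAddCircle)) < 0 := by
        by_contra hcon
        exact hno (mem_range_of_exists_le_of_exists_ge hcont ⟨x, not_lt.1 hx⟩ ⟨u, not_lt.1 hcon⟩)
      rw [e, neg_one_mul]
      exact neg_nonneg.2 (nonpos_of_mul_nonneg_right ((hsupp _).2 z hz) hneg)
  obtain ⟨σ, hσ, hside⟩ := hside
  refine ⟨σ, hσ, fun u v => hside u _ (hcl v), fun u v huv => ?_⟩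
  have hσ0 : σ ≠ 0 := by rcases hσ with rfl | rfl <;> norm_num
  by_contra hne
  -- the midpoint of a chord on the tangent would be an interior point on a supporting line
  have hmid := hΩs (hcl v) (hcl u) hne (a := 1 / 2) (b := 1 / 2) (by norm_num) (by norm_num)
    (by norm_num)
  obtain ⟨b, hb⟩ := exists_wedge_neg hσ0 (him u)
  have hc : Continuous fun s : ℝ =>
      ((1 / 2 : ℝ) • γ.jet 0 v + (1 / 2 : ℝ) • γ.jet 0 u) + s • b := by
    fun_prop
  rw [mem_interior_iff_mem_nhds] at hmid
  have h1 : ∀ᶠ s in 𝓝 (0 : ℝ),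
      ((1 / 2 : ℝ) • γ.jet 0 v + (1 / 2 : ℝ) • γ.jet 0 u) + s • b ∈ closure Ω :=
    hc.continuousAt.eventually (by simpa using hmid)
  obtain ⟨s, hs, hs0⟩ := ((h1.filter_mono nhdsWithin_le_nhds).and
    (self_mem_nhdsWithin (s := Ioi (0 : ℝ)))).exists
  have h2 := hside u _ hs
  have e : ((1 / 2 : ℝ) • γ.jet 0 v + (1 / 2 : ℝ) • γ.jet 0 u) + s • b - γ.jet 0 u =
      (1 / 2 : ℝ) • (γ.jet 0 v - γ.jet 0 u) + s • b := by module
  rw [e, wedge_add_right, wedge_smul_right, wedge_smul_right, huv, mul_zero, zero_add] at h2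
  have := mul_neg_of_pos_of_neg (show 0 < s from hs0) hb
  linarith

/-! ### Deck transformations of a convex curve -/

/-- The lift to the line of an orientation preserving diffeomorphism of the circle, together with
its derivative. -/
structure IsCircleDiffeo (τ τ' : ℝ → ℝ) : Prop where
  hasDerivAt : ∀ x, HasDerivAt τ (τ' x) x
  continuous_deriv : Continuous τ'
  pos : ∀ x, 0 < τ' x
  map_add_one : ∀ x, τ (x + 1) = τ x + 1

theorem toC_injective {σ : ℝ} (hσ : σ ≠ 0) : Function.Injective (toC σ) := fun _ _ h =>
  plane_ext (congrArg Complex.re h) (mul_left_cancel₀ hσ (congrArg Complex.im h))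

section Deck

variable {σ : ℝ} {γ : CkLoop 2}

/-- The turning angle of a curve from the parameter `u` to `v`. -/
def turning (σ : ℝ) (γ : CkLoop 2) (u v : ℝ) : ℝ :=
  (logRatio σ (fun x : ℝ => γ.jet 1 (x : UnitAddCircle))
    (fun x : ℝ => γ.jet 2 (x : UnitAddCircle)) u v).im

theorem turning_add (hσ : σ ≠ 0) (him : IsImmersed γ) (u v w : ℝ) :
    turning σ γ u v + turning σ γ v w = turning σ γ u w := by
  rw [turning, turning, turning, ← logRatio_add hσ (loop_comp_continuous (γ.jet 1))
    (loop_comp_continuous (γ.jet 2)) (fun x => him _) u v w, Complex.add_im]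

theorem turning_nonneg (hσ : σ ≠ 0) (him : IsImmersed γ)
    (hk : ∀ q, 0 ≤ wedge σ (γ.jet 1 q) (γ.jet 2 q)) {u v : ℝ} (huv : u ≤ v) :
    0 ≤ turning σ γ u v :=
  logRatio_im_nonneg hσ (loop_comp_continuous (γ.jet 1)) (loop_comp_continuous (γ.jet 2))
    (fun _ => him _) (fun _ => hk _) huv

theorem turning_continuous (hσ : σ ≠ 0) (him : IsImmersed γ) (u : ℝ) :
    Continuous (turning σ γ u) := by
  have hq := logDeriv_continuous hσ (loop_comp_continuous (γ.jet 1))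
    (loop_comp_continuous (γ.jet 2)) (fun x => him _)
  exact Complex.continuous_im.comp
    (intervalIntegral.continuous_primitive (fun a b => hq.intervalIntegrable a b) u)

theorem turning_add_one (u v : ℝ) : turning σ γ (u + 1) (v + 1) = turning σ γ u v := by
  rw [turning, turning, logRatio, logRatio, ← intervalIntegral.integral_comp_add_right _ 1]
  congr 2
  ext1 x
  rw [AddCircle.coe_add, AddCircle.coe_period, add_zero]

/-- Points at which the curve points into the same direction have positive multiples as
velocities. -/
theorem exists_pos_smul_of_turning (hσ : σ ≠ 0) (him : IsImmersed γ) {u v : ℝ} {j : ℤ}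
    (h : turning σ γ u v = j * (2 * Real.pi)) :
    ∃ c : ℝ, 0 < c ∧ γ.jet 1 (v : UnitAddCircle) = c • γ.jet 1 (u : UnitAddCircle) := by
  have h1 := toC_eq_mul_exp hσ γ.hasDerivAt_jet_one (loop_comp_continuous (γ.jet 2))
    (fun x => him _) u v
  refine ⟨Real.exp (logRatio σ (fun x : ℝ => γ.jet 1 (x : UnitAddCircle))
    (fun x : ℝ => γ.jet 2 (x : UnitAddCircle)) u v).re, Real.exp_pos _,
    toC_injective hσ (h1.trans ?_)⟩
  rw [toC_smul, mul_comm]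
  congr 1
  have h2 : (logRatio σ (fun x : ℝ => γ.jet 1 (x : UnitAddCircle))
    (fun x : ℝ => γ.jet 2 (x : UnitAddCircle)) u v).im = j * (2 * Real.pi) := h
  apply Complex.ext
  · rw [Complex.exp_re, h2, Real.cos_int_mul_two_pi, mul_one, Complex.ofReal_re]
  · have : Real.sin (j * (2 * Real.pi)) = 0 := by
      have := Real.sin_int_mul_pi (2 * j)
      push_cast at this
      rw [← this]
      congr 1
      ring
    rw [Complex.exp_im, h2, this, mul_zero, Complex.ofReal_im]

/-- On a strictly convex curve the direction of the tangent determines the point. -/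
theorem jet_zero_eq_of_turning (hσ : σ ≠ 0) (him : IsImmersed γ) (hch : ChordCondition σ γ)
    (hst : IsStrictChord σ γ) {u v : ℝ} {j : ℤ} (h : turning σ γ u v = j * (2 * Real.pi)) :
    γ.jet 0 (v : UnitAddCircle) = γ.jet 0 (u : UnitAddCircle) := by
  obtain ⟨c, hc, hV⟩ := exists_pos_smul_of_turning hσ him h
  have h1 := hch (u : UnitAddCircle) (v : UnitAddCircle)
  have h2 := hch (v : UnitAddCircle) (u : UnitAddCircle)
  have e : γ.jet 0 (u : UnitAddCircle) - γ.jet 0 (v : UnitAddCircle) =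
      (-1 : ℝ) • (γ.jet 0 (v : UnitAddCircle) - γ.jet 0 (u : UnitAddCircle)) := by module
  rw [hV, wedge_smul_left, e, wedge_smul_right] at h2
  have h3 := nonneg_of_mul_nonneg_right h2 hc
  exact hst _ _ (le_antisymm (by linarith) h1)

/-- The turning angle of a strictly convex curve is strictly monotone although its curvature may
vanish at some points. -/
theorem turning_strictMono (hσ : σ ≠ 0) (him : IsImmersed γ) (hch : ChordCondition σ γ)
    (hst : IsStrictChord σ γ) (u : ℝ) : StrictMono (turning σ γ u) := by
  have hk := hch.wedge_nonneg
  have hm : ∀ a b, a ≤ b → turning σ γ u a ≤ turning σ γ u b := fun a b hab => by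
    rw [← turning_add hσ him u a b]
    linarith [turning_nonneg hσ him hk hab]
  intro a b hab
  refine lt_of_le_of_ne (hm a b hab.le) fun heq => ?_
  -- otherwise the curve would be constant between `a` and `b`
  have hconst : ∀ x ∈ Icc a b, γ.jet 0 (x : UnitAddCircle) = γ.jet 0 (a : UnitAddCircle) := by
    intro x hx
    refine jet_zero_eq_of_turning (j := 0) hσ him hch hst ?_
    have h1 := hm a x hx.1
    have h2 := hm x b hx.2
    have h3 := turning_add hσ him u a x
    push_cast
    linarith
  have h1 := (γ.hasDerivAt_jet_zero a).hasDerivWithinAt (s := Icc a b)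
  have h2 := (hasDerivWithinAt_const a (Icc a b) (γ.jet 0 (a : UnitAddCircle))).congr hconst rfl
  exact him _ ((uniqueDiffOn_Icc hab a ⟨le_rfl, hab.le⟩).eq_deriv _ h1 h2)

/-- The turning angle grows by the same positive amount in each period. -/
theorem turning_surjective (hσ : σ ≠ 0) (him : IsImmersed γ) (hch : ChordCondition σ γ)
    (hst : IsStrictChord σ γ) : Function.Surjective (turning σ γ 0) := by
  have hs := turning_strictMono hσ him hch hst 0
  have h00 : turning σ γ 0 0 = 0 := by
    have := turning_add hσ him 0 0 0
    linarith
  have hc : 0 < turning σ γ 0 1 := by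
    have := hs zero_lt_one
    rwa [h00] at this
  have hadd : ∀ x, turning σ γ 0 (x + 1) = turning σ γ 0 1 + turning σ γ 0 x := fun x => by
    rw [← turning_add hσ him 0 1 (x + 1), ← turning_add_one (σ := σ) (γ := γ) 0 x, zero_add]
  have hnat : ∀ n : ℕ, turning σ γ 0 n = n * turning σ γ 0 1 := by
    intro n
    induction n with
    | zero => simpa using h00
    | succ n ih => rw [Nat.cast_succ, hadd, ih]; ring
  have hneg : ∀ n : ℕ, turning σ γ 0 (-n) = -(n * turning σ γ 0 1) := by
    intro n
    induction n with
    | zero => simpa using h00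
    | succ n ih =>
      have := hadd (-(n + 1 : ℕ))
      have e : -((n + 1 : ℕ) : ℝ) + 1 = -n := by push_cast; ring
      rw [e, ih] at this
      push_cast at this ⊢
      linarith
  refine Continuous.surjective (turning_continuous hσ him 0) ?_ ?_
  · refine hs.monotone.tendsto_atTop_atTop fun b => ?_
    obtain ⟨n, hn⟩ := exists_nat_ge (b / turning σ γ 0 1)
    exact ⟨n, by rw [hnat, ← div_le_iff₀ hc]; exact hn⟩
  · refine hs.monotone.tendsto_atBot_atBot fun b => ?_
    obtain ⟨n, hn⟩ := exists_nat_ge (-b / turning σ γ 0 1)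
    refine ⟨-n, ?_⟩
    rw [div_le_iff₀ hc] at hn
    rw [hneg]
    linarith

/-- A continuous change of parameter that leaves an immersed curve invariant and preserves the
direction of the velocity is differentiable. -/
theorem hasDerivAt_of_invariant {γ V : ℝ → Plane} (hγ : ∀ x, HasDerivAt γ (V x) x)
    (hV : Continuous V) (h0 : ∀ x, V x ≠ 0) {τ : ℝ → ℝ} (hτ : Continuous τ)
    (hinv : ∀ x, γ (τ x) = γ x) {x c : ℝ} (hc : V (τ x) = c • V x) :
    HasDerivAt τ c⁻¹ x := by
  have hpd : ∀ s, HasDerivAt (fun s => inner ℝ (V (τ x)) (γ s)) (inner ℝ (V (τ x)) (V s)) s :=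
    fun s => (innerSL ℝ (V (τ x))).hasFDerivAt.comp_hasDerivAt s (hγ s)
  have hstrict : HasStrictDerivAt (fun s => inner ℝ (V (τ x)) (γ s))
      (inner ℝ (V (τ x)) (V (τ x))) (τ x) :=
    hasStrictDerivAt_of_hasDerivAt_of_continuousAt (Eventually.of_forall hpd)
      (continuous_const.inner hV).continuousAt
  have hne : inner ℝ (V (τ x)) (V (τ x)) ≠ 0 := by
    rw [real_inner_self_eq_norm_sq]
    exact pow_ne_zero 2 (norm_ne_zero_iff.2 (h0 _))
  have h1 := (hstrict.to_localInverse hne).hasDerivAt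
  have e1 : inner ℝ (V (τ x)) (γ (τ x)) = inner ℝ (V (τ x)) (γ x) := by rw [hinv]
  rw [e1] at h1
  have h2 := h1.comp x (hpd x)
  have h3 : τ =ᶠ[𝓝 x] fun s => hstrict.localInverse _ _ _ hne (inner ℝ (V (τ x)) (γ s)) := by
    filter_upwards [hτ.continuousAt.eventually (hstrict.eventually_left_inverse hne)] with s hs
    rw [← hinv s]
    exact hs.symm
  refine (h2.congr_of_eventuallyEq h3).congr_deriv ?_
  have hc0 : c ≠ 0 := fun hc0 => h0 (τ x) (by rw [hc, hc0, zero_smul])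
  have hx : inner ℝ (V x) (V x) ≠ 0 := by
    rw [real_inner_self_eq_norm_sq]
    exact pow_ne_zero 2 (norm_ne_zero_iff.2 (h0 _))
  rw [hc, real_inner_smul_left, real_inner_smul_left, real_inner_smul_right]
  field_simp

/-- A strictly convex curve may traverse its image several times; moving each point ahead by a
number of full turns leaves the curve invariant. -/
theorem exists_deck (hσ : σ ≠ 0) (him : IsImmersed γ) (hch : ChordCondition σ γ)
    (hst : IsStrictChord σ γ) : ∃ τ τ' : ℤ → ℝ → ℝ, (∀ j, IsCircleDiffeo (τ j) (τ' j)) ∧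
      (∀ j (x : ℝ), γ.jet 0 (τ j x : UnitAddCircle) = γ.jet 0 (x : UnitAddCircle)) ∧
      (∀ u v, ∃ j, τ j v ∈ Icc u (τ 1 u)) ∧ ∀ u, turning σ γ u (τ 1 u) = 2 * Real.pi := by
  have hs := turning_strictMono hσ him hch hst 0
  set e := hs.orderIsoOfSurjective _ (turning_surjective hσ him hch hst) with he
  have hea : ∀ x, e x = turning σ γ 0 x := fun _ => rfl
  -- the point whose turning angle is larger by `j` full turns
  set τ : ℤ → ℝ → ℝ := fun j x => e.symm (turning σ γ 0 x + j * (2 * Real.pi)) with hτ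
  have hΘ : ∀ j x, turning σ γ 0 (τ j x) = turning σ γ 0 x + j * (2 * Real.pi) := fun j x => by
    rw [← hea]; exact e.apply_symm_apply _
  have hturn : ∀ j x, turning σ γ x (τ j x) = j * (2 * Real.pi) := fun j x => by
    have := turning_add hσ him 0 x (τ j x)
    rw [hΘ] at this
    linarith
  have hinv : ∀ j (x : ℝ), γ.jet 0 (τ j x : UnitAddCircle) = γ.jet 0 (x : UnitAddCircle) :=
    fun j x => jet_zero_eq_of_turning hσ him hch hst (hturn j x)
  have hcont : ∀ j, Continuous (τ j) := fun j =>
    e.symm.continuous.comp ((turning_continuous hσ him 0).add continuous_const)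
  choose c hc0 hc using fun j x => exists_pos_smul_of_turning hσ him (hturn j x)
  have hd : ∀ j x, HasDerivAt (τ j) (c j x)⁻¹ x := fun j x =>
    hasDerivAt_of_invariant γ.hasDerivAt_jet_zero (loop_comp_continuous (γ.jet 1)) (fun x => him _)
      (hcont j) (hinv j) (hc j x)
  -- the derivative is a ratio of speeds, hence continuous
  have hcform : ∀ j x, (c j x)⁻¹ = ‖γ.jet 1 (x : UnitAddCircle)‖ /
      ‖γ.jet 1 (τ j x : UnitAddCircle)‖ := fun j x => by
    have : 0 < ‖γ.jet 1 (x : UnitAddCircle)‖ := norm_pos_iff.2 (him _)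
    have := hc0 j x
    rw [hc, norm_smul, Real.norm_of_nonneg (hc0 j x).le]
    field_simp
  refine ⟨τ, fun j x => (c j x)⁻¹, fun j => ⟨hd j, ?_, fun x => inv_pos.2 (hc0 j x), fun x => ?_⟩,
    hinv, fun u v => ?_, fun u => ?_⟩
  · simp only [hcform]
    exact (loop_comp_continuous (γ.jet 1)).norm.div
      ((loop_comp_continuous (γ.jet 1)).comp (hcont j)).norm fun x => norm_ne_zero_iff.2 (him _)
  · apply hs.injective
    have h1 := turning_add hσ him 0 x (x + 1)
    have h2 := turning_add hσ him 0 (τ j x) (τ j x + 1)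
    have h3 := turning_add hσ him x (τ j x) (τ j x + 1)
    have h4 := turning_add hσ him x (x + 1) (τ j x + 1)
    rw [turning_add_one] at h4
    rw [hΘ, ← h2, hΘ, ← h1]
    linarith
  · obtain ⟨j, hj, -⟩ := existsUnique_add_zsmul_mem_Ico Real.two_pi_pos (turning σ γ 0 v)
      (turning σ γ 0 u)
    rw [zsmul_eq_mul, ← hΘ] at hj
    refine ⟨j, hs.le_iff_le.1 hj.1, hs.le_iff_le.1 (hj.2.le.trans ?_)⟩
    rw [hΘ]
    push_cast
    linarith
  · rw [hturn]
    push_cast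
    ring

end Deck

/-! ### Invariance under changes of parameter -/

theorem shiftConv_periodic {V w : ℝ → Plane} {lam : ℝ} (hV : Continuous V)
    (hp : Function.Periodic V 1) (hL : 0 < length V) (hwp : Function.Periodic w 1) :
    Function.Periodic (shiftConv lam V w) 1 := by
  intro u
  rw [shiftConv, shiftConv, ← intervalIntegral.integral_comp_add_right _ 1]
  simp only [arc_add_one hV hp hL, hwp _, add_sub_add_right_eq_sub]

theorem CkLoop.smoothed_coe_eq_shiftConv {n : ℕ} {lam : ℝ} {γ : CkLoop (n + 1)} (hL : 0 < γ.len)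
    (x : ℝ) :
    γ.smoothed lam (x : UnitAddCircle) = shiftConv lam (fun x : ℝ => γ.jet 1 (x : UnitAddCircle))
      (fun v : ℝ => (‖γ.jet 1 (v : UnitAddCircle)‖ / γ.len) • γ.jet 0 (v : UnitAddCircle)) x := by
  have h1 := loop_periodic (γ.smoothed lam)
  have h2 := shiftConv_periodic (lam := lam) (loop_comp_continuous (γ.jet 1))
    (loop_periodic (γ.jet 1)) hL (loop_periodic fun q => (‖γ.jet 1 q‖ / γ.len) • γ.jet 0 q)
  obtain ⟨y, hy, hxy⟩ := (h1.sub h2).exists_mem_Ico₀ zero_lt_one x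
  rw [Pi.sub_apply, Pi.sub_apply, smoothed_coe_shift hL (Ico_subset_Icc_self hy), sub_self] at hxy
  exact sub_eq_zero.1 hxy

namespace CkLoop

variable {n : ℕ}

theorem jet_one_eq_of_jet_zero_eq {β γ : CkLoop (n + 1)} (h0 : β.jet 0 = γ.jet 0) :
    β.jet 1 = γ.jet 1 := by
  ext1 q
  obtain ⟨x, -, rfl⟩ := exists_coe_eq q
  have h1 := β.hasDerivAt_jet_zero x
  rw [h0] at h1
  exact h1.unique (γ.hasDerivAt_jet_zero x)

theorem ext_one {β γ : CkLoop 1} (h0 : β.jet 0 = γ.jet 0) : β = γ := by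
  apply Subtype.ext
  funext j
  fin_cases j
  · exact h0
  · exact jet_one_eq_of_jet_zero_eq h0

end CkLoop

namespace IsCircleDiffeo

variable {τ τ' : ℝ → ℝ}

theorem deriv_periodic (h : IsCircleDiffeo τ τ') : Function.Periodic τ' 1 := fun x => by
  have h1 := (h.hasDerivAt (x + 1)).comp_add_const x 1
  have h2 := (h.hasDerivAt x).add_const (1 : ℝ)
  rw [funext h.map_add_one] at h1
  exact h1.unique h2

theorem continuous (h : IsCircleDiffeo τ τ') : Continuous τ :=
  continuous_iff_continuousAt.2 fun x => (h.hasDerivAt x).continuousAt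

/-- The change of parameter as a map of the circle. -/
def circleMap (h : IsCircleDiffeo τ τ') : C(UnitAddCircle, UnitAddCircle) where
  toFun := Function.Periodic.lift (f := fun x : ℝ => (τ x : UnitAddCircle)) (c := 1) fun x => by
    simp only [h.map_add_one, AddCircle.coe_add, AddCircle.coe_period, add_zero]
  continuous_toFun := ((AddCircle.continuous_mk' 1).comp h.continuous).quotient_lift _

theorem circleMap_coe (h : IsCircleDiffeo τ τ') (x : ℝ) :
    h.circleMap (x : UnitAddCircle) = (τ x : UnitAddCircle) := rfl

/-- The derivative of the change of parameter as a function on the circle. -/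
def circleDeriv (h : IsCircleDiffeo τ τ') : C(UnitAddCircle, ℝ) where
  toFun := h.deriv_periodic.lift
  continuous_toFun := h.continuous_deriv.quotient_lift _

theorem circleDeriv_coe (h : IsCircleDiffeo τ τ') (x : ℝ) :
    h.circleDeriv (x : UnitAddCircle) = τ' x := rfl

variable {V w : ℝ → Plane} {lam : ℝ}

theorem norm_deriv_smul (h : IsCircleDiffeo τ τ') (x : ℝ) (a : Plane) :
    ‖τ' x • a‖ = τ' x * ‖a‖ := by
  rw [norm_smul, Real.norm_of_nonneg (h.pos x).le]

theorem integral_comp {E : Type*} [NormedAddCommGroup E] [NormedSpace ℝ E] [CompleteSpace E]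
    (h : IsCircleDiffeo τ τ') {g : ℝ → E} (hg : Continuous g) (a b : ℝ) :
    ∫ x in a..b, τ' x • g (τ x) = ∫ x in τ a..τ b, g x :=
  intervalIntegral.integral_deriv_smul_comp (fun x _ => h.hasDerivAt x)
    h.continuous_deriv.continuousOn hg

theorem integral_norm_comp (h : IsCircleDiffeo τ τ') (hV : Continuous V) (a b : ℝ) :
    ∫ x in a..b, ‖τ' x • V (τ x)‖ = ∫ x in τ a..τ b, ‖V x‖ := by
  rw [← h.integral_comp hV.norm]
  simp only [h.norm_deriv_smul, smul_eq_mul]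

theorem length_comp (h : IsCircleDiffeo τ τ') (hV : Continuous V) (hp : Function.Periodic V 1) :
    length (fun x => τ' x • V (τ x)) = length V := by
  have hp' : Function.Periodic (fun s => ‖V s‖) 1 := fun s => by simp only [hp s]
  have h1 := h.map_add_one 0
  rw [zero_add] at h1
  rw [length, h.integral_norm_comp hV, h1, hp'.intervalIntegral_add_eq _ 0, zero_add, length]

theorem arc_comp_sub (h : IsCircleDiffeo τ τ') (hV : Continuous V) (hp : Function.Periodic V 1)
    (u v : ℝ) : arc (fun x => τ' x • V (τ x)) v - arc (fun x => τ' x • V (τ x)) u =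
      arc V (τ v) - arc V (τ u) := by
  have hi : ∀ a b, IntervalIntegrable (fun x => ‖V x‖) volume a b := fun a b =>
    hV.norm.intervalIntegrable a b
  simp only [arc, h.length_comp hV hp, h.integral_norm_comp hV, ← sub_div]
  rw [intervalIntegral.integral_interval_sub_left (hi _ _) (hi _ _),
    intervalIntegral.integral_interval_sub_left (hi _ _) (hi _ _)]

theorem shiftConv_comp (h : IsCircleDiffeo τ τ') (hV : Continuous V) (hp : Function.Periodic V 1)
    (hw : Continuous w) (u : ℝ) :
    shiftConv lam (fun x => τ' x • V (τ x)) (fun x => τ' x • w (τ x)) u =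
      shiftConv lam V w (τ u) := by
  have hA := arc_continuous hV
  rw [shiftConv, shiftConv, ← h.map_add_one, ← h.integral_comp (by fun_prop)]
  simp only [h.arc_comp_sub hV hp]
  congr 1; ext1 v
  rw [smul_comm]

variable {n : ℕ}

/-- The change of parameter in a loop of class `C¹`. -/
def reparamFun (h : IsCircleDiffeo τ τ') (γ : CkLoop (n + 1)) : CkLoop 1 :=
  ⟨![(γ.jet 0).comp h.circleMap,
    ⟨fun q => h.circleDeriv q • γ.jet 1 (h.circleMap q), by fun_prop⟩], by
    intro j x
    fin_cases j
    exact (γ.hasDerivAt_jet_zero (τ x)).scomp x (h.hasDerivAt x)⟩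

theorem reparamFun_jet_zero (h : IsCircleDiffeo τ τ') (γ : CkLoop (n + 1)) (q : UnitAddCircle) :
    (h.reparamFun γ).jet 0 q = γ.jet 0 (h.circleMap q) := rfl

theorem reparamFun_jet_one (h : IsCircleDiffeo τ τ') (γ : CkLoop (n + 1)) (q : UnitAddCircle) :
    (h.reparamFun γ).jet 1 q = h.circleDeriv q • γ.jet 1 (h.circleMap q) := rfl

theorem norm_reparamFun_le (h : IsCircleDiffeo τ τ') (γ : CkLoop (n + 1)) :
    ‖h.reparamFun γ‖ ≤ (1 + ‖h.circleDeriv‖) * ‖γ‖ := by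
  refine CkLoop.norm_le_of_jet (by positivity) fun j => ?_
  rw [ContinuousMap.norm_le _ (by positivity)]
  intro q
  have hn := norm_nonneg γ
  have hd := norm_nonneg h.circleDeriv
  fin_cases j
  · refine (((γ.jet 0).norm_coe_le_norm (h.circleMap q)).trans (γ.norm_jet_le 0)).trans ?_
    nlinarith
  · refine (norm_smul_le (h.circleDeriv q) (γ.jet 1 (h.circleMap q))).trans ?_
    refine (mul_le_mul (h.circleDeriv.norm_coe_le_norm q)
      (((γ.jet 1).norm_coe_le_norm (h.circleMap q)).trans (γ.norm_jet_le 1)) (norm_nonneg _)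
      hd).trans ?_
    nlinarith

/-- The change of parameter as a linear map. -/
def reparamLin (n : ℕ) (h : IsCircleDiffeo τ τ') : CkLoop (n + 1) →ₗ[ℝ] CkLoop 1 where
  toFun := h.reparamFun
  map_add' _ _ := CkLoop.ext_one rfl
  map_smul' _ _ := CkLoop.ext_one rfl

/-- The change of parameter as a continuous linear map. -/
def reparam (h : IsCircleDiffeo τ τ') : CkLoop (n + 1) →L[ℝ] CkLoop 1 :=
  (h.reparamLin n).mkContinuous (1 + ‖h.circleDeriv‖) h.norm_reparamFun_le

theorem reparam_apply (h : IsCircleDiffeo τ τ') (γ : CkLoop (n + 1)) :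
    h.reparam γ = h.reparamFun γ := rfl

theorem isImmersed_reparamFun (h : IsCircleDiffeo τ τ') {γ : CkLoop (n + 1)} (hγ : IsImmersed γ) :
    IsImmersed (h.reparamFun γ) := by
  intro q
  obtain ⟨x, -, rfl⟩ := exists_coe_eq q
  rw [reparamFun_jet_one, circleDeriv_coe]
  exact smul_ne_zero (h.pos x).ne' (hγ _)

theorem smoothed_reparamFun (h : IsCircleDiffeo τ τ') {γ : CkLoop (n + 1)} (hγ : IsImmersed γ)
    (x : ℝ) : (h.reparamFun γ).smoothed lam (x : UnitAddCircle) =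
      γ.smoothed lam (τ x : UnitAddCircle) := by
  have h0 := loop_comp_continuous (γ.jet 0)
  have h1 := loop_comp_continuous (γ.jet 1)
  have hV : (fun v : ℝ => (h.reparamFun γ).jet 1 (v : UnitAddCircle)) =
      fun v : ℝ => τ' v • γ.jet 1 (τ v : UnitAddCircle) := rfl
  have hlen : (h.reparamFun γ).len = γ.len := by
    rw [CkLoop.len, hV]
    exact h.length_comp (V := fun v : ℝ => γ.jet 1 (v : UnitAddCircle)) h1
      (loop_periodic (γ.jet 1))
  have hw : Continuous fun v : ℝ =>
      (‖γ.jet 1 (v : UnitAddCircle)‖ / γ.len) • γ.jet 0 (v : UnitAddCircle) := by fun_prop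
  rw [CkLoop.smoothed_coe_eq_shiftConv (CkLoop.len_pos_of_isImmersed hγ),
    CkLoop.smoothed_coe_eq_shiftConv (CkLoop.len_pos_of_isImmersed (h.isImmersed_reparamFun hγ)),
    hlen, hV]
  have e : ∀ v : ℝ, (‖(h.reparamFun γ).jet 1 (v : UnitAddCircle)‖ / γ.len) •
      (h.reparamFun γ).jet 0 (v : UnitAddCircle) = τ' v •
        (‖γ.jet 1 (τ v : UnitAddCircle)‖ / γ.len) • γ.jet 0 (τ v : UnitAddCircle) := fun v => by
    rw [reparamFun_jet_one, circleDeriv_coe, h.norm_deriv_smul, mul_div_assoc, mul_smul]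
    rfl
  rw [funext e]
  exact h.shiftConv_comp (V := fun v : ℝ => γ.jet 1 (v : UnitAddCircle)) h1
    (loop_periodic (γ.jet 1)) hw x

/-- A change of parameter that leaves the initial curve invariant leaves the whole solution
invariant, because solutions are unique and the flow does not depend on the parameter. -/
theorem invariant (hlam : 0 < lam) (h : IsCircleDiffeo τ τ')
    {F : CkLoop (n + 1) → CkLoop (n + 1)} (hF : IsFlowField lam F) {X : ℝ → CkLoop (n + 1)}
    (hX : ∀ t, 0 ≤ t → HasDerivWithinAt X (F (X t)) (Ici 0) t) (h0 : IsImmersed (X 0))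
    (hG : IsTheGlobalFlow lam (X 0) X)
    (hinv : ∀ x : ℝ, (X 0).jet 0 (τ x : UnitAddCircle) = (X 0).jet 0 (x : UnitAddCircle))
    {t : ℝ} (ht : 0 ≤ t) (x : ℝ) :
    (X t).jet 0 (τ x : UnitAddCircle) = (X t).jet 0 (x : UnitAddCircle) := by
  have him : ∀ t, 0 ≤ t → IsImmersed (X t) := fun t ht =>
    hF.isImmersed_of_integral hlam (convex_Ici 0) self_mem_Ici hX h0 ht ht
  have hflow : IsCkFlow lam 2 ⊤ fun t => h.reparam (X t) := by
    refine ⟨h.reparam.contDiff.comp_contDiffOn hG.2.1.1, ?_⟩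
    rw [timeInterval_top]
    intro t ht u hu
    have h1 := isFlowField_fieldOne hlam
    have h2 := h.isImmersed_reparamFun (him t ht)
    have h3 := CkLoop.hasDerivWithinAt_jet_apply (hX t ht) 0 (τ u : UnitAddCircle)
    simp only [reparam_apply]
    rw [h1.flowField_eq h2 hu, (h1.1 _ h2 _).1, h.smoothed_reparamFun (him t ht),
      reparamFun_jet_zero, circleMap_coe, ← (hF.1 _ (him t ht) _).1]
    exact h3
  have hs : (h.reparamFun (X 0)).jet 0 = (X 0).jet 0 := by
    ext1 q
    obtain ⟨y, -, rfl⟩ := exists_coe_eq q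
    exact hinv y
  have h4 := hG.2.2 ⊤ _ hflow.isW11Flow hs t (by rw [timeInterval_top]; exact ht)
  exact DFunLike.congr_fun h4 (x : UnitAddCircle)

end IsCircleDiffeo

/-! ### Preservation of convexity -/

theorem CkLoop.continuous_jet_apply {α : Type*} [TopologicalSpace α] {k : ℕ} {Φ : α → CkLoop k}
    (hΦ : Continuous Φ) (j : Fin (k + 1)) :
    Continuous fun p : α × UnitAddCircle => (Φ p.1).jet j p.2 := by
  have h1 : Continuous fun p : α × UnitAddCircle =>
      (((Φ p.1).jet j, p.2) : C(UnitAddCircle, Plane) × UnitAddCircle) :=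
    (((jetL k j).continuous.comp hΦ).comp continuous_fst).prodMk continuous_snd
  exact ContinuousEval.continuous_eval.comp h1

section Convexity

variable {σ lam : ℝ}

/-- A change of parameter that leaves the curve invariant preserves the direction of the velocity,
so the curve makes full turns between corresponding points. -/
theorem exists_int_turning (hσ : σ ≠ 0) {γ : CkLoop 2} (him : IsImmersed γ) {τ τ' : ℝ → ℝ}
    (hτ : IsCircleDiffeo τ τ')
    (hinv : ∀ x : ℝ, γ.jet 0 (τ x : UnitAddCircle) = γ.jet 0 (x : UnitAddCircle)) (u : ℝ) :
    ∃ j : ℤ, turning σ γ u (τ u) = j * (2 * Real.pi) := by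
  have h1 : τ' u • γ.jet 1 (τ u : UnitAddCircle) = γ.jet 1 (u : UnitAddCircle) := by
    have h2 := (γ.hasDerivAt_jet_zero (τ u)).scomp u (hτ.hasDerivAt u)
    have e : ((fun y : ℝ => γ.jet 0 (y : UnitAddCircle)) ∘ τ) =
        fun y : ℝ => γ.jet 0 (y : UnitAddCircle) := funext hinv
    rw [e] at h2
    exact h2.unique (γ.hasDerivAt_jet_zero u)
  have h2 := toC_eq_mul_exp hσ γ.hasDerivAt_jet_one (loop_comp_continuous (γ.jet 2))
    (fun x => him _) u (τ u)
  have h3 : toC σ (γ.jet 1 (τ u : UnitAddCircle)) ≠ 0 := toC_ne_zero hσ (him _)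
  rw [← h1, toC_smul] at h2
  set L := logRatio σ (fun x : ℝ => γ.jet 1 (x : UnitAddCircle))
    (fun x : ℝ => γ.jet 2 (x : UnitAddCircle)) u (τ u) with hL
  have h4 : Complex.exp ((Real.log (τ' u) : ℝ) + L) = Complex.exp 0 := by
    rw [Complex.exp_add, ← Complex.ofReal_exp, Real.exp_log (hτ.pos u), Complex.exp_zero]
    apply mul_left_cancel₀ h3
    rw [mul_one]
    conv_rhs => rw [h2]
    ring
  obtain ⟨j, hj⟩ := Complex.exp_eq_exp_iff_exists_int.1 h4
  refine ⟨j, ?_⟩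
  have h5 := congrArg Complex.im hj
  simpa [hL, turning] using h5

/-- The turning angle between two fixed parameters varies continuously with the curve. -/
theorem continuous_turning {Φ : ℝ → CkLoop 2} (hΦ : Continuous Φ) (hσ : σ ≠ 0)
    (him : ∀ t, IsImmersed (Φ t)) (u v : ℝ) : Continuous fun t => turning σ (Φ t) u v := by
  refine Complex.continuous_im.comp ?_
  refine intervalIntegral.continuous_parametric_intervalIntegral_of_continuous' ?_ u v
  have hc : Continuous fun p : ℝ × ℝ => (p.1, (p.2 : UnitAddCircle)) :=
    continuous_fst.prodMk ((AddCircle.continuous_mk' 1).comp continuous_snd)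
  exact ((toCL σ).continuous.comp ((CkLoop.continuous_jet_apply hΦ 2).comp hc)).div
    ((toCL σ).continuous.comp ((CkLoop.continuous_jet_apply hΦ 1).comp hc))
    fun p => toC_ne_zero hσ (him _ _)

/-- A continuous function with values in a lattice is constant. -/
theorem eq_of_continuous_of_forall_int_mul {f : ℝ → ℝ} (hf : Continuous f) {c : ℝ} (hc : 0 < c)
    (h : ∀ t, ∃ j : ℤ, f t = j * c) (s t : ℝ) : f s = f t := by
  wlog hst : f s < f t generalizing s t
  · rcases (not_lt.1 hst).eq_or_lt with h1 | h1
    · exact h1.symm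
    · exact (this t s h1).symm
  exfalso
  obtain ⟨i, hi⟩ := h s
  obtain ⟨j, hj⟩ := h t
  have hij : i + 1 ≤ j := by
    have : (i : ℝ) < j := lt_of_mul_lt_mul_right (by rwa [← hi, ← hj]) hc.le
    exact_mod_cast this
  have hij' : (i : ℝ) + 1 ≤ j := by exact_mod_cast hij
  obtain ⟨r, hr⟩ := mem_range_of_exists_le_of_exists_ge hf (c := (i + 1 / 2) * c)
    ⟨s, by rw [hi]; nlinarith⟩ ⟨t, by rw [hj]; nlinarith⟩
  obtain ⟨l, hl⟩ := h r
  have h1 : (l : ℝ) = i + 1 / 2 := mul_right_cancel₀ hc.ne' (hl.symm.trans hr)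
  have h2 : (2 * l : ℝ) = 2 * i + 1 := by linarith
  have h3 : 2 * l = 2 * i + 1 := by exact_mod_cast h2
  omega

variable {X : ℝ → CkLoop 2}

theorem curvature_nonneg_iff {γ : CkLoop 2} (him : IsImmersed γ) (q : UnitAddCircle) :
    0 ≤ σ * signedCurvature γ q ↔ 0 ≤ wedge σ (γ.jet 1 q) (γ.jet 2 q) := by
  have : 0 < ‖γ.jet 1 q‖ := norm_pos_iff.2 (him q)
  rw [sign_mul_signedCurvature, le_div_iff₀ (by positivity), zero_mul]

/-- As long as the curvature is nonnegative, the curve lies on one side of its tangents, because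
its turning number is that of the initial curve. -/
theorem chordCondition_of_curvature_nonneg (hσ : σ ≠ 0) {γ : CkLoop 2} (him : IsImmersed γ)
    (hk : ∀ q, 0 ≤ wedge σ (γ.jet 1 q) (γ.jet 2 q)) {τ : ℤ → ℝ → ℝ}
    (hinv : ∀ j (x : ℝ), γ.jet 0 (τ j x : UnitAddCircle) = γ.jet 0 (x : UnitAddCircle))
    (hdom : ∀ u v, ∃ j, τ j v ∈ Icc u (τ 1 u))
    (hturn : ∀ u, turning σ γ u (τ 1 u) = 2 * Real.pi) : ChordCondition σ γ := by
  intro p q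
  obtain ⟨u, -, rfl⟩ := exists_coe_eq p
  obtain ⟨v, -, rfl⟩ := exists_coe_eq q
  obtain ⟨j, hj⟩ := hdom u v
  rw [← hinv j v]
  exact wedge_nonneg_of_turning hσ γ.hasDerivAt_jet_zero γ.hasDerivAt_jet_one
    (loop_comp_continuous (γ.jet 2)) (fun x => him _) (fun x => hk _) (hinv 1 u) (hturn u) hj

/-- Where the curvature vanishes, its time derivative is a positive multiple of the component of
`P - X` on the inner side of the tangent, `P` being the averaged position. -/
theorem curvature_nonneg_of_wedge_pos (hlam : 0 < lam)
    (hX : ∀ t, 0 ≤ t → HasDerivWithinAt X (fieldTwo lam (X t)) (Ici 0) t)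
    (him : ∀ t, 0 ≤ t → IsImmersed (X t)) {a b : ℝ} (ha : 0 ≤ a) (q : UnitAddCircle)
    (hpos : ∀ t ∈ Icc a b, 0 < wedge σ ((X t).jet 1 q) ((X t).smoothed lam q - (X t).jet 0 q))
    (h0 : 0 ≤ σ * signedCurvature (X a) q) {t : ℝ} (ht : t ∈ Icc a b) :
    0 ≤ σ * signedCurvature (X t) q := by
  have hd := fun (s : ℝ) (hs : 0 ≤ s) =>
    hasDerivWithinAt_curvature (σ := σ) hlam (hX s hs) (him s hs) q
  have h := image_le_of_deriv_right_lt_deriv_boundary' (a := a) (b := b)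
    (f := fun s => -(σ * signedCurvature (X s) q)) (B := fun _ => 0) (B' := fun _ => 0)
    (fun s hs => ((hd s (ha.trans hs.1)).neg.continuousWithinAt).mono
      (Icc_subset_Ici_self.trans (Ici_subset_Ici.2 ha)))
    (fun s hs => ((hd s (ha.trans hs.1)).neg).mono (Ici_subset_Ici.2 (ha.trans hs.1)))
    (by linarith) continuousOn_const (fun s _ => hasDerivWithinAt_const _ _ _)
    (fun s hs h1 => by
      have hk : σ * signedCurvature (X s) q = 0 := by linarith
      have h2 := hpos s (Ico_subset_Icc_self hs)
      have h3 := him s (ha.trans hs.1)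
      have h4 : 0 < ‖(X s).jet 1 q‖ := norm_pos_iff.2 (h3 q)
      have h5 := CkLoop.len_pos_of_isImmersed h3
      rw [hk, mul_zero, zero_add]
      exact neg_neg_of_pos (by positivity)) ht
  linarith

/-- The evolution equation of the curvature has the coefficient `1 - 2⟨N, T⟩ ≥ -1`, because the
averaged unit tangent `N` has norm at most one, and its source is positive. -/
theorem exp_mul_curvature_monotone (hlam : 0 < lam)
    (hX : ∀ t, 0 ≤ t → HasDerivWithinAt X (fieldTwo lam (X t)) (Ici 0) t)
    (him : ∀ t, 0 ≤ t → IsImmersed (X t)) (q : UnitAddCircle)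
    (hpos : ∀ t, 0 ≤ t → 0 < wedge σ ((X t).jet 1 q) ((X t).smoothed lam q - (X t).jet 0 q))
    (hk : ∀ t, 0 ≤ t → 0 ≤ σ * signedCurvature (X t) q) {t : ℝ} (ht : 0 ≤ t) :
    σ * signedCurvature (X 0) q * Real.exp (-t / lam ^ 2) ≤ σ * signedCurvature (X t) q := by
  have hd : ∀ s, 0 ≤ s → HasDerivWithinAt
      (fun s => σ * signedCurvature (X s) q * Real.exp (s / lam ^ 2)) _ (Ici 0) s := fun s hs =>
    (hasDerivWithinAt_curvature (σ := σ) hlam (hX s hs) (him s hs) q).mul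
      (((hasDerivAt_id s).div_const (lam ^ 2)).exp).hasDerivWithinAt
  have hm : MonotoneOn (fun s => σ * signedCurvature (X s) q * Real.exp (s / lam ^ 2)) (Ici 0) := by
    refine monotoneOn_of_hasDerivWithinAt_nonneg (convex_Ici 0)
      (fun s hs => (hd s hs).continuousWithinAt)
      (fun s hs => (hd s (interior_subset hs)).mono interior_subset) fun s hs => ?_
    have hs' : 0 ≤ s := interior_subset hs
    have h3 := him s hs'
    have h4 : 0 < ‖(X s).jet 1 q‖ := norm_pos_iff.2 (h3 q)
    have h5 := CkLoop.len_pos_of_isImmersed h3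
    have h6 := hpos s hs'
    have h7 := hk s hs'
    have h8 : inner ℝ ((X s).jet 1 q) ((X s).tangent lam q) / ‖(X s).jet 1 q‖ ≤ 1 := by
      rw [div_le_one h4]
      exact (real_inner_le_norm _ _).trans
        (mul_le_of_le_one_right h4.le (CkLoop.norm_tangent_le hlam h5 q))
    set c := inner ℝ ((X s).jet 1 q) ((X s).tangent lam q) / ‖(X s).jet 1 q‖
    have h9 : 0 < wedge σ ((X s).jet 1 q) ((X s).smoothed lam q - (X s).jet 0 q) /
      (lam ^ 2 * (X s).len ^ 2) / ‖(X s).jet 1 q‖ := by positivity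
    set G := wedge σ ((X s).jet 1 q) ((X s).smoothed lam q - (X s).jet 0 q) /
      (lam ^ 2 * (X s).len ^ 2) / ‖(X s).jet 1 q‖
    have e : (lam ^ 2)⁻¹ * ((1 - 2 * c) * (σ * signedCurvature (X s) q) + G) *
        Real.exp (s / lam ^ 2) + σ * signedCurvature (X s) q *
          (Real.exp (s / lam ^ 2) * (1 / lam ^ 2)) =
        (lam ^ 2)⁻¹ * Real.exp (s / lam ^ 2) *
          ((2 - 2 * c) * (σ * signedCurvature (X s) q) + G) := by
      ring
    refine le_of_le_of_eq ?_ e.symm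
    have : 0 ≤ (2 - 2 * c) * (σ * signedCurvature (X s) q) := mul_nonneg (by linarith) h7
    positivity
  have h1 := hm self_mem_Ici (show t ∈ Ici 0 from ht) ht
  simp only [zero_div, Real.exp_zero, mul_one] at h1
  rw [neg_div, Real.exp_neg, ← div_eq_mul_inv, div_le_iff₀ (Real.exp_pos _)]
  exact h1

/-- The curvature of a solution that starts with a strictly convex curve stays nonnegative, and
the solution stays on one side of its tangents. -/
theorem chordCondition_of_flow (hlam : 0 < lam) (hσ : σ ≠ 0)
    (hX : ∀ t, 0 ≤ t → HasDerivWithinAt X (fieldTwo lam (X t)) (Ici 0) t)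
    (h0 : IsImmersed (X 0)) (hch : ChordCondition σ (X 0)) (hst : IsStrictChord σ (X 0))
    {t : ℝ} (ht : 0 ≤ t) :
    ChordCondition σ (X t) ∧ ∀ q, 0 ≤ wedge σ ((X t).jet 1 q) ((X t).jet 2 q) := by
  have hF := isFlowField_fieldTwo hlam
  have hLip := fun M m hm => exists_bounds_fieldTwo (lam := lam) (m := m) hlam hm M
  have him : ∀ t, 0 ≤ t → IsImmersed (X t) := fun t ht =>
    hF.isImmersed_of_integral hlam (convex_Ici 0) self_mem_Ici hX h0 ht ht
  obtain ⟨τ, τ', hτ, hinv0, hdom, hturn0⟩ := exists_deck hσ h0 hch hst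
  have hinv : ∀ t, 0 ≤ t → ∀ j (x : ℝ),
      (X t).jet 0 (τ j x : UnitAddCircle) = (X t).jet 0 (x : UnitAddCircle) := fun t ht j x =>
    (hτ j).invariant hlam hF hX h0 (hF.isTheGlobalFlow hlam hLip h0 hX) (hinv0 j) ht x
  have hXc : ContinuousOn X (Ici 0) := fun t ht => (hX t ht).continuousWithinAt
  -- constant extension to negative times
  set Φ : ℝ → CkLoop 2 := fun t => X (max t 0) with hΦ
  have hΦc : Continuous Φ := hXc.comp_continuous (continuous_id.max continuous_const)
    fun t => mem_Ici.2 (le_max_right t 0)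
  have hΦim : ∀ t, IsImmersed (Φ t) := fun t => him _ (le_max_right _ _)
  have hΦX : ∀ t, 0 ≤ t → Φ t = X t := fun t ht => by simp only [hΦ, max_eq_left ht]
  have hturn : ∀ t, 0 ≤ t → ∀ u, turning σ (X t) u (τ 1 u) = 2 * Real.pi := by
    intro t ht u
    have := eq_of_continuous_of_forall_int_mul (continuous_turning hΦc hσ hΦim u (τ 1 u))
      Real.two_pi_pos (fun s => exists_int_turning hσ (hΦim s) (hτ 1)
        (hinv _ (le_max_right s 0) 1) u) t 0
    rw [hΦX t ht, hΦX 0 le_rfl, hturn0] at this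
    exact this
  have hchord : ∀ t, 0 ≤ t → (∀ q, 0 ≤ wedge σ ((X t).jet 1 q) ((X t).jet 2 q)) →
      ChordCondition σ (X t) := fun t ht hk =>
    chordCondition_of_curvature_nonneg hσ (him t ht) hk (hinv t ht) hdom (hturn t ht)
  have hFΦ : Continuous fun t => fieldTwo lam (Φ t) := continuous_iff_continuousAt.2 fun t =>
    ContinuousAt.comp (IsFlowField.continuousAt hLip (hΦim t)) hΦc.continuousAt
  have hW : Continuous fun p : ℝ × UnitAddCircle =>
      wedge σ ((Φ p.1).jet 1 p.2) ((fieldTwo lam (Φ p.1)).jet 0 p.2) :=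
    Continuous.wedge (CkLoop.continuous_jet_apply hΦc 1) (CkLoop.continuous_jet_apply hFΦ 0)
  have hWe : ∀ t q, wedge σ ((Φ t).jet 1 q) ((fieldTwo lam (Φ t)).jet 0 q) =
      (lam ^ 2)⁻¹ * wedge σ ((Φ t).jet 1 q) ((Φ t).smoothed lam q - (Φ t).jet 0 q) :=
    fun t q => by rw [(hF.1 _ (hΦim t) q).1, wedge_smul_right]
  have hl : 0 < (lam ^ 2)⁻¹ := by positivity
  set S : Set ℝ := {s | ∀ q, 0 ≤ wedge σ ((Φ s).jet 1 q) ((Φ s).jet 2 q)} with hS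
  have hSc : IsClosed S := by
    have : S = ⋂ q, {s | 0 ≤ wedge σ ((Φ s).jet 1 q) ((Φ s).jet 2 q)} := by
      ext s; simp [hS]
    rw [this]
    refine isClosed_iInter fun q => isClosed_le continuous_const ?_
    have hq : Continuous fun s : ℝ => (s, q) := by fun_prop
    exact Continuous.wedge ((CkLoop.continuous_jet_apply hΦc 1).comp hq)
      ((CkLoop.continuous_jet_apply hΦc 2).comp hq)
  have h0S : (0 : ℝ) ∈ S := fun q => by
    rw [hΦX 0 le_rfl]; exact hch.wedge_nonneg q
  -- nonnegative curvature at a time gives the chord condition, hence a positive source in the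
  -- evolution of the curvature, uniformly on the circle and for a short time
  have hsub : Icc 0 t ⊆ S := by
    refine (hSc.inter isClosed_Icc).Icc_subset_of_forall_exists_gt h0S ?_
    rintro s ⟨hsS, hs⟩ y hy
    have hk : ∀ q, 0 ≤ wedge σ ((X s).jet 1 q) ((X s).jet 2 q) := by
      rw [← hΦX s hs.1]; exact hsS
    have hpos := fun q => (hchord s hs.1 hk).smoothed_pos hσ hlam (him s hs.1) q
    have hev := (isCompact_univ (X := UnitAddCircle)).eventually_forall_of_forall_eventually
      (x₀ := s) (P := fun r q => 0 < wedge σ ((Φ r).jet 1 q) ((fieldTwo lam (Φ r)).jet 0 q))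
      fun q _ => by
        refine hW.continuousAt.eventually (lt_mem_nhds ?_)
        beta_reduce
        rw [hWe, hΦX s hs.1]
        exact mul_pos hl (hpos q)
    obtain ⟨ε, hε, hball⟩ := Metric.eventually_nhds_iff.1 hev
    have hr : s < min y (s + ε / 2) := lt_min hy (by linarith)
    refine ⟨min y (s + ε / 2), fun q => ?_, hr, min_le_left _ _⟩
    have hr0 : 0 ≤ min y (s + ε / 2) := hs.1.trans hr.le
    rw [hΦX _ hr0, ← curvature_nonneg_iff (him _ hr0)]
    refine curvature_nonneg_of_wedge_pos hlam hX him hs.1 (b := min y (s + ε / 2)) q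
      (fun r hr' => ?_) ((curvature_nonneg_iff (him _ hs.1) q).2 (hk q)) ⟨hr.le, le_rfl⟩
    have h1 := hball (y := r) (by
      rw [Real.dist_eq, abs_of_nonneg (by linarith [hr'.1])]
      linarith [hr'.2, min_le_right y (s + ε / 2)]) q (mem_univ q)
    rw [hWe, hΦX r (hs.1.trans hr'.1)] at h1
    exact pos_of_mul_pos_right h1 hl.le
  have hk : ∀ q, 0 ≤ wedge σ ((X t).jet 1 q) ((X t).jet 2 q) := by
    rw [← hΦX t ht]; exact hsub ⟨ht, le_rfl⟩
  exact ⟨hchord t ht hk, hk⟩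

end Convexity

theorem preservation_of_convexity {lam : ℝ} (hlam : 0 < lam) {X₀ : CkLoop 2} (h0 : IsImmersed X₀)
    (hconv : BoundsStrictlyConvexDomain X₀) :
    ∃ X : ℝ → CkLoop 2, IsTheGlobalFlow lam X₀ X ∧
        ∃ σ : ℝ, (σ = 1 ∨ σ = -1) ∧ (∀ u, 0 ≤ σ * signedCurvature X₀ u) ∧
        (∀ t : ℝ, 0 ≤ t →
          IsImmersed (X t) ∧ BoundsConvexSet (X t) ∧
          ∀ u, σ * signedCurvature X₀ u * Real.exp (-t / lam ^ 2)
            ≤ σ * signedCurvature (X t) u) ∧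
        ∀ a : ℝ, ∃ (T : EReal) (φ : ℝ → ℝ),
          (2 ≤ a → T = ⊤) ∧ IsTimeChange a X T φ ∧
          IsTheMaximalFlow lam a X₀ T (fun t => X (φ t)) ∧
          ∀ t ∈ timeInterval T,
            IsImmersed (X (φ t)) ∧ BoundsConvexSet (X (φ t)) ∧
            ∀ u, σ * signedCurvature X₀ u * Real.exp (-φ t / lam ^ 2)
              ≤ σ * signedCurvature (X (φ t)) u := by
  obtain ⟨X, rfl, hX⟩ := exists_global_two hlam h0
  obtain ⟨σ, hσ, hch, hst⟩ := hconv.exists_chordCondition h0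
  have hσ0 : σ ≠ 0 := by rcases hσ with rfl | rfl <;> norm_num
  have hF := isFlowField_fieldTwo hlam
  have hLip := fun M m hm => exists_bounds_fieldTwo (lam := lam) (m := m) hlam hm M
  have him : ∀ t, 0 ≤ t → IsImmersed (X t) := fun t ht =>
    hF.isImmersed_of_integral hlam (convex_Ici 0) self_mem_Ici hX h0 ht ht
  have hC := fun t ht => chordCondition_of_flow hlam hσ0 hX h0 hch hst (t := t) ht
  have hk : ∀ t, 0 ≤ t → ∀ q, 0 ≤ σ * signedCurvature (X t) q := fun t ht q =>
    (curvature_nonneg_iff (him t ht) q).2 ((hC t ht).2 q)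
  have key : ∀ t, 0 ≤ t → IsImmersed (X t) ∧ BoundsConvexSet (X t) ∧
      ∀ u, σ * signedCurvature (X 0) u * Real.exp (-t / lam ^ 2)
        ≤ σ * signedCurvature (X t) u := fun t ht =>
    ⟨him t ht, (hC t ht).1.boundsConvexSet hσ0 (him t ht), fun q =>
      exp_mul_curvature_monotone hlam hX him q
        (fun s hs => (hC s hs).1.smoothed_pos hσ0 hlam (him s hs) q) (fun s hs => hk s hs q) ht⟩
  refine ⟨X, hF.isTheGlobalFlow hlam hLip h0 hX, σ, hσ, hk 0 le_rfl, key, fun a => ?_⟩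
  obtain ⟨T, φ, h1, h2, h3⟩ := exists_timeChange hlam (hF.isCkFlow hlam hLip h0 hX)
    (fun t ht => CkLoop.len_pos_of_isImmersed (him t ht)) (fun t ht => hF.len_le hlam hX ht) a
  exact ⟨T, φ, h1, h2, h3, fun t ht => key _ (h2.2.2.1.mapsTo ht)⟩

end SobolevLengthFlow

end

open SobolevLengthFlow in
theorem theorem1p2 (lam : ℝ) (hlam : 0 < lam) :
    -- preservation of immersion
    (∀ X₀ : CkLoop 1, IsImmersed X₀ →
      ∃ X : ℝ → CkLoop 1, IsTheGlobalFlow lam X₀ X ∧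
        (∀ t : ℝ, 0 ≤ t →
          IsImmersed (X t) ∧ SpeedSqBound (X t) X₀ (Real.exp (-4 * t / lam ^ 2))) ∧
        -- the flow with a general parameter `a`
        ∀ a : ℝ, ∃ (T : EReal) (φ : ℝ → ℝ),
          (2 ≤ a → T = ⊤) ∧ IsTimeChange a X T φ ∧
          IsTheMaximalFlow lam a X₀ T (fun t => X (φ t)) ∧
          ∀ t ∈ timeInterval T,
            IsImmersed (X (φ t)) ∧
            SpeedSqBound (X (φ t)) X₀ (Real.exp (-4 * φ t / lam ^ 2))) ∧
    -- preservation of convexity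
    (∀ X₀ : CkLoop 2, IsImmersed X₀ → BoundsStrictlyConvexDomain X₀ →
      ∃ X : ℝ → CkLoop 2, IsTheGlobalFlow lam X₀ X ∧
        -- `σ` is the sign for which `σ * signedCurvature` is the curvature with respect to
        -- the inward normal of the initial convex curve
        ∃ σ : ℝ, (σ = 1 ∨ σ = -1) ∧ (∀ u, 0 ≤ σ * signedCurvature X₀ u) ∧
        (∀ t : ℝ, 0 ≤ t →
          IsImmersed (X t) ∧ BoundsConvexSet (X t) ∧
          ∀ u, σ * signedCurvature X₀ u * Real.exp (-t / lam ^ 2)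
            ≤ σ * signedCurvature (X t) u) ∧
        -- the flow with a general parameter `a`
        ∀ a : ℝ, ∃ (T : EReal) (φ : ℝ → ℝ),
          (2 ≤ a → T = ⊤) ∧ IsTimeChange a X T φ ∧
          IsTheMaximalFlow lam a X₀ T (fun t => X (φ t)) ∧
          ∀ t ∈ timeInterval T,
            IsImmersed (X (φ t)) ∧ BoundsConvexSet (X (φ t)) ∧
            ∀ u, σ * signedCurvature X₀ u * Real.exp (-φ t / lam ^ 2)
              ≤ σ * signedCurvature (X (φ t)) u) := by
  exact ⟨fun _ h => preservation_of_immersion hlam h,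
    fun _ h hconv => preservation_of_convexity hlam h hconv⟩
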